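/- **Setting.** Fix a set $\Sigma_e$ of edge labels and a disjoint set $\Sigma_n$ of data values, whose elements are coded injectively by bit strings; $|x|$ is the length of the code of $x$. A (finite) data-graph is $G=(V,L,D)$ with $V$ a finite set of nodes, $L:V\times V\to\mathcal P(\Sigma_e)$ with finite values, and $D:V\to\Sigma_n$; put $E=\{(v,a,w): a\in L(v,w)\}$, $|G|=|V|+|E|$, and let $G^f=V\cup E$ be its set of facts. Write $G\subseteq G'$ if $V\subseteq V'$, $L(v,w)\subseteq L'(v,w)$ and $D(v)=D'(v)$ for $v,w\in V$. GXPath path expressions $\alpha$ and node expressions $\varphi$ are given by $$\alpha=\varepsilon\mid \_\mid a\mid a^-\mid[\varphi]\mid\alpha\cdot\alpha\mid\alpha\cup\alpha\mid\alpha\cap\alpha\mid\alpha^*\mid\overline{\alpha}\mid\alpha^{n,m},\qquad \varphi=\neg\varphi\mid\varphi\wedge\varphi\mid\varphi\vee\varphi\mid c^=\mid c^{\neq}\mid\langle\alpha\rangle\mid\langle\alpha=\beta\rangle\mid\langle\alpha\neq\beta\rangle$$ with $a\in\Sigma_e$, $c\in\Sigma_n$, $n,m\in\mathbb N$. In a data-graph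 $G$, path expressions denote sets $[\![\alpha]\!]_G\subseteq V^2$: $\varepsilon$ is the identity, $\_$ consists of the pairs with $L(u,v)\ne\emptyset$, $a$ (resp. $a^-$) of the pairs with $a\in L(u,v)$ (resp. $a\in L(v,u)$), $[\varphi]$ is the identity on $[\![\varphi]\!]_G$, $\cdot,\cup,\cap$ are composition, union and intersection, $\alpha^*$ is the reflexive transitive closure, $\overline\alpha$ the complement in $V^2$, and $\alpha^{n,m}=\bigcup_{k=n}^m\alpha^k$. Node expressions denote sets $[\![\varphi]\!]_G\subseteq V$: Boolean connectives are as usual, $c^=$ (resp. $c^{\ne}$) consists of the nodes whose data value is (resp. is not) $c$, $\langle\alpha\rangle$ of the nodes $u$ with some $(u,v)\in[\![\alpha]\!]_G$, and $\langle\alpha=\beta\rangle$ (resp. $\langle\alpha\ne\beta\rangle$) of the $u$ with $(u,u_1)\in[\![\alpha]\!]_G$, $(u,u_2)\in[\![\beta]\!]_G$ and $D(u_1)=D(u_2)$ (resp. $\neq$) for some $u_1,u_2$. For a finite set $R$ of expressions, $G\models R$ means that $[\![\varphi]\!]_G=V$ and $[\![\alpha]\!]_G=V^2$ for all node expressions $\varphi\in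 R$ and path expressions $\alpha\in R$. For a preorder $\preccurlyeq$ on the subsets of $G$, write $H\prec K$ if $H\preccurlyeq K$ and not $K\preccurlyeq H$. A $\preccurlyeq$-repair of $G$ with respect to $R$ is a data-graph $H\subseteq G$ with $H\models R$ for which there is no $K\subseteq G$ with $K\models R$ and $H\prec K\preccurlyeq G$. We consider the following criteria. * $\subseteq_P$ and $\leq_P$, for a partition $P=(P_1,\dots,P_\ell)$ of $G^f$ into priority levels: $G_1\subseteq_P G_2$ iff $G_1^f\cap P_i=G_2^f\cap P_i$ for all $i$, or there is $i$ with $G_1^f\cap P_i\subsetneq G_2^f\cap P_i$ and $G_1^f\cap P_j=G_2^f\cap P_j$ for all $j<i$; $G_1\leq_P G_2$ is defined likewise by comparing the cardinalities $|G_1^f\cap P_i|$ and $|G_2^f\cap P_i|$ with $=$ and $<$. * $\leq$: $G_1\leq G_2$ iff $|G_1|\leq|G_2|$. * $\leq_w$, for a fixed $w:\Sigma_e\sqcup\Sigma_n\to\mathbb N$ that is computable in polynomial time (with values in binary) and satisfies $w(x)=O(2^{|x|})$: $G_1\leq_w G_2$ iff $w(G_1)\leq w(G_2)$, where $w(G)=\sum_{v\in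 V}w(D(v))+\sum_{(u,a,v)\in E}w(a)$. * $\preccurlyeq_{\mathcal M}$, for a fixed partial order on $\Sigma_e\sqcup\Sigma_n$: let $G^{\mathcal M}(a)=|[\![a]\!]_G|$ for $a\in\Sigma_e$ and $G^{\mathcal M}(c)=|[\![c^=]\!]_G|$ for $c\in\Sigma_n$; then $G_1\preccurlyeq_{\mathcal M}G_2$ iff $G_1^{\mathcal M}=G_2^{\mathcal M}$ or for every $x$ with $G_1^{\mathcal M}(x)>G_2^{\mathcal M}(x)$ there is $y>x$ with $G_1^{\mathcal M}(y)<G_2^{\mathcal M}(y)$. It is assumed that, given two data-graphs $G_1,G_2$, it can be decided in polynomial time whether $G_1\preccurlyeq_{\mathcal M}G_2$. For sets $\mathcal L,\mathcal Q$ of GXPath expressions, the problem $\mathrm{CQA}_{\preccurlyeq}$ is: given a data-graph $G$, a finite set $R\subseteq\mathcal L$, a path expression $q\in\mathcal Q$, two nodes $v,w$ of $G$ and, for $\preccurlyeq\,\in\{\subseteq_P,\leq_P\}$, also the partition $P$, decide whether $(v,w)\in[\![q]\!]_H$ for every $\preccurlyeq$-repair $H$ of $G$ with respect to $R$. Inputs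 are written as bit strings, with numbers in binary. $\Delta^p_2$ is the class of problems solvable in deterministic polynomial time with an NP oracle, $\Delta^p_2[\log n]$ is the same with $O(\log|x|)$ oracle calls on inputs $x$, and $\Pi^p_2$ consists of the complements of the problems solvable in nondeterministic polynomial time with an NP oracle. **Theorem.** For all sets $\mathcal L,\mathcal Q$ of GXPath expressions: 1. $\mathrm{CQA}_{\subseteq_P}$ and $\mathrm{CQA}_{\preccurlyeq_{\mathcal M}}$ are in $\Pi^p_2$; 2. $\mathrm{CQA}_{\leq}$ is in $\Delta^p_2[\log n]$; 3. $\mathrm{CQA}_{\leq_w}$ and $\mathrm{CQA}_{\leq_P}$ are in $\Delta^p_2$. -/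

import Mathlib

universe u v

/-! ## Oracle machines and complexity classes -/

namespace Machine

/-- Programs for a machine with finitely many stacks of bits (registers `0, 1, 2, …`, of which a
program mentions only finitely many), i.e. structured programs for a multitape Turing machine.
Every instruction touches only the top bit of a stack. -/
inductive Cmd : Type
  | skip : Cmd
  | push (r : ℕ) (b : Bool) : Cmd
  | pop (r : ℕ) : Cmd
  | seq (c d : Cmd) : Cmd
  /-- three-way branch: register `r` is empty / has top bit `false` / has top bit `true` -/
  | cond (r : ℕ) (onEmpty onFalse onTrue : Cmd) : Cmd
  /-- repeat `c` while register `r` is non-empty -/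
  | loop (r : ℕ) (c : Cmd) : Cmd
  /-- push a nondeterministically chosen bit on register `r` -/
  | guess (r : ℕ) : Cmd
  /-- ask the oracle about the content of register `r` and push its answer on register `a` -/
  | query (r a : ℕ) : Cmd

/-- The contents of the registers; the head of a list is the top of the stack. -/
abbrev Store : Type := ℕ → List Bool

/-- `Runs O c s t k s'`: with oracle `O`, some run of `c` from `s` halts in `s'` after exactly `t`
steps, `k` of which are oracle calls. Every instruction and every test is one step. -/
inductive Runs (O : Language Bool) : Cmd → Store → ℕ → ℕ → Store → Prop
  | skip (s : Store) : Runs O .skip s 1 0 s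
  | push (s : Store) (r : ℕ) (b : Bool) :
      Runs O (.push r b) s 1 0 (Function.update s r (b :: s r))
  | pop (s : Store) (r : ℕ) :
      Runs O (.pop r) s 1 0 (Function.update s r (s r).tail)
  | seq {c d : Cmd} {s s' s'' : Store} {t k t' k' : ℕ} :
      Runs O c s t k s' → Runs O d s' t' k' s'' → Runs O (.seq c d) s (t + t') (k + k') s''
  | cond_empty {r : ℕ} {c d e : Cmd} {s s' : Store} {t k : ℕ} :
      s r = [] → Runs O c s t k s' → Runs O (.cond r c d e) s (t + 1) k s'
  | cond_false {r : ℕ} {c d e : Cmd} {s s' : Store} {t k : ℕ} :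
      (s r).head? = some false → Runs O d s t k s' → Runs O (.cond r c d e) s (t + 1) k s'
  | cond_true {r : ℕ} {c d e : Cmd} {s s' : Store} {t k : ℕ} :
      (s r).head? = some true → Runs O e s t k s' → Runs O (.cond r c d e) s (t + 1) k s'
  | loop_done {r : ℕ} {c : Cmd} {s : Store} :
      s r = [] → Runs O (.loop r c) s 1 0 s
  | loop_step {r : ℕ} {c : Cmd} {s s' s'' : Store} {t k t' k' : ℕ} :
      s r ≠ [] → Runs O c s t k s' → Runs O (.loop r c) s' t' k' s'' →
      Runs O (.loop r c) s (t + t' + 1) (k + k') s''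
  | guess (s : Store) (r : ℕ) (b : Bool) :
      Runs O (.guess r) s 1 0 (Function.update s r (b :: s r))
  | query (s : Store) (r a : ℕ) (b : Bool) :
      (b = true ↔ s r ∈ O) → Runs O (.query r a) s 1 1 (Function.update s a (b :: s a))

/-- The program contains no nondeterministic instruction. -/
def Cmd.Deterministic : Cmd → Prop
  | .seq c d => c.Deterministic ∧ d.Deterministic
  | .cond _ c d e => c.Deterministic ∧ d.Deterministic ∧ e.Deterministic
  | .loop _ c => c.Deterministic
  | .guess _ => False
  | _ => True

/-- The program contains no oracle call. -/
def Cmd.OracleFree : Cmd → Prop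
  | .seq c d => c.OracleFree ∧ d.OracleFree
  | .cond _ c d e => c.OracleFree ∧ d.OracleFree ∧ e.OracleFree
  | .loop _ c => c.OracleFree
  | .query _ _ => False
  | _ => True

/-- The input is in register `0`; all other registers are empty. -/
def start (x : List Bool) : Store := fun r => if r = 0 then x else []

/-- A halting store is accepting if the top of register `0` is `true`. -/
def Accepting (s : Store) : Prop := (s 0).head? = some true

/-- `c` with oracle `O` has an accepting run on `x` of at most `T` steps. -/
def AcceptsWithin (O : Language Bool) (c : Cmd) (x : List Bool) (T : ℕ) : Prop :=
  ∃ t k s, Runs O c (start x) t k s ∧ t ≤ T ∧ Accepting s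

/-- `NP`: languages accepted by a nondeterministic machine without oracle in polynomial time. -/
def NP (L : Language Bool) : Prop :=
  ∃ (c : Cmd) (p : Polynomial ℕ), c.OracleFree ∧
    ∀ x, x ∈ L ↔ AcceptsWithin 0 c x (p.eval x.length)

/-- A decision problem: its instances, the strings that represent an instance, and the
yes-instances. An instance may have several representations (a set can be listed in any order);
an algorithm has to be correct on each of them. -/
structure Problem where
  Inst : Type*
  Codes : Inst → List Bool → Prop
  Yes : Inst → Prop

/-- The complementary problem. -/
def Problem.compl (Q : Problem) : Problem := ⟨Q.Inst, Q.Codes, fun I => ¬ Q.Yes I⟩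

/-- `PTIME`. -/
def InP (Q : Problem) : Prop :=
  ∃ (c : Cmd) (p : Polynomial ℕ), c.Deterministic ∧ c.OracleFree ∧
    ∀ I x, Q.Codes I x → ∃ t k s, Runs 0 c (start x) t k s ∧
      t ≤ p.eval x.length ∧ (Accepting s ↔ Q.Yes I)

/-- `Δ₂ᵖ`: deterministic polynomial time with an oracle in `NP`. -/
def InDelta2 (Q : Problem) : Prop :=
  ∃ (O : Language Bool) (c : Cmd) (p : Polynomial ℕ), NP O ∧ c.Deterministic ∧
    ∀ I x, Q.Codes I x → ∃ t k s, Runs O c (start x) t k s ∧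
      t ≤ p.eval x.length ∧ (Accepting s ↔ Q.Yes I)

/-- `Δ₂ᵖ[log n]`: deterministic polynomial time with `O(log n)` calls to an oracle in `NP`. -/
def InDelta2Log (Q : Problem) : Prop :=
  ∃ (O : Language Bool) (c : Cmd) (p : Polynomial ℕ) (C : ℕ), NP O ∧ c.Deterministic ∧
    ∀ I x, Q.Codes I x → ∃ t k s, Runs O c (start x) t k s ∧
      t ≤ p.eval x.length ∧ k ≤ C * (Nat.log 2 x.length + 1) ∧ (Accepting s ↔ Q.Yes I)

/-- `Σ₂ᵖ`: nondeterministic polynomial time with an oracle in `NP`. -/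
def InSigma2 (Q : Problem) : Prop :=
  ∃ (O : Language Bool) (c : Cmd) (p : Polynomial ℕ), NP O ∧
    ∀ I x, Q.Codes I x → (Q.Yes I ↔ AcceptsWithin O c x (p.eval x.length))

/-- `Π₂ᵖ`: the complements of the problems in `Σ₂ᵖ`. -/
def InPi2 (Q : Problem) : Prop := InSigma2 Q.compl

/-- A set whose elements are coded injectively by bit strings. -/
class Coded (α : Type*) where
  code : α → List Bool
  code_injective : Function.Injective code

/-- Elements of a disjoint union are coded by a tag bit and the code of the element. -/
instance {α β : Type*} [Coded α] [Coded β] : Coded (α ⊕ β) where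
  code := Sum.elim (fun a => false :: Coded.code a) (fun b => true :: Coded.code b)
  code_injective := by
    rintro (a | a) (b | b) h
    · exact congrArg _ (Coded.code_injective (List.cons.inj h).2)
    · exact absurd (List.cons.inj h).1 (by decide)
    · exact absurd (List.cons.inj h).1 (by decide)
    · exact congrArg _ (Coded.code_injective (List.cons.inj h).2)

/-- `f` is computable in polynomial time, with values written in binary. -/
def PolyTimeComputable {α : Type*} [Coded α] (f : α → ℕ) : Prop :=
  ∃ (c : Cmd) (p : Polynomial ℕ), c.Deterministic ∧ c.OracleFree ∧
    ∀ a : α, ∃ t k s, Runs 0 c (start (Coded.code a)) t k s ∧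
      t ≤ p.eval (Coded.code a).length ∧ s 0 = Nat.bits (f a)

/-! Self-delimiting codes, to be concatenated. -/

/-- A bit string: every bit is preceded by `true`, and `false` marks the end. -/
def encStr (x : List Bool) : List Bool := x.flatMap (fun b => [true, b]) ++ [false]

/-- A natural number in binary. -/
def encNat (n : ℕ) : List Bool := encStr (Nat.bits n)

/-- A list: every entry is preceded by `true`, and `false` marks the end. -/
def encList {α : Type*} (enc : α → List Bool) (l : List α) : List Bool :=
  l.flatMap (fun a => true :: enc a) ++ [false]

/-- A constructor number, in unary. -/
def encTag (n : ℕ) : List Bool := List.replicate n true ++ [false]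

/-- `l` lists the elements of `S`, each exactly once. -/
def Enumerates {α : Type*} (l : List α) (S : Finset α) : Prop := (l : Multiset α) = S.val

end Machine

/-! ## Data-graphs, GXPath and prioritized repairs -/

namespace GXPath

open Machine

/-- A finite data-graph with edge labels in `Lab` and data values in `Val`. Nodes are named by
natural numbers; `(v, a, w) ∈ E` says that `a ∈ L(v, w)`. -/
structure DataGraph (Lab : Type u) (Val : Type v) where
  V : Finset ℕ
  E : Finset (ℕ × Lab × ℕ)
  src_mem : ∀ e ∈ E, e.1 ∈ V
  tgt_mem : ∀ e ∈ E, e.2.2 ∈ V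
  D : (v : ℕ) → v ∈ V → Val

mutual
/-- Path expressions. -/
inductive PathExpr (Lab : Type u) (Val : Type v) : Type (max u v)
  | eps : PathExpr Lab Val
  | wild : PathExpr Lab Val
  | lab (a : Lab) : PathExpr Lab Val
  | inv (a : Lab) : PathExpr Lab Val
  | test (φ : NodeExpr Lab Val) : PathExpr Lab Val
  | comp (α β : PathExpr Lab Val) : PathExpr Lab Val
  | union (α β : PathExpr Lab Val) : PathExpr Lab Val
  | inter (α β : PathExpr Lab Val) : PathExpr Lab Val
  | star (α : PathExpr Lab Val) : PathExpr Lab Val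
  | compl (α : PathExpr Lab Val) : PathExpr Lab Val
  /-- `α^{n,m}` -/
  | iter (α : PathExpr Lab Val) (n m : ℕ) : PathExpr Lab Val

/-- Node expressions. -/
inductive NodeExpr (Lab : Type u) (Val : Type v) : Type (max u v)
  | not (φ : NodeExpr Lab Val) : NodeExpr Lab Val
  | and (φ ψ : NodeExpr Lab Val) : NodeExpr Lab Val
  | or (φ ψ : NodeExpr Lab Val) : NodeExpr Lab Val
  | dataEq (c : Val) : NodeExpr Lab Val
  | dataNe (c : Val) : NodeExpr Lab Val
  /-- `⟨α⟩` -/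
  | ex (α : PathExpr Lab Val) : NodeExpr Lab Val
  /-- `⟨α = β⟩` -/
  | exEq (α β : PathExpr Lab Val) : NodeExpr Lab Val
  /-- `⟨α ≠ β⟩` -/
  | exNe (α β : PathExpr Lab Val) : NodeExpr Lab Val
end

/-- All GXPath expressions: path expressions and node expressions. -/
abbrev Expr (Lab : Type u) (Val : Type v) : Type (max u v) := PathExpr Lab Val ⊕ NodeExpr Lab Val

/-- `k`-fold composition of a binary relation on `V`. -/
def relPow (V : Finset ℕ) (S : Set (ℕ × ℕ)) : ℕ → Set (ℕ × ℕ)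
  | 0 => {p | p.1 ∈ V ∧ p.1 = p.2}
  | k + 1 => {p | ∃ z, (p.1, z) ∈ S ∧ (z, p.2) ∈ relPow V S k}

mutual
/-- The semantics of a path expression, a set of pairs of nodes. -/
def pathSem {Lab : Type u} {Val : Type v} (G : DataGraph Lab Val) : PathExpr Lab Val → Set (ℕ × ℕ)
  | .eps => {p | p.1 ∈ G.V ∧ p.1 = p.2}
  | .wild => {p | ∃ a, (p.1, a, p.2) ∈ G.E}
  | .lab a => {p | (p.1, a, p.2) ∈ G.E}
  | .inv a => {p | (p.2, a, p.1) ∈ G.E}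
  | .test φ => {p | p.1 ∈ nodeSem G φ ∧ p.1 = p.2}
  | .comp α β => {p | ∃ z, (p.1, z) ∈ pathSem G α ∧ (z, p.2) ∈ pathSem G β}
  | .union α β => pathSem G α ∪ pathSem G β
  | .inter α β => pathSem G α ∩ pathSem G β
  | .star α => {p | p.1 ∈ G.V ∧ Relation.ReflTransGen (fun u v => (u, v) ∈ pathSem G α) p.1 p.2}
  | .compl α => {p | p.1 ∈ G.V ∧ p.2 ∈ G.V ∧ p ∉ pathSem G α}
  | .iter α n m => {p | ∃ k, n ≤ k ∧ k ≤ m ∧ p ∈ relPow G.V (pathSem G α) k}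

/-- The semantics of a node expression, a set of nodes. -/
def nodeSem {Lab : Type u} {Val : Type v} (G : DataGraph Lab Val) : NodeExpr Lab Val → Set ℕ
  | .not φ => {u | u ∈ G.V ∧ u ∉ nodeSem G φ}
  | .and φ ψ => nodeSem G φ ∩ nodeSem G ψ
  | .or φ ψ => nodeSem G φ ∪ nodeSem G ψ
  | .dataEq c => {u | ∃ h : u ∈ G.V, G.D u h = c}
  | .dataNe c => {u | ∃ h : u ∈ G.V, G.D u h ≠ c}
  | .ex α => {u | ∃ v, (u, v) ∈ pathSem G α}
  | .exEq α β => {u | ∃ (v w : ℕ) (hv : v ∈ G.V) (hw : w ∈ G.V),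
      (u, v) ∈ pathSem G α ∧ (u, w) ∈ pathSem G β ∧ G.D v hv = G.D w hw}
  | .exNe α β => {u | ∃ (v w : ℕ) (hv : v ∈ G.V) (hw : w ∈ G.V),
      (u, v) ∈ pathSem G α ∧ (u, w) ∈ pathSem G β ∧ G.D v hv ≠ G.D w hw}
end

section Repairs

variable {Lab : Type u} {Val : Type v}

/-- `G` is a subset of `G'`. -/
def DataGraph.Sub (G G' : DataGraph Lab Val) : Prop :=
  G.V ⊆ G'.V ∧ G.E ⊆ G'.E ∧ ∀ v (h : v ∈ G.V) (h' : v ∈ G'.V), G.D v h = G'.D v h'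

/-- `|G| = |V| + |E|`. -/
def DataGraph.size (G : DataGraph Lab Val) : ℕ := G.V.card + G.E.card

/-- Facts: nodes and edges. -/
abbrev Fact (Lab : Type u) : Type u := ℕ ⊕ (ℕ × Lab × ℕ)

/-- The set of facts `V ∪ E` of a data-graph. -/
def DataGraph.facts (G : DataGraph Lab Val) : Finset (Fact Lab) := G.V.disjSum G.E

/-- The facts of `G` in a given set of facts. -/
def DataGraph.factsIn (G : DataGraph Lab Val) (P : Finset (Fact Lab)) : Set (Fact Lab) :=
  {f | f ∈ G.facts ∧ f ∈ P}

/-- `G ⊨ R`. -/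
def Consistent (G : DataGraph Lab Val) (R : Finset (Expr Lab Val)) : Prop :=
  (∀ φ, Sum.inr φ ∈ R → ∀ v ∈ G.V, v ∈ nodeSem G φ) ∧
  (∀ α, Sum.inl α ∈ R → ∀ v ∈ G.V, ∀ w ∈ G.V, (v, w) ∈ pathSem G α)

/-- A preference criterion: `pref G₁ G₂` says that `G₂` is at least as preferred as `G₁`. -/
abbrev Pref (Lab : Type u) (Val : Type v) : Type (max u v) := DataGraph Lab Val → DataGraph Lab Val → Prop

/-- The strict part of a preference criterion. -/
def Strict (pref : Pref Lab Val) (G₁ G₂ : DataGraph Lab Val) : Prop :=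
  pref G₁ G₂ ∧ ¬ pref G₂ G₁

/-- `H` is a prioritized subset repair of `G` with respect to `R` and the criterion `pref`, which
compares subsets of `G`. -/
def IsRepair (pref : Pref Lab Val) (G : DataGraph Lab Val) (R : Finset (Expr Lab Val))
    (H : DataGraph Lab Val) : Prop :=
  Consistent H R ∧ H.Sub G ∧
    ¬ ∃ K : DataGraph Lab Val,
      K ≠ H ∧ K.Sub G ∧ Consistent K R ∧ Strict pref H K ∧ pref K G

/-- `P = (P₁, …, P_ℓ)` is a partition of the facts of `G` into priority levels. -/
def IsPrioritization (G : DataGraph Lab Val) (P : List (Finset (Fact Lab))) : Prop :=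
  P.Pairwise Disjoint ∧ ∀ f, f ∈ G.facts ↔ ∃ A ∈ P, f ∈ A

/-- Prioritized set inclusion `⊆_P`. -/
def prioInclusion (P : List (Finset (Fact Lab))) : Pref Lab Val := fun G₁ G₂ =>
  (∀ i : Fin P.length, G₁.factsIn (P.get i) = G₂.factsIn (P.get i)) ∨
  ∃ i : Fin P.length, G₁.factsIn (P.get i) ⊂ G₂.factsIn (P.get i) ∧
    ∀ j < i, G₁.factsIn (P.get j) = G₂.factsIn (P.get j)

/-- Cardinality `≤`. -/
def cardinality : Pref Lab Val := fun G₁ G₂ => G₁.size ≤ G₂.size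

/-- Prioritized cardinality `≤_P`. -/
def prioCardinality (P : List (Finset (Fact Lab))) : Pref Lab Val := fun G₁ G₂ =>
  (∀ i : Fin P.length, (G₁.factsIn (P.get i)).ncard = (G₂.factsIn (P.get i)).ncard) ∨
  ∃ i : Fin P.length, (G₁.factsIn (P.get i)).ncard < (G₂.factsIn (P.get i)).ncard ∧
    ∀ j < i, (G₁.factsIn (P.get j)).ncard = (G₂.factsIn (P.get j)).ncard

/-- The weight of a data-graph: the weights of the data values of its nodes and of the labels of
its edges. -/
def DataGraph.weight (w : Lab ⊕ Val → ℕ) (G : DataGraph Lab Val) : ℕ :=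
  ∑ v : G.V, w (.inr (G.D v v.2)) + ∑ e ∈ G.E, w (.inl e.2.1)

/-- Weights `≤_w`. -/
def weights (w : Lab ⊕ Val → ℕ) : Pref Lab Val := fun G₁ G₂ => G₁.weight w ≤ G₂.weight w

/-- The multiset of edges and data values of a data-graph, as a multiplicity function. -/
noncomputable def DataGraph.mset (G : DataGraph Lab Val) : Lab ⊕ Val → ℕ
  | .inl a => (pathSem G (.lab a)).ncard
  | .inr c => (nodeSem G (.dataEq c)).ncard

/-- The multiset ordering induced by a partial order `le`. -/
def msetLe {A : Type*} (le : A → A → Prop) (M₁ M₂ : A → ℕ) : Prop :=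
  M₁ = M₂ ∨ (M₁ ≠ M₂ ∧ ∀ x, M₂ x < M₁ x → ∃ y, (le x y ∧ x ≠ y) ∧ M₁ y < M₂ y)

/-- The multiset criterion. -/
def multisets (le : Lab ⊕ Val → Lab ⊕ Val → Prop) : Pref Lab Val := fun G₁ G₂ =>
  msetLe le G₁.mset G₂.mset

end Repairs

/-! ## Codes of the inputs -/

section Codes

variable {Lab : Type u} {Val : Type v} [Coded Lab] [Coded Val]

mutual
/-- The parse tree of a path expression in Polish form; counters are in binary. -/
def encPath {Lab : Type u} {Val : Type v} [Coded Lab] [Coded Val] : PathExpr Lab Val → List Bool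
  | .eps => encTag 0
  | .wild => encTag 1
  | .lab a => encTag 2 ++ encStr (Coded.code a)
  | .inv a => encTag 3 ++ encStr (Coded.code a)
  | .test φ => encTag 4 ++ encNode φ
  | .comp α β => encTag 5 ++ encPath α ++ encPath β
  | .union α β => encTag 6 ++ encPath α ++ encPath β
  | .inter α β => encTag 7 ++ encPath α ++ encPath β
  | .star α => encTag 8 ++ encPath α
  | .compl α => encTag 9 ++ encPath α
  | .iter α n m => encTag 10 ++ encPath α ++ encNat n ++ encNat m

/-- The parse tree of a node expression in Polish form. -/
def encNode {Lab : Type u} {Val : Type v} [Coded Lab] [Coded Val] : NodeExpr Lab Val → List Bool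
  | .not φ => encTag 0 ++ encNode φ
  | .and φ ψ => encTag 1 ++ encNode φ ++ encNode ψ
  | .or φ ψ => encTag 2 ++ encNode φ ++ encNode ψ
  | .dataEq c => encTag 3 ++ encStr (Coded.code c)
  | .dataNe c => encTag 4 ++ encStr (Coded.code c)
  | .ex α => encTag 5 ++ encPath α
  | .exEq α β => encTag 6 ++ encPath α ++ encPath β
  | .exNe α β => encTag 7 ++ encPath α ++ encPath β
end

def encExpr : Expr Lab Val → List Bool
  | .inl α => encTag 0 ++ encPath α
  | .inr φ => encTag 1 ++ encNode φ

def encEdge (e : ℕ × Lab × ℕ) : List Bool :=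
  encNat e.1 ++ encStr (Coded.code e.2.1) ++ encNat e.2.2

def encNodeEntry (p : ℕ × Val) : List Bool := encNat p.1 ++ encStr (Coded.code p.2)

def encFact : Fact Lab → List Bool
  | .inl v => encTag 0 ++ encNat v
  | .inr e => encTag 1 ++ encEdge e

/-- `x` lists the nodes of `G` with their data values, and then the edges of `G`. -/
def DataGraph.Codes (G : DataGraph Lab Val) (x : List Bool) : Prop :=
  ∃ (ns : List (ℕ × Val)) (es : List (ℕ × Lab × ℕ)),
    Enumerates (ns.map Prod.fst) G.V ∧ (∀ p ∈ ns, ∃ h : p.1 ∈ G.V, G.D p.1 h = p.2) ∧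
    Enumerates es G.E ∧ x = encList encNodeEntry ns ++ encList encEdge es

/-- `x` lists the expressions in `R`. -/
def CodesConstraints (R : Finset (Expr Lab Val)) (x : List Bool) : Prop :=
  ∃ rs : List (Expr Lab Val), Enumerates rs R ∧ x = encList encExpr rs

/-- `x` lists the priority levels in order, each as a list of facts. -/
def CodesPrioritization (P : List (Finset (Fact Lab))) (x : List Bool) : Prop :=
  ∃ ls : List (List (Fact Lab)), List.Forall₂ Enumerates ls P ∧ x = encList (encList encFact) ls

end Codes

/-! ## Consistent query answering -/

section CQA

/-- An input `(G, R, q, v, w)` of the problem, with `R ⊆ 𝓛` and `q ∈ 𝓠`. -/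
structure Input {Lab : Type u} {Val : Type v} (𝓛 𝓠 : Set (Expr Lab Val)) where
  G : DataGraph Lab Val
  R : Finset (Expr Lab Val)
  R_sub : ↑R ⊆ 𝓛
  q : PathExpr Lab Val
  q_mem : Sum.inl q ∈ 𝓠
  v : ℕ
  w : ℕ
  v_mem : v ∈ G.V
  w_mem : w ∈ G.V

/-- An input together with a prioritization of its data-graph. -/
structure PrioInput {Lab : Type u} {Val : Type v} (𝓛 𝓠 : Set (Expr Lab Val)) extends Input 𝓛 𝓠 where
  P : List (Finset (Fact Lab))
  isPrioritization : IsPrioritization G P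

variable {Lab : Type u} {Val : Type v} [Coded Lab] [Coded Val] {𝓛 𝓠 : Set (Expr Lab Val)}

/-- The pair `(v, w)` is an answer to `q` in every repair. -/
def Input.CertainAnswer (I : Input 𝓛 𝓠) (pref : Pref Lab Val) : Prop :=
  ∀ H, IsRepair pref I.G I.R H → (I.v, I.w) ∈ pathSem H I.q

def Input.Codes (I : Input 𝓛 𝓠) (x : List Bool) : Prop :=
  ∃ g r, I.G.Codes g ∧ CodesConstraints I.R r ∧
    x = g ++ r ++ encPath I.q ++ encNat I.v ++ encNat I.w

def PrioInput.Codes (I : PrioInput 𝓛 𝓠) (x : List Bool) : Prop :=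
  ∃ y z, I.toInput.Codes y ∧ CodesPrioritization I.P z ∧ x = y ++ z

/-- CQA for a criterion that is not part of the input. -/
def cqa (𝓛 𝓠 : Set (Expr Lab Val)) (pref : Pref Lab Val) : Problem :=
  ⟨Input 𝓛 𝓠, Input.Codes, fun I => I.CertainAnswer pref⟩

/-- CQA for a criterion that depends on a prioritization, which is part of the input. -/
def cqaPrio (𝓛 𝓠 : Set (Expr Lab Val)) (pref : List (Finset (Fact Lab)) → Pref Lab Val) :
    Problem :=
  ⟨PrioInput 𝓛 𝓠, PrioInput.Codes, fun I => I.toInput.CertainAnswer (pref I.P)⟩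

/-- The problem of comparing two given data-graphs by a criterion. -/
def comparison (pref : Pref Lab Val) : Problem :=
  ⟨DataGraph Lab Val × DataGraph Lab Val,
    fun I x => ∃ y z, I.1.Codes y ∧ I.2.Codes z ∧ x = y ++ z,
    fun I => pref I.1 I.2⟩

end CQA

end GXPath

open Machine GXPath

-- A subgraph of `G` is described by one bit per fact, so it can be guessed, and everything to be
-- checked about it is decidable in polynomial time. Indeed a path expression denotes a relation on
-- `V` and a node expression a subset of the diagonal; each operator acts on lists of pairs in
-- polynomial time. Only two operators need an idea: the star is computed by Warshall's algorithm
-- (`mem_starR`), and since the counters of `α^{n,m}` are in binary, one writes `α^{n,m} = α^n · (ε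
-- ∪ α)^{m-n}` and computes powers by repeated squaring (`mem_powR`, `mem_iterR`). Expressions are
-- evaluated in Polish form with a stack (`evals_path`, `evals_node`), and `H ⊨ R` becomes the
-- totality of a single relation (`consB_iff`).
--
-- For `Π₂ᵖ`: the pair is not a certain answer iff some consistent `H ⊆ G` misses it and no
-- consistent `K ⊆ G` with `K ≼ G` is strictly better. The machine guesses `H` and leaves the
-- existence of `K` to one NP query. This works for every criterion that can be decided in
-- polynomial time (`Setup.inPi2`), in particular for `⊆_P` and for multisets.
--
-- For `Δ₂ᵖ`: suppose that the criterion compares a number `val H`, and that `G` has the largest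
-- value among its subgraphs. The empty graph satisfies all constraints, so the values of the
-- consistent subgraphs have a maximum, and the repairs are exactly the consistent subgraphs that
-- attain it. The binary digits of this maximum are found from the top by NP queries ("is there a
-- consistent `H` whose value is at least the known prefix followed by `1`, `0`, …?"), and one last
-- query asks for a repair that misses the pair (`Setup.Valued.exists_answers`). The number of
-- queries is one plus the bit length of `val G`: polynomial in general, and logarithmic for
-- cardinality, where `val G = |G|` is at most the input length (`Setup.Valued.inDelta2Log`). The
-- criterion `≤_P` fits this scheme: a level with `k` facts present contributes the digit block of
-- `2^k - 1` in a fixed width, and the blocks are concatenated by priority (`prioDigits_le_iff`).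
--
-- On the machine side, `PF` is the class of functions between coded types that are computed by
-- deterministic oracle-free programs in polynomial time and leave no rubbish behind. It is closed
-- under composition, pairing, finite case distinction and folds with a state of polynomial size
-- (`PF.foldl`), so most algorithms are written as functional programs. The machines that guess or
-- ask an oracle are built once, in `exists_np`, `InPi2.of_exists` and `exists_adaptive`. Runs of
-- plain programs are stated for all oracles at once (`Ex`), so that the same code serves in all of
-- them.

set_option linter.unusedSectionVars false

namespace Machine

/-! ## Execution lemmas -/

infixr:60 " ;; " => Cmd.seq

/-- The store whose registers `0, 1, …` hold the entries of a list. -/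
def st (l : List (List Bool)) : Store := fun r => l.getD r []

theorem st_update (l : List (List Bool)) {r : ℕ} (h : r < l.length) (x : List Bool) :
    Function.update (st l) r x = st (l.set r x) := by
  funext q
  by_cases hq : q = r
  · subst hq; simp [st, h]
  · have : r ≠ q := fun e => hq e.symm
    simp [st, hq, List.getD, this]

theorem st_append_nil (l : List (List Bool)) (n : ℕ) : st (l ++ List.replicate n []) = st l := by
  funext q
  simp only [st, List.getD, List.getElem?_append]
  split_ifs with h
  · rfl
  · have : l[q]? = none := by simp at h; simp [h]
    rw [this]
    by_cases h' : q - l.length < n <;> simp [h']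

theorem start_eq_st (x : List Bool) : start x = st [x] := by
  funext q
  rcases q with _ | q <;> simp [start, st]

/-- With any oracle, some run of `c` leads from `s` to `s'` within `T` steps and no oracle call. -/
def Ex (c : Cmd) (s s' : Store) (T : ℕ) : Prop := ∀ O, ∃ t ≤ T, Runs O c s t 0 s'

theorem Ex.mono {c : Cmd} {s s' : Store} {T T' : ℕ} (h : Ex c s s' T) (hT : T ≤ T') :
    Ex c s s' T' := fun O => let ⟨t, ht, r⟩ := h O; ⟨t, ht.trans hT, r⟩

theorem Ex.seq {c d : Cmd} {s s' s'' : Store} {T T' : ℕ} (h : Ex c s s' T) (h' : Ex d s' s'' T') :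
    Ex (c ;; d) s s'' (T + T') := fun O =>
  let ⟨t, ht, r⟩ := h O
  let ⟨t', ht', r'⟩ := h' O
  ⟨t + t', by omega, .seq r r'⟩

theorem Ex.skip (s : Store) : Ex .skip s s 1 := fun _ => ⟨1, le_rfl, .skip s⟩

theorem Ex.push {l : List (List Bool)} (r : ℕ) (b : Bool) (h : r < l.length) :
    Ex (.push r b) (st l) (st (l.set r (b :: l.getD r []))) 1 := fun _ =>
  ⟨1, le_rfl, by rw [← st_update l h]; exact .push (st l) r b⟩

theorem Ex.pop {l : List (List Bool)} (r : ℕ) (h : r < l.length) :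
    Ex (.pop r) (st l) (st (l.set r (l.getD r []).tail)) 1 := fun _ =>
  ⟨1, le_rfl, by rw [← st_update l h]; exact .pop (st l) r⟩

theorem Ex.cond_nil {c d e : Cmd} {s s' : Store} {T r : ℕ} (h : s r = []) (hc : Ex c s s' T) :
    Ex (.cond r c d e) s s' (T + 1) := fun O =>
  let ⟨t, ht, k⟩ := hc O
  ⟨t + 1, by omega, .cond_empty h k⟩

theorem Ex.cond_false {c d e : Cmd} {s s' : Store} {T r : ℕ} {x : List Bool}
    (h : s r = false :: x) (hc : Ex d s s' T) :
    Ex (.cond r c d e) s s' (T + 1) := fun O =>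
  let ⟨t, ht, k⟩ := hc O
  ⟨t + 1, by omega, .cond_false (by simp [h]) k⟩

theorem Ex.cond_true {c d e : Cmd} {s s' : Store} {T r : ℕ} {x : List Bool}
    (h : s r = true :: x) (hc : Ex e s s' T) :
    Ex (.cond r c d e) s s' (T + 1) := fun O =>
  let ⟨t, ht, k⟩ := hc O
  ⟨t + 1, by omega, .cond_true (by simp [h]) k⟩

theorem Ex.loop_nil {c : Cmd} {s : Store} {r : ℕ} (h : s r = []) : Ex (.loop r c) s s 1 :=
  fun _ => ⟨1, le_rfl, .loop_done h⟩

theorem Ex.loop_cons {c : Cmd} {s s' s'' : Store} {r T T' : ℕ} (h : s r ≠ []) (hc : Ex c s s' T)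
    (hl : Ex (.loop r c) s' s'' T') : Ex (.loop r c) s s'' (T + T' + 1) := fun O =>
  let ⟨t, ht, k⟩ := hc O
  let ⟨t', ht', k'⟩ := hl O
  ⟨t + t' + 1, by omega, .loop_step h k k'⟩

/-- Deterministic programs without oracle calls. -/
def Cmd.Plain (c : Cmd) : Prop := c.Deterministic ∧ c.OracleFree

@[simp] theorem plain_skip : Cmd.skip.Plain := ⟨trivial, trivial⟩
@[simp] theorem plain_push (r : ℕ) (b : Bool) : (Cmd.push r b).Plain := ⟨trivial, trivial⟩
@[simp] theorem plain_pop (r : ℕ) : (Cmd.pop r).Plain := ⟨trivial, trivial⟩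
@[simp] theorem plain_seq (c d : Cmd) : (c ;; d).Plain ↔ c.Plain ∧ d.Plain := by
  simp only [Cmd.Plain, Cmd.Deterministic, Cmd.OracleFree]; tauto
@[simp] theorem plain_cond (r : ℕ) (c d e : Cmd) :
    (Cmd.cond r c d e).Plain ↔ c.Plain ∧ d.Plain ∧ e.Plain := by
  simp only [Cmd.Plain, Cmd.Deterministic, Cmd.OracleFree]; tauto
@[simp] theorem plain_loop (r : ℕ) (c : Cmd) : (Cmd.loop r c).Plain ↔ c.Plain := Iff.rfl

/-! ### Renaming registers -/

/-- The same program on registers shifted by `n`. -/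
def Cmd.shift (n : ℕ) : Cmd → Cmd
  | .skip => .skip
  | .push r b => .push (r + n) b
  | .pop r => .pop (r + n)
  | .seq c d => .seq (c.shift n) (d.shift n)
  | .cond r c d e => .cond (r + n) (c.shift n) (d.shift n) (e.shift n)
  | .loop r c => .loop (r + n) (c.shift n)
  | .guess r => .guess (r + n)
  | .query r a => .query (r + n) (a + n)

@[simp] theorem plain_shift (n : ℕ) (c : Cmd) : (c.shift n).Plain ↔ c.Plain := by
  induction c <;> simp_all [Cmd.shift, Cmd.Plain, Cmd.Deterministic, Cmd.OracleFree] <;> tauto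

/-- Registers below `n` from `u`, the others from `s`. -/
def glue (n : ℕ) (u s : Store) : Store := fun r => if r < n then u r else s (r - n)

@[simp] theorem glue_add (n : ℕ) (u s : Store) (r : ℕ) : glue n u s (r + n) = s r := by
  simp [glue]

theorem glue_update (n : ℕ) (u s : Store) (r : ℕ) (x : List Bool) :
    glue n u (Function.update s r x) = Function.update (glue n u s) (r + n) x := by
  funext q
  by_cases h : q < n
  · have : q ≠ r + n := by omega
    simp [glue, h, this]
  · by_cases h' : q = r + n
    · subst h'; simp [glue]
    · have : q - n ≠ r := by omega
      simp [glue, h, h', this]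

theorem Runs.shift {O : Language Bool} {c : Cmd} {s s' : Store} {t k : ℕ} (h : Runs O c s t k s')
    (n : ℕ) (u : Store) : Runs O (c.shift n) (glue n u s) t k (glue n u s') := by
  induction h with
  | skip s => exact .skip _
  | push s r b => rw [glue_update]; simpa [Cmd.shift] using Runs.push (O := O) (glue n u s) (r + n) b
  | pop s r => rw [glue_update]; simpa [Cmd.shift] using Runs.pop (O := O) (glue n u s) (r + n)
  | seq _ _ h1 h2 => exact .seq h1 h2
  | cond_empty h _ ih => exact .cond_empty (by simpa using h) ih
  | cond_false h _ ih => exact .cond_false (by simpa using h) ih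
  | cond_true h _ ih => exact .cond_true (by simpa using h) ih
  | loop_done h => exact .loop_done (by simpa using h)
  | loop_step h _ _ ih ih' => exact .loop_step (by simpa using h) ih ih'
  | guess s r b => rw [glue_update]; simpa [Cmd.shift] using Runs.guess (O := O) (glue n u s) (r + n) b
  | query s r a b h =>
    rw [glue_update]
    simpa [Cmd.shift] using Runs.query (O := O) (glue n u s) (r + n) (a + n) b (by simpa using h)

theorem glue_st (l m : List (List Bool)) : glue l.length (st l) (st m) = st (l ++ m) := by
  funext q
  simp only [glue, st, List.getD, List.getElem?_append]
  split_ifs <;> rfl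

/-- This is the subroutine call: after shifting, the program works above the first `n` registers,
which it can neither read nor change. -/
theorem Ex.call {c : Cmd} {x y : List Bool} {T : ℕ} (h : Ex c (st [x]) (st [y]) T)
    (l : List (List Bool)) (n : ℕ) (hn : l.length = n) :
    Ex (c.shift n) (st (l ++ [x])) (st (l ++ [y])) T := fun O => by
  subst hn
  obtain ⟨t, ht, r⟩ := h O
  refine ⟨t, ht, ?_⟩
  rw [← glue_st, ← glue_st]
  exact r.shift _ _

/-! ### Moving data between registers -/

/-- Pop all bits of register `a`, running `c b` on each bit `b`. -/
def bitLoop (a : ℕ) (c : Bool → Cmd) : Cmd :=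
  .loop a (.cond a .skip (.pop a ;; c false) (.pop a ;; c true))

@[simp] theorem plain_bitLoop (a : ℕ) (c : Bool → Cmd) :
    (bitLoop a c).Plain ↔ (c false).Plain ∧ (c true).Plain := by simp [bitLoop]

/-- `S d r` is the loop invariant: the store when `r` is still to be popped and `d` is what has been
popped, the latest bit first. Each round costs `K` and the two tests of the loop and of the branch.
-/
theorem Ex.bitLoop {a : ℕ} {c : Bool → Cmd} {K : ℕ} (S : List Bool → List Bool → Store)
    (hS : ∀ d r, S d r a = r) (step : ∀ d b r, Ex (.pop a ;; c b) (S d (b :: r)) (S (b :: d) r) K)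
    (r : List Bool) : ∀ d, Ex (bitLoop a c) (S d r) (S (r.reverse ++ d) []) ((K + 2) * r.length + 1) := by
  induction r with
  | nil => intro d; exact (Ex.loop_nil (hS d [])).mono (by simp)
  | cons b r ih =>
    intro d
    have h1 : Ex (.cond a .skip (.pop a ;; c false) (.pop a ;; c true)) (S d (b :: r)) (S (b :: d) r)
        (K + 1) := by
      cases b
      · exact Ex.cond_false (hS d _) (step d _ r)
      · exact Ex.cond_true (hS d _) (step d _ r)
    have := Ex.loop_cons (by rw [hS]; simp) h1 (ih (b :: d))
    rw [List.reverse_cons, List.append_assoc]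
    exact this.mono (by simp only [List.length_cons]; ring_nf; omega)

theorem getD_set_ne {l : List (List Bool)} {a b : ℕ} (h : a ≠ b) (x : List Bool) :
    (l.set a x).getD b [] = l.getD b [] := by simp [List.getD, h]

theorem getD_set_self {l : List (List Bool)} {a : ℕ} (h : a < l.length) (x : List Bool) :
    (l.set a x).getD a [] = x := by simp [h]

theorem set_getD_self (l : List (List Bool)) (a : ℕ) : l.set a (l.getD a []) = l := by
  apply List.ext_getElem?
  intro i
  rw [List.getElem?_set]
  split_ifs with h1 h2
  · subst h1; simp [h2]
  · subst h1; simp at h2; simp [h2]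
  · rfl

/-- Empty register `a`. -/
def clr (a : ℕ) : Cmd := bitLoop a fun _ => .skip

@[simp] theorem plain_clr (a : ℕ) : (clr a).Plain := by simp [clr]

theorem Ex.clr {l : List (List Bool)} (a : ℕ) (ha : a < l.length) :
    Ex (clr a) (st l) (st (l.set a [])) (4 * (l.getD a []).length + 1) := by
  have := Ex.bitLoop (a := a) (c := fun _ => .skip) (K := 2) (fun _ r => st (l.set a r))
    (fun d r => getD_set_self ha r)
    (fun d b r => by
      have h := (Ex.pop (l := l.set a (b :: r)) a (by simpa)).seq (Ex.skip _)
      rw [getD_set_self ha, List.set_set] at h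
      exact h) (l.getD a []) []
  rwa [set_getD_self] at this

/-- Move the content of register `a` in reverse order to register `b`. -/
def mv (a b : ℕ) : Cmd := bitLoop a fun x => .push b x

@[simp] theorem plain_mv (a b : ℕ) : (mv a b).Plain := by simp [mv]

theorem Ex.mv {l : List (List Bool)} (a b : ℕ) (ha : a < l.length) (hb : b < l.length) (hab : a ≠ b) :
    Ex (mv a b) (st l) (st ((l.set b ((l.getD a []).reverse ++ l.getD b [])).set a []))
      (4 * (l.getD a []).length + 1) := by
  have := Ex.bitLoop (a := a) (c := fun x => .push b x) (K := 2)
    (fun d r => st ((l.set b (d ++ l.getD b [])).set a r))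
    (fun d r => getD_set_self (by simpa) r)
    (fun d x r => by
      have h := (Ex.pop (l := (l.set b (d ++ l.getD b [])).set a (x :: r)) a (by simpa)).seq
        (Ex.push b x (by simpa))
      rw [getD_set_self (by simpa), getD_set_ne hab, getD_set_ne hab, getD_set_self hb, List.set_set,
        List.set_comm _ _ hab, List.set_set, List.tail_cons] at h
      exact h) (l.getD a []) []
  simp only [List.nil_append, List.append_nil, set_getD_self] at this
  exact this

/-- Move the reversal of register `a` in delimited form to register `b`. -/
def mvEnc (a b : ℕ) : Cmd := .push b false ;; bitLoop a fun x => .push b x ;; .push b true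

@[simp] theorem plain_mvEnc (a b : ℕ) : (mvEnc a b).Plain := by simp [mvEnc]

@[simp] theorem encStr_nil : encStr [] = [false] := rfl
@[simp] theorem encStr_cons (b : Bool) (x : List Bool) : encStr (b :: x) = true :: b :: encStr x := rfl
theorem length_encStr (x : List Bool) : (encStr x).length = 2 * x.length + 1 := by
  induction x with
  | nil => rfl
  | cons b x ih => simp [ih]; ring

/-- A stack is filled from the end of the string, so the end marker goes in first, and each bit goes
in before the `true` that announces it. -/
theorem Ex.mvEnc {l : List (List Bool)} (a b : ℕ) (ha : a < l.length) (hb : b < l.length)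
    (hab : a ≠ b) :
    Ex (mvEnc a b) (st l) (st ((l.set b (encStr (l.getD a []).reverse ++ l.getD b [])).set a []))
      (5 * (l.getD a []).length + 2) := by
  have := Ex.bitLoop (a := a) (c := fun x => .push b x ;; .push b true) (K := 3)
    (fun d r => st ((l.set b (encStr d ++ l.getD b [])).set a r))
    (fun d r => getD_set_self (by simpa) r)
    (fun d x r => by
      have h := (Ex.pop (l := (l.set b (encStr d ++ l.getD b [])).set a (x :: r)) a (by simpa)).seq
        ((Ex.push b x (by simpa)).seq (Ex.push b true (by simpa)))
      rw [getD_set_self (by simpa), getD_set_ne hab, getD_set_ne hab, getD_set_self hb, List.set_set,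
        List.set_comm _ _ hab, List.set_set, getD_set_self (by simpa),
        List.set_comm _ _ hab, List.set_set, List.set_set, List.tail_cons] at h
      exact h) (l.getD a []) []
  have h0 := Ex.push (l := l) b false hb
  have e : (l.set b (encStr [] ++ l.getD b [])).set a (l.getD a []) = l.set b (false :: l.getD b []) := by
    rw [List.set_comm _ _ hab.symm, set_getD_self]; rfl
  rw [e] at this
  simp only [List.append_nil] at this
  exact (h0.seq this).mono (by omega)

/-- Copy register `a`, reversed, to registers `b` and `c`, emptying `a`. -/
def mv2 (a b c : ℕ) : Cmd := bitLoop a fun x => .push b x ;; .push c x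

@[simp] theorem plain_mv2 (a b c : ℕ) : (mv2 a b c).Plain := by simp [mv2]

/-- Read a delimited string from the front. -/
def unstr : List Bool → List Bool × List Bool
  | [] => ([], [])
  | false :: x => ([], x)
  | [true] => ([], [])
  | true :: b :: x => (b :: (unstr x).1, (unstr x).2)

theorem unstr_encStr (x y : List Bool) : unstr (encStr x ++ y) = (x, y) := by
  induction x with
  | nil => rfl
  | cons b x ih => simp [unstr, ih]

theorem length_unstr_snd (x : List Bool) : (unstr x).2.length ≤ x.length := by
  fun_induction unstr x
  all_goals simp
  omega

theorem length_unstr_fst (x : List Bool) : (unstr x).1.length ≤ x.length := by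
  fun_induction unstr x
  all_goals simp
  omega

/-- Move a delimited string from the front of register `a`, reversed, to register `b`, using the
empty register `f` as a flag. -/
def dec (a b f : ℕ) : Cmd :=
  .push f true ;; .loop f (.cond a (.pop f) (.pop a ;; .pop f)
    (.pop a ;; .cond a .skip (.pop a ;; .push b false) (.pop a ;; .push b true)))

@[simp] theorem plain_dec (a b f : ℕ) : (dec a b f).Plain := by simp [dec]

/-- A loop can only test a register for emptiness, whereas the end of a delimited string is a bit
`false` inside `a`; the flag `f` holds `[true]` until this bit has been seen. The cases are those of
`unstr`, which covers malformed strings too, so that the program halts on every content of `a`. -/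
theorem Ex.dec_loop (S : List Bool → List Bool → List Bool → Store) {a b f : ℕ}
    (ha : ∀ x y z, S x y z a = x) (hf : ∀ x y z, S x y z f = z)
    (hpa : ∀ x y z, Ex (.pop a) (S x y z) (S x.tail y z) 1)
    (hpf : ∀ x y z, Ex (.pop f) (S x y z) (S x y z.tail) 1)
    (hpb : ∀ x y z c, Ex (.push b c) (S x y z) (S x (c :: y) z) 1) (x : List Bool) :
    ∀ y, Ex (.loop f (.cond a (.pop f) (.pop a ;; .pop f)
      (.pop a ;; .cond a .skip (.pop a ;; .push b false) (.pop a ;; .push b true))))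
      (S x y [true]) (S (unstr x).2 ((unstr x).1.reverse ++ y) []) (6 * x.length + 8) := by
  fun_induction unstr x with
  | case1 =>
    intro y
    exact (Ex.loop_cons (by simp [hf]) (Ex.cond_nil (ha _ _ _) (hpf _ _ _))
      (Ex.loop_nil (by simp [hf]))).mono (by simp)
  | case2 x =>
    intro y
    exact (Ex.loop_cons (by simp [hf]) (Ex.cond_false (ha _ _ _) ((hpa _ _ _).seq (hpf _ _ _)))
      (Ex.loop_nil (by simp [hf]))).mono (by simp)
  | case3 =>
    intro y
    refine (Ex.loop_cons (by simp [hf]) (Ex.cond_true (ha _ _ _) ((hpa _ _ _).seq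
      (Ex.cond_nil (ha _ _ _) (Ex.skip _))))
      (Ex.loop_cons (by simp [hf]) (Ex.cond_nil (ha _ _ _) (hpf _ _ _))
      (Ex.loop_nil (by simp [hf])))).mono (by simp)
  | case4 v x ih =>
    intro y
    have h2 : Ex (.cond a .skip (.pop a ;; .push b false) (.pop a ;; .push b true)) (S (v :: x) y [true])
        (S x (v :: y) [true]) 3 := by
      cases v
      · exact Ex.cond_false (ha _ _ _) ((hpa _ _ _).seq (hpb _ _ _ _))
      · exact Ex.cond_true (ha _ _ _) ((hpa _ _ _).seq (hpb _ _ _ _))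
    have := Ex.loop_cons (r := f) (s := S (true :: v :: x) y [true]) (by simp [hf]) (Ex.cond_true (ha (true :: v :: x) y [true])
      ((hpa _ _ _).seq h2)) (ih (v :: y))
    simp only [List.reverse_cons, List.append_assoc, List.singleton_append]
    exact this.mono (by simp; omega)

theorem Ex.dec {l : List (List Bool)} (a b f : ℕ) (ha : a < l.length) (hb : b < l.length)
    (hf : f < l.length) (hab : a ≠ b) (haf : a ≠ f) (hbf : b ≠ f) (h0 : l.getD f [] = []) :
    Ex (dec a b f) (st l) (st ((l.set b ((unstr (l.getD a [])).1.reverse ++ l.getD b [])).set a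
      (unstr (l.getD a [])).2)) (6 * (l.getD a []).length + 9) := by
  have h := Ex.dec_loop (fun x y z => st (((l.set f z).set b y).set a x)) (a := a) (b := b) (f := f)
    (fun x y z => by simp [st, ha])
    (fun x y z => by
      simp only [st]; rw [getD_set_ne haf, getD_set_ne hbf, getD_set_self hf])
    (fun x y z => by
      have h := Ex.pop (l := ((l.set f z).set b y).set a x) a (by simpa)
      rwa [getD_set_self (by simpa), List.set_set] at h)
    (fun x y z => by
      have h := Ex.pop (l := ((l.set f z).set b y).set a x) f (by simpa)
      rwa [getD_set_ne haf, getD_set_ne hbf, getD_set_self hf, List.set_comm _ _ haf,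
        List.set_comm _ _ hbf, List.set_set] at h)
    (fun x y z c => by
      have h := Ex.push (l := ((l.set f z).set b y).set a x) b c (by simpa)
      rwa [getD_set_ne hab, getD_set_self (by simpa), List.set_comm _ _ hab, List.set_set] at h)
    (l.getD a []) (l.getD b [])
  have h1 := Ex.push (l := l) f true hf
  have e1 : (((l.set f [true]).set b (l.getD b [])).set a (l.getD a [])) = l.set f [true] := by
    rw [← getD_set_ne hbf.symm [true], set_getD_self, ← getD_set_ne haf.symm [true], set_getD_self]
  have e2 : l.set f [] = l := by rw [← h0, set_getD_self]
  rw [e1, e2] at h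
  rw [h0] at h1
  exact (h1.seq h).mono (by omega)

end Machine

namespace Machine

/-! ## Polynomial bounds -/

theorem eval_mono (p : Polynomial ℕ) {a b : ℕ} (h : a ≤ b) : p.eval a ≤ p.eval b := by
  rw [Polynomial.eval_eq_sum, Polynomial.eval_eq_sum]
  exact Finset.sum_le_sum fun i _ => Nat.mul_le_mul_left _ (Nat.pow_le_pow_left h i)

/-- `T` is bounded by a polynomial in `n`. -/
def PB {ι : Type*} (n T : ι → ℕ) : Prop := ∃ p : Polynomial ℕ, ∀ i, T i ≤ p.eval (n i)

section PB
variable {ι κ : Type*} {n m T T' : ι → ℕ}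

theorem PB.self (n : ι → ℕ) : PB n n := ⟨.X, by simp⟩
theorem PB.const (n : ι → ℕ) (k : ℕ) : PB n fun _ => k := ⟨.C k, by simp⟩
theorem PB.add (h : PB n T) (h' : PB n T') : PB n fun i => T i + T' i :=
  let ⟨p, hp⟩ := h
  let ⟨q, hq⟩ := h'
  ⟨p + q, fun i => by rw [Polynomial.eval_add]; exact add_le_add (hp i) (hq i)⟩
theorem PB.mul (h : PB n T) (h' : PB n T') : PB n fun i => T i * T' i :=
  let ⟨p, hp⟩ := h
  let ⟨q, hq⟩ := h'
  ⟨p * q, fun i => by rw [Polynomial.eval_mul]; exact Nat.mul_le_mul (hp i) (hq i)⟩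
theorem PB.mono (h : PB n T) (hT : ∀ i, T' i ≤ T i) : PB n T' :=
  let ⟨p, hp⟩ := h
  ⟨p, fun i => (hT i).trans (hp i)⟩
theorem PB.trans (h : PB n m) (h' : PB m T) : PB n T :=
  let ⟨p, hp⟩ := h
  let ⟨q, hq⟩ := h'
  ⟨q.comp p, fun i => by rw [Polynomial.eval_comp]; exact (hq i).trans (eval_mono q (hp i))⟩
theorem PB.pull (h : PB n T) (f : κ → ι) : PB (fun k => n (f k)) fun k => T (f k) :=
  let ⟨p, hp⟩ := h
  ⟨p, fun k => hp (f k)⟩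
theorem PB.mono' {m : ι → ℕ} (h : PB n T) (hT : ∀ i, n i = m i) : PB m T := by
  obtain rfl : n = m := funext hT
  exact h
theorem PB.eval (h : PB n m) (p : Polynomial ℕ) : PB n fun i => p.eval (m i) :=
  h.trans ⟨p, fun _ => le_rfl⟩
end PB

/-! ## Polynomial-time functions between coded types -/

/-- A type whose elements are written as bit strings. -/
class Enc (α : Type*) where
  enc : α → List Bool

open Machine.Enc (enc)

/-- Bit strings that represent themselves. -/
structure Raw where
  /-- The bits of the string. -/
  bits : List Bool

instance : Enc Raw := ⟨Raw.bits⟩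
instance : Enc Bool := ⟨fun b => [b]⟩
instance : Enc ℕ := ⟨Nat.bits⟩
instance {α β : Type*} [Enc α] [Enc β] : Enc (α × β) := ⟨fun p => encStr (enc p.1) ++ enc p.2⟩
instance {α : Type*} [Enc α] : Enc (List α) := ⟨fun l => l.flatMap fun a => encStr (enc a)⟩
instance (priority := low) {α : Type*} [Coded α] : Enc α := ⟨Coded.code⟩
instance {α : Type*} [Enc α] {P : α → Prop} : Enc {a // P a} := ⟨fun a => enc a.1⟩

/-- The length of the code. -/
def sz {α : Type*} [Enc α] (a : α) : ℕ := (enc a).length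

section
variable {α : Type*} {β : Type*} {γ : Type*} {δ : Type*} {σ : Type*}
variable [Enc α] [Enc β] [Enc γ] [Enc δ] [Enc σ]

@[simp] theorem enc_raw (x : Raw) : enc x = x.bits := rfl
@[simp] theorem enc_bool (b : Bool) : enc b = [b] := rfl
@[simp] theorem enc_nat (n : ℕ) : enc n = n.bits := rfl
@[simp] theorem enc_pair (a : α) (b : β) : enc (a, b) = encStr (enc a) ++ enc b := rfl
@[simp] theorem enc_nil : enc ([] : List α) = [] := rfl
@[simp] theorem enc_cons (a : α) (l : List α) : enc (a :: l) = encStr (enc a) ++ enc l := rfl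
@[simp] theorem enc_append (l l' : List α) : enc (l ++ l') = enc l ++ enc l' := List.flatMap_append
@[simp] theorem enc_subtype {P : α → Prop} (a : {a // P a}) : enc a = enc a.1 := rfl

@[simp] theorem sz_bool (b : Bool) : sz b = 1 := rfl
theorem sz_raw (x : Raw) : sz x = x.bits.length := rfl
@[simp] theorem sz_pair (a : α) (b : β) : sz (a, b) = 2 * sz a + 1 + sz b := by
  simp [sz, length_encStr]
@[simp] theorem sz_nil : sz ([] : List α) = 0 := rfl
@[simp] theorem sz_cons (a : α) (l : List α) : sz (a :: l) = 2 * sz a + 1 + sz l := by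
  simp [sz, length_encStr]
@[simp] theorem sz_append (l l' : List α) : sz (l ++ l') = sz l + sz l' := by simp [sz]
@[simp] theorem sz_reverse (l : List α) : sz l.reverse = sz l := by
  induction l with
  | nil => rfl
  | cons a l ih => simp [ih]; ring
theorem sz_sublist {l l' : List α} (h : l.Sublist l') : sz l ≤ sz l' := by
  induction h with
  | slnil => rfl
  | cons a _ ih => simp; omega
  | cons_cons a _ ih => simp; omega
theorem length_le_sz (l : List α) : l.length ≤ sz l := by
  induction l with
  | nil => simp
  | cons a l ih => simp; omega
theorem sz_le_of_mem {l : List α} {a : α} (h : a ∈ l) : sz a ≤ sz l := by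
  induction l with
  | nil => simp at h
  | cons b l ih =>
    rcases List.mem_cons.1 h with rfl | h
    · simp; omega
    · have := ih h; simp; omega
theorem sz_le_mul {l : List α} {M : ℕ} (h : ∀ a ∈ l, sz a ≤ M) : sz l ≤ l.length * (2 * M + 1) := by
  induction l with
  | nil => simp
  | cons b l ih =>
    have h1 := h b (by simp)
    have h2 := ih fun a ha => h a (by simp [ha])
    simp only [sz_cons, List.length_cons, add_mul]; omega

/-- `f` is computable in polynomial time. -/
@[fun_prop] def PF (f : α → β) : Prop :=
  ∃ c : Cmd, c.Plain ∧ ∃ T : α → ℕ, PB sz T ∧ ∀ a, Ex c (st [enc a]) (st [enc (f a)]) (T a)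

/-- One step pushes at most one bit. Hence outputs of polynomial-time programs have polynomial
length, without which their time bounds could not be composed. -/
theorem Runs.length_le {O : Language Bool} {c : Cmd} {s s' : Store} {t k : ℕ}
    (h : Runs O c s t k s') (r : ℕ) : (s' r).length ≤ (s r).length + t := by
  induction h with
  | skip => omega
  | push s q b => by_cases h : r = q <;> simp [Function.update, h]
  | pop s q =>
    by_cases h : r = q
    · subst h; simp; omega
    · simp [h]
  | seq _ _ h1 h2 => omega
  | cond_empty _ _ ih => omega
  | cond_false _ _ ih => omega
  | cond_true _ _ ih => omega
  | loop_done => omega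
  | loop_step _ _ _ h1 h2 => omega
  | guess s q b => by_cases h : r = q <;> simp [Function.update, h]
  | query s q a b _ => by_cases h : r = a <;> simp [Function.update, h]

theorem PF.pb_sz {f : α → β} (hf : PF f) : PB sz fun a => sz (f a) := by
  obtain ⟨c, -, T, hT, h⟩ := hf
  refine ((PB.self _).add hT).mono fun a => ?_
  obtain ⟨t, ht, r⟩ := h a 0
  have := r.length_le 0
  simp only [st, List.getD_cons_zero] at this
  simp only [sz]
  omega

/-- Functions with the same codes are computable alike. -/
theorem PF.cast {f : α → β} (hf : PF f) {g : γ → δ} (i : γ → α) (hi : ∀ c, enc (i c) = enc c)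
    (ho : ∀ c, enc (f (i c)) = enc (g c)) : PF g := by
  obtain ⟨c, hc, T, hT, h⟩ := hf
  refine ⟨c, hc, fun a => T (i a), (hT.pull i).mono' ?_, fun a => ?_⟩
  · intro a; simp [sz, hi]
  · rw [← hi, ← ho]; exact h (i a)

end
end Machine

-- Composition, pairing, projections and branching

namespace Machine
open Machine.Enc (enc)
section
variable {α : Type*} {β : Type*} {γ : Type*} {δ : Type*} {σ : Type*}
variable [Enc α] [Enc β] [Enc γ] [Enc δ] [Enc σ]

@[fun_prop] theorem PF.id : PF fun a : α => a :=
  ⟨.skip, by simp, fun _ => 1, .const _ 1, fun _ => Ex.skip _⟩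

@[fun_prop] theorem PF.comp {g : β → γ} {f : α → β} (hg : PF g) (hf : PF f) :
    PF fun a => g (f a) := by
  have hs := hf.pb_sz
  obtain ⟨c, hc, T, hT, h⟩ := hf
  obtain ⟨d, hd, T', hT', h'⟩ := hg
  refine ⟨c ;; d, by simp [hc, hd], fun a => T a + T' (f a), hT.add (hs.trans (hT'.pull f)),
    fun a => (h a).seq (h' _)⟩

/-- Push a string. -/
def pushAll (r : ℕ) : List Bool → Cmd
  | [] => .skip
  | b :: x => pushAll r x ;; .push r b

theorem plain_pushAll (r : ℕ) (x : List Bool) : (pushAll r x).Plain := by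
  induction x <;> simp_all [pushAll]

theorem Ex.pushAll (x : List Bool) : Ex (pushAll 0 x) (st [[]]) (st [x]) (x.length + 1) := by
  induction x with
  | nil => exact Ex.skip _
  | cons b x ih => exact ih.seq (Ex.push (l := [x]) 0 b (by simp))

@[fun_prop] theorem PF.const (b : β) : PF fun _ : α => b := by
  refine ⟨clr 0 ;; pushAll 0 (enc b), by simp [plain_pushAll], fun a => (4 * sz a + 1) + (sz b + 1),
    ((PB.const _ 4).mul (.self _)).add (.const _ 1) |>.add (.const _ _), fun a => ?_⟩
  exact (Ex.clr (l := [enc a]) 0 (by simp)).seq (Ex.pushAll _)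

theorem st8 (x : List Bool) : st [x] = st [x, [], [], [], [], [], [], []] :=
  (st_append_nil [x] 7).symm

/-- Convention for all composite programs: registers `0` to `6` are the workspace of the caller, and
the callee sees register `7` as its own register `0`. -/
theorem Ex.call7 {c : Cmd} {x y : List Bool} {T : ℕ} (h : Ex c (st [x]) (st [y]) T)
    (a0 a1 a2 a3 a4 a5 a6 : List Bool) :
    Ex (c.shift 7) (st [a0, a1, a2, a3, a4, a5, a6, x]) (st [a0, a1, a2, a3, a4, a5, a6, y]) T :=
  h.call [a0, a1, a2, a3, a4, a5, a6] 7 rfl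

theorem Ex.mv2_0 (x : List Bool) : Ex (mv2 0 1 2) (st [x, [], [], [], [], [], [], []])
    (st [[], x.reverse, x.reverse, [], [], [], [], []]) (5 * x.length + 1) := by
  have := Ex.bitLoop (a := 0) (c := fun x => .push 1 x ;; .push 2 x) (K := 3)
    (fun d r => st [r, d, d, [], [], [], [], []]) (fun d r => rfl)
    (fun d b r => (Ex.pop (l := [b :: r, d, d, [], [], [], [], []]) 0 (by simp)).seq
      ((Ex.push 1 b (by simp)).seq (Ex.push 2 b (by simp)))) x []
  simpa [mv2] using this

-- The input is duplicated; one copy waits in register `2` while the first program runs, and the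
-- first result waits in register `3` while the second one runs. A move reverses its string, so
-- every string is moved an even number of times.
@[fun_prop] theorem PF.mk {f : α → β} {g : α → γ} (hf : PF f) (hg : PF g) :
    PF fun a => (f a, g a) := by
  have hs := hf.pb_sz
  have hs' := hg.pb_sz
  obtain ⟨c, hc, T, hT, h⟩ := hf
  obtain ⟨d, hd, T', hT', h'⟩ := hg
  refine ⟨mv2 0 1 2 ;; mv 1 7 ;; c.shift 7 ;; mv 7 3 ;; mv 2 7 ;; d.shift 7 ;; mv 7 1 ;; mv 1 0 ;;
    mvEnc 3 0, by simp [hc, hd], fun a => (13 * sz a + 10) + (T a + 9 * sz (f a)) +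
      (T' a + 8 * sz (g a)), ?_, fun a => ?_⟩
  · exact (((PB.const _ 13).mul (.self _)).add (.const _ _)).add (hT.add ((PB.const _ 9).mul hs)) |>.add
      (hT'.add ((PB.const _ 8).mul hs'))
  · rw [st8, st8 (enc (f a, g a))]
    have h1 := Ex.mv2_0 (enc a)
    have h2 : Ex (mv 1 7) (st [[], (enc a).reverse, (enc a).reverse, [], [], [], [], []])
      (st [[], [], (enc a).reverse, [], [], [], [], enc a]) (4 * (enc a).length + 1) := by
      simpa using Ex.mv (l := [[], (enc a).reverse, (enc a).reverse, [], [], [], [], []]) 1 7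
        (by simp) (by simp) (by simp)
    have h3 := (h a).call7 [] [] (enc a).reverse [] [] [] []
    have h4 : Ex (mv 7 3) (st [[], [], (enc a).reverse, [], [], [], [], enc (f a)])
      (st [[], [], (enc a).reverse, (enc (f a)).reverse, [], [], [], []]) (4 * (enc (f a)).length + 1) := by
      simpa using Ex.mv (l := [[], [], (enc a).reverse, [], [], [], [], enc (f a)]) 7 3
        (by simp) (by simp) (by simp)
    have h5 : Ex (mv 2 7) (st [[], [], (enc a).reverse, (enc (f a)).reverse, [], [], [], []])
      (st [[], [], [], (enc (f a)).reverse, [], [], [], enc a]) (4 * (enc a).length + 1) := by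
      simpa using Ex.mv (l := [[], [], (enc a).reverse, (enc (f a)).reverse, [], [], [], []]) 2 7
        (by simp) (by simp) (by simp)
    have h6 := (h' a).call7 [] [] [] (enc (f a)).reverse [] [] []
    have h7 : Ex (mv 7 1) (st [[], [], [], (enc (f a)).reverse, [], [], [], enc (g a)])
      (st [[], (enc (g a)).reverse, [], (enc (f a)).reverse, [], [], [], []])
      (4 * (enc (g a)).length + 1) := by
      simpa using Ex.mv (l := [[], [], [], (enc (f a)).reverse, [], [], [], enc (g a)]) 7 1
        (by simp) (by simp) (by simp)
    have h8 : Ex (mv 1 0) (st [[], (enc (g a)).reverse, [], (enc (f a)).reverse, [], [], [], []])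
      (st [enc (g a), [], [], (enc (f a)).reverse, [], [], [], []]) (4 * (enc (g a)).length + 1) := by
      simpa using Ex.mv (l := [[], (enc (g a)).reverse, [], (enc (f a)).reverse, [], [], [], []]) 1 0
        (by simp) (by simp) (by simp)
    have h9 : Ex (mvEnc 3 0) (st [enc (g a), [], [], (enc (f a)).reverse, [], [], [], []])
      (st [enc (f a, g a), [], [], [], [], [], [], []]) (5 * (enc (f a)).length + 2) := by
      simpa using Ex.mvEnc (l := [enc (g a), [], [], (enc (f a)).reverse, [], [], [], []]) 3 0
        (by simp) (by simp) (by simp)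
    refine (h1.seq (h2.seq (h3.seq (h4.seq (h5.seq (h6.seq (h7.seq (h8.seq h9)))))))).mono ?_
    simp only [sz]
    omega

/-- The first component of a pair of strings. -/
def Raw.fst (x : Raw) : Raw := ⟨(unstr x.bits).1⟩
/-- The second component of a pair of strings. -/
def Raw.snd (x : Raw) : Raw := ⟨(unstr x.bits).2⟩

theorem PF.rawFst : PF Raw.fst := by
  refine ⟨dec 0 1 2 ;; clr 0 ;; mv 1 0, by simp, fun a => 14 * sz a + 11,
    ((PB.const _ 14).mul (.self _)).add (.const _ _), fun ⟨a⟩ => ?_⟩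
  show Ex _ (st [a]) (st [(unstr a).1]) _
  rw [st8, st8 (unstr a).1]
  have h1 := Ex.dec (l := [a, [], [], [], [], [], [], []]) 0 1 2 (by simp) (by simp) (by simp)
    (by simp) (by simp) (by simp) rfl
  have h2 := Ex.clr (l := [(unstr a).2, (unstr a).1.reverse, [], [], [], [], [], []]) 0 (by simp)
  have h3 := Ex.mv (l := [[], (unstr a).1.reverse, [], [], [], [], [], []]) 1 0 (by simp) (by simp)
    (by simp)
  simp at h1 h2 h3
  refine (h1.seq (h2.seq h3)).mono ?_
  have := length_unstr_fst a
  have := length_unstr_snd a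
  change _ ≤ 14 * a.length + 11
  omega

theorem PF.rawSnd : PF Raw.snd := by
  refine ⟨dec 0 1 2 ;; clr 1, by simp, fun a => 14 * sz a + 11,
    ((PB.const _ 14).mul (.self _)).add (.const _ _), fun ⟨a⟩ => ?_⟩
  show Ex _ (st [a]) (st [(unstr a).2]) _
  rw [st8, st8 (unstr a).2]
  have h1 := Ex.dec (l := [a, [], [], [], [], [], [], []]) 0 1 2 (by simp) (by simp) (by simp)
    (by simp) (by simp) (by simp) rfl
  have h2 := Ex.clr (l := [(unstr a).2, (unstr a).1.reverse, [], [], [], [], [], []]) 1 (by simp)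
  simp at h1 h2
  refine (h1.seq h2).mono ?_
  have := length_unstr_fst a
  have := length_unstr_snd a
  change _ ≤ 14 * a.length + 11
  omega

@[fun_prop] theorem PF.fst {f : α → β × γ} (hf : PF f) : PF fun a => (f a).1 :=
  PF.comp (g := Prod.fst) (PF.rawFst.cast (fun p : β × γ => (⟨enc p⟩ : Raw)) (fun _ => rfl) fun ⟨b, c⟩ => by
    simp [Raw.fst, unstr_encStr]) hf

@[fun_prop] theorem PF.snd {f : α → β × γ} (hf : PF f) : PF fun a => (f a).2 :=
  PF.comp (g := Prod.snd) (PF.rawSnd.cast (fun p : β × γ => (⟨enc p⟩ : Raw)) (fun _ => rfl) fun ⟨b, c⟩ => by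
    simp [Raw.snd, unstr_encStr]) hf

@[fun_prop] theorem PF.ite {p : α → Bool} {f g : α → β} (hp : PF p) (hf : PF f) (hg : PF g) :
    PF fun a => if p a then f a else g a := by
  have hs := hf.pb_sz
  have hs' := hg.pb_sz
  obtain ⟨e, he, T₀, hT₀, h₀⟩ := hp
  obtain ⟨c, hc, T, hT, h⟩ := hf
  obtain ⟨d, hd, T', hT', h'⟩ := hg
  refine ⟨mv2 0 1 2 ;; mv 1 7 ;; e.shift 7 ;; .cond 7 .skip (.pop 7 ;; mv 2 7 ;; d.shift 7)
    (.pop 7 ;; mv 2 7 ;; c.shift 7) ;; mv 7 1 ;; mv 1 0, by simp [he, hc, hd],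
    fun a => (13 * sz a + 20) + T₀ a + (T a + 8 * sz (f a)) + (T' a + 8 * sz (g a)), ?_, fun a => ?_⟩
  · exact ((((PB.const _ 13).mul (.self _)).add (.const _ _)).add hT₀).add
      (hT.add ((PB.const _ 8).mul hs)) |>.add (hT'.add ((PB.const _ 8).mul hs'))
  · rw [st8, st8 (enc (if p a then f a else g a))]
    have h1 := Ex.mv2_0 (enc a)
    have h2 : Ex (mv 1 7) (st [[], (enc a).reverse, (enc a).reverse, [], [], [], [], []])
      (st [[], [], (enc a).reverse, [], [], [], [], enc a]) (4 * (enc a).length + 1) := by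
      simpa using Ex.mv (l := [[], (enc a).reverse, (enc a).reverse, [], [], [], [], []]) 1 7
        (by simp) (by simp) (by simp)
    have h3 := (h₀ a).call7 [] [] (enc a).reverse [] [] [] []
    have h4 : Ex (.pop 7) (st [[], [], (enc a).reverse, [], [], [], [], [p a]])
      (st [[], [], (enc a).reverse, [], [], [], [], []]) 1 :=
      Ex.pop (l := [[], [], (enc a).reverse, [], [], [], [], [p a]]) 7 (by simp)
    have h5 : Ex (mv 2 7) (st [[], [], (enc a).reverse, [], [], [], [], []])
      (st [[], [], [], [], [], [], [], enc a]) (4 * (enc a).length + 1) := by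
      simpa using Ex.mv (l := [[], [], (enc a).reverse, [], [], [], [], []]) 2 7
        (by simp) (by simp) (by simp)
    have h7 (y : List Bool) : Ex (mv 7 1) (st [[], [], [], [], [], [], [], y])
      (st [[], y.reverse, [], [], [], [], [], []]) (4 * y.length + 1) := by
      simpa using Ex.mv (l := [[], [], [], [], [], [], [], y]) 7 1
        (by simp) (by simp) (by simp)
    have h8 (y : List Bool) : Ex (mv 1 0) (st [[], y.reverse, [], [], [], [], [], []])
      (st [y, [], [], [], [], [], [], []]) (4 * y.length + 1) := by
      simpa using Ex.mv (l := [[], y.reverse, [], [], [], [], [], []]) 1 0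
        (by simp) (by simp) (by simp)
    cases hb : p a
    · rw [enc_bool, hb] at h3
      rw [hb] at h4
      have h6 := Ex.cond_false (c := .skip) (e := .pop 7 ;; mv 2 7 ;; c.shift 7) (r := 7) (x := []) rfl
        (h4.seq (h5.seq ((h' a).call7 [] [] [] [] [] [] [])))
      refine (h1.seq (h2.seq (h3.seq (h6.seq ((h7 _).seq (h8 _)))))).mono ?_
      simp only [sz]
      omega
    · rw [enc_bool, hb] at h3
      rw [hb] at h4
      have h6 := Ex.cond_true (c := .skip) (d := .pop 7 ;; mv 2 7 ;; d.shift 7) (r := 7) (x := []) rfl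
        (h4.seq (h5.seq ((h a).call7 [] [] [] [] [] [] [])))
      refine (h1.seq (h2.seq (h3.seq (h6.seq ((h7 _).seq (h8 _)))))).mono ?_
      simp only [sz]
      omega

/-- A raw string and the list of its bits have different codes: in a list, the entry `b` is written
as the three bits of `encStr [b]`, which are pushed here from the last to the first. -/
theorem PF.rawBits : PF Raw.bits := by
  refine ⟨mv 0 1 ;; bitLoop 1 (fun b => .push 0 false ;; .push 0 b ;; .push 0 true), by simp,
    fun a => 10 * sz a + 3, ((PB.const _ 10).mul (.self _)).add (.const _ _), fun ⟨a⟩ => ?_⟩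
  show Ex _ (st [a]) (st [enc (α := List Bool) a]) _
  rw [← st_append_nil [a] 1, ← st_append_nil [enc (α := List Bool) a] 1]
  have h1 := Ex.mv (l := [a, []]) 0 1 (by simp) (by simp) (by simp)
  have h2 := Ex.bitLoop (a := 1) (c := fun b => .push 0 false ;; .push 0 b ;; .push 0 true) (K := 4)
    (fun d r => st [enc (α := List Bool) d, r]) (fun d r => rfl)
    (fun d b r => (Ex.pop (l := [enc (α := List Bool) d, b :: r]) 1 (by simp)).seq
      ((Ex.push 0 false (by simp)).seq ((Ex.push 0 b (by simp)).seq (Ex.push 0 true (by simp)))))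
    a.reverse []
  simp at h1 h2
  refine (h1.seq h2).mono ?_
  change _ ≤ 10 * a.length + 3
  omega

/-- Add a bit in front of a string. -/
def Raw.cons (p : Bool × Raw) : Raw := ⟨p.1 :: p.2.bits⟩

/-- The code of the pair `(b, x)` is `true :: b :: false :: x`, so only the two delimiting bits have
to go. -/
theorem PF.rawCons : PF Raw.cons := by
  refine ⟨.pop 0 ;; .cond 0 .skip (.pop 0 ;; .pop 0 ;; .push 0 false) (.pop 0 ;; .pop 0 ;; .push 0 true),
    by simp, fun _ => 5, .const _ _, fun ⟨b, ⟨x⟩⟩ => ?_⟩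
  have h1 := Ex.pop (l := [true :: b :: false :: x]) 0 (by simp)
  cases b
  · exact h1.seq (Ex.cond_false rfl ((Ex.pop (l := [false :: false :: x]) 0 (by simp)).seq
      ((Ex.pop 0 (by simp)).seq (Ex.push 0 false (by simp)))))
  · exact h1.seq (Ex.cond_true rfl ((Ex.pop (l := [true :: false :: x]) 0 (by simp)).seq
      ((Ex.pop 0 (by simp)).seq (Ex.push 0 true (by simp)))))

/-- Is the string empty? -/
def Raw.isNil (x : Raw) : Bool := x.bits.isEmpty

theorem PF.rawIsNil : PF Raw.isNil := by
  refine ⟨.cond 0 (.push 0 true) (clr 0 ;; .push 0 false) (clr 0 ;; .push 0 false), by simp,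
    fun a => 4 * sz a + 3, ((PB.const _ 4).mul (.self _)).add (.const _ _), fun a => ?_⟩
  rcases a with ⟨_ | ⟨_ | _, a⟩⟩
  · exact (Ex.cond_nil rfl (Ex.push (l := [[]]) 0 true (by simp))).mono (by simp)
  · exact (Ex.cond_false rfl ((Ex.clr (l := [false :: a]) 0 (by simp)).seq
      (Ex.push (l := [[]]) 0 false (by simp))))
  · exact (Ex.cond_true rfl ((Ex.clr (l := [true :: a]) 0 (by simp)).seq
      (Ex.push (l := [[]]) 0 false (by simp))))

end
end Machine

-- Folds with bounded state, and the list functions they provide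

namespace Machine
open Machine.Enc (enc)
section
variable {α : Type*} {β : Type*} {γ : Type*} {δ : Type*} {σ : Type*}
variable [Enc α] [Enc β] [Enc γ] [Enc δ] [Enc σ]

/-- One step of a fold: registers `0`, `1`, `2` hold the list and, reversed, the context and the
state. -/
def foldBody (c : Cmd) : Cmd :=
  dec 0 3 4 ;; mv 3 7 ;; mvEnc 2 7 ;; .push 7 false ;;
    bitLoop 1 (fun x => .push 4 x ;; .push 7 x ;; .push 7 true) ;; mv 4 1 ;; c.shift 7 ;; mv 7 2

/-- The argument `(a, s, b)` of the step function is assembled in register `7` from back to front: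
the entry `b`, then the state `s`, then the context `a`, of which register `4` keeps a copy for the
next round. -/
theorem ex_foldBody {c : Cmd} {a s b s' l : List Bool} {T : ℕ}
    (h : Ex c (st [encStr a ++ (encStr s ++ b)]) (st [s']) T) :
    Ex (foldBody c) (st [encStr b ++ l, a.reverse, s.reverse, [], [], [], [], []])
      (st [l, a.reverse, s'.reverse, [], [], [], [], []])
      (16 * b.length + 6 * l.length + 5 * s.length + 10 * a.length + 4 * s'.length + T + 25) := by
  have h1 : Ex (dec 0 3 4) (st [encStr b ++ l, a.reverse, s.reverse, [], [], [], [], []])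
      (st [l, a.reverse, s.reverse, b.reverse, [], [], [], []]) (6 * (encStr b ++ l).length + 9) := by
    simpa [unstr_encStr] using Ex.dec (l := [encStr b ++ l, a.reverse, s.reverse, [], [], [], [], []])
      0 3 4 (by simp) (by simp) (by simp) (by simp) (by simp) (by simp) rfl
  have h2 : Ex (mv 3 7) (st [l, a.reverse, s.reverse, b.reverse, [], [], [], []])
      (st [l, a.reverse, s.reverse, [], [], [], [], b]) (4 * b.length + 1) := by
    simpa using Ex.mv (l := [l, a.reverse, s.reverse, b.reverse, [], [], [], []]) 3 7
      (by simp) (by simp) (by simp)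
  have h3 : Ex (mvEnc 2 7) (st [l, a.reverse, s.reverse, [], [], [], [], b])
      (st [l, a.reverse, [], [], [], [], [], encStr s ++ b]) (5 * s.length + 2) := by
    simpa using Ex.mvEnc (l := [l, a.reverse, s.reverse, [], [], [], [], b]) 2 7
      (by simp) (by simp) (by simp)
  have h4 := Ex.push (l := [l, a.reverse, [], [], [], [], [], encStr s ++ b]) 7 false (by simp)
  have h5 := Ex.bitLoop (a := 1) (c := fun x => .push 4 x ;; .push 7 x ;; .push 7 true) (K := 4)
    (fun d r => st [l, r, [], [], d, [], [], encStr d ++ (encStr s ++ b)]) (fun d r => rfl)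
    (fun d x r => (Ex.pop (l := [l, x :: r, [], [], d, [], [], encStr d ++ (encStr s ++ b)]) 1
      (by simp)).seq ((Ex.push 4 x (by simp)).seq ((Ex.push 7 x (by simp)).seq
      (Ex.push 7 true (by simp))))) a.reverse []
  rw [List.reverse_reverse, List.append_nil] at h5
  have h6 : Ex (mv 4 1) (st [l, [], [], [], a, [], [], encStr a ++ (encStr s ++ b)])
      (st [l, a.reverse, [], [], [], [], [], encStr a ++ (encStr s ++ b)]) (4 * a.length + 1) := by
    simpa using Ex.mv (l := [l, [], [], [], a, [], [], encStr a ++ (encStr s ++ b)]) 4 1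
      (by simp) (by simp) (by simp)
  have h7 := h.call7 l a.reverse [] [] [] [] []
  have h8 : Ex (mv 7 2) (st [l, a.reverse, [], [], [], [], [], s'])
      (st [l, a.reverse, s'.reverse, [], [], [], [], []]) (4 * s'.length + 1) := by
    simpa using Ex.mv (l := [l, a.reverse, [], [], [], [], [], s']) 7 2
      (by simp) (by simp) (by simp)
  refine (h1.seq (h2.seq (h3.seq (h4.seq (h5.seq (h6.seq (h7.seq h8))))))).mono ?_
  simp [length_encStr]
  omega

/-- Folding over a list takes polynomial time if the state stays of polynomial size. -/
theorem PF.foldl {l : α → List β} {g : α → σ} {h : α → σ → β → σ} (hl : PF l) (hg : PF g)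
    (hh : PF fun x : α × σ × β => h x.1 x.2.1 x.2.2) {B : α → ℕ} (hB : PB sz B)
    (hs : ∀ a m, m <+: l a → sz (m.foldl (h a) (g a)) ≤ B a) :
    PF fun a => (l a).foldl (h a) (g a) := by
  have hls := hl.pb_sz
  obtain ⟨c₀, hc₀, T₀, hT₀, h₀⟩ := PF.mk PF.id (PF.mk hg hl)
  obtain ⟨c, hc, T, ⟨p, hp⟩, hcT⟩ := hh
  -- The argument of `p` bounds the code length of the triple of context, state and entry; `B a`
  -- bounds the state and `sz (l a)` every entry. `K` bounds the time of a whole round.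
  let M : α → ℕ := fun a => p.eval (2 * sz a + 1 + (2 * B a + 1 + sz (l a)))
  let K : α → ℕ := fun a => 40 * sz (l a) + 10 * B a + 10 * sz a + M a + 40
  have hM : PB sz M := PB.eval (((PB.const _ 2).mul (.self _)).add (.const _ 1) |>.add
    ((((PB.const _ 2).mul hB).add (.const _ 1)).add hls)) p
  have hK : PB sz K := ((((PB.const _ 40).mul hls).add ((PB.const _ 10).mul hB)).add
    ((PB.const _ 10).mul (.self _))).add hM |>.add (.const _ _)
  refine ⟨c₀ ;; dec 0 1 4 ;; dec 0 2 4 ;; .loop 0 (foldBody c) ;; clr 1 ;; mv 2 0,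
    by simp [hc₀, hc, foldBody],
    fun a => T₀ a + (30 * (sz a + B a + sz (l a)) + 50) + ((K a + 1) * sz (l a) + 1), ?_, fun a => ?_⟩
  · exact (hT₀.add (((PB.const _ 30).mul (((PB.self _).add hB).add hls)).add (.const _ _))).add
      (((hK.add (.const _ _)).mul hls).add (.const _ _))
  · have hg0 : sz (g a) ≤ B a := hs a [] (List.nil_prefix)
    -- `m₁` has been processed and `m₂` is still in register `0`. The size bound `hs` is available
    -- exactly because `m₁` is a prefix of the list.
    have key : ∀ m₂ m₁, m₁ ++ m₂ = l a → Ex (.loop 0 (Machine.foldBody c))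
        (st [enc m₂, (enc a).reverse, (enc (m₁.foldl (h a) (g a))).reverse, [], [], [], [], []])
        (st [[], (enc a).reverse, (enc ((l a).foldl (h a) (g a))).reverse, [], [], [], [], []])
        ((K a + 1) * m₂.length + 1) := by
      intro m₂
      induction m₂ with
      | nil =>
        intro m₁ hm
        rw [List.append_nil] at hm
        subst hm
        exact (Ex.loop_nil rfl).mono (by simp)
      | cons b m₂ ih =>
        intro m₁ hm
        have h1 := ih (m₁ ++ [b]) (by simpa using hm)
        have hs1 := hs a m₁ ⟨_, hm⟩
        have hs2 := hs a (m₁ ++ [b]) ⟨m₂, by simpa using hm⟩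
        have hb : 2 * sz b + 1 + sz m₂ ≤ sz (l a) := by rw [← hm]; simp
        have h2 := ex_foldBody (l := enc m₂) (hcT (a, m₁.foldl (h a) (g a), b))
        have hT : T (a, m₁.foldl (h a) (g a), b) ≤ M a := by
          refine (hp _).trans (eval_mono _ ?_)
          simp only [sz_pair]
          omega
        rw [List.foldl_append] at h1 hs2
        refine (Ex.loop_cons ?_ h2 h1).mono ?_
        -- Every entry contributes at least its end marker, so the register is empty only when the
        -- list is.
        · intro h
          have : encStr (enc b) ++ enc m₂ = [] := h
          have h3 := congrArg List.length this
          simp [length_encStr] at h3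
        · simp only [List.length_cons, List.foldl_cons, List.foldl_nil] at hs2 ⊢
          have hKa : K a = 40 * sz (l a) + 10 * B a + 10 * sz a + M a + 40 := rfl
          simp only [sz] at *
          rw [mul_add, mul_one]
          omega
    have h1 : Ex (dec 0 1 4) (st [enc (a, g a, l a)])
        (st [encStr (enc (g a)) ++ enc (l a), (enc a).reverse, [], [], [], [], [], []])
        (6 * (enc (a, g a, l a)).length + 9) := by
      rw [st8]
      simpa [unstr_encStr] using Ex.dec (l := [enc (a, g a, l a), [], [], [], [], [], [], []])
        0 1 4 (by simp) (by simp) (by simp) (by simp) (by simp) (by simp) rfl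
    have h2 : Ex (dec 0 2 4)
        (st [encStr (enc (g a)) ++ enc (l a), (enc a).reverse, [], [], [], [], [], []])
        (st [enc (l a), (enc a).reverse, (enc (g a)).reverse, [], [], [], [], []])
        (6 * (encStr (enc (g a)) ++ enc (l a)).length + 9) := by
      simpa [unstr_encStr] using
        Ex.dec (l := [encStr (enc (g a)) ++ enc (l a), (enc a).reverse, [], [], [], [], [], []])
        0 2 4 (by simp) (by simp) (by simp) (by simp) (by simp) (by simp) rfl
    have h3 := key (l a) [] rfl
    have h4 := Ex.clr (l := [[], (enc a).reverse, (enc ((l a).foldl (h a) (g a))).reverse, [], [], [], [],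
      []]) 1 (by simp)
    have h5 : Ex (mv 2 0) (st [[], [], (enc ((l a).foldl (h a) (g a))).reverse, [], [], [], [], []])
        (st [enc ((l a).foldl (h a) (g a))]) (4 * (enc ((l a).foldl (h a) (g a))).length + 1) := by
      rw [st8 (enc ((l a).foldl (h a) (g a)))]
      simpa using Ex.mv (l := [[], [], (enc ((l a).foldl (h a) (g a))).reverse, [], [], [], [], []]) 2 0
        (by simp) (by simp) (by simp)
    refine ((h₀ a).seq (h1.seq (h2.seq (h3.seq (h4.seq h5))))).mono ?_
    have hfin := hs a (l a) List.prefix_rfl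
    have hlen := length_le_sz (l a)
    simp only [sz] at *
    simp [length_encStr] at *
    have hmul : (K a + 1) * (l a).length ≤ (K a + 1) * (enc (l a)).length :=
      Nat.mul_le_mul_left _ hlen
    omega

theorem PF.foldl_fin {l : α → List β} {g : α → Bool} {h : α → Bool → β → Bool} (hl : PF l) (hg : PF g)
    (hh : PF fun x : α × Bool × β => h x.1 x.2.1 x.2.2) : PF fun a => (l a).foldl (h a) (g a) :=
  hl.foldl hg hh (B := fun _ => 1) (.const _ 1) fun _ _ _ => le_rfl

@[fun_prop] theorem PF.cons {f : α → β} {l : α → List β} (hf : PF f) (hl : PF l) :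
    PF fun a => f a :: l a :=
  (hf.mk hl).cast (fun a => a) (fun _ => rfl) fun _ => rfl

@[fun_prop] theorem PF.not {f : α → Bool} (hf : PF f) : PF fun a => !f a :=
  (hf.ite (PF.const false) (PF.const true)).cast (fun a => a) (fun _ => rfl) fun a => by
    cases f a <;> rfl

@[fun_prop] theorem PF.and {f g : α → Bool} (hf : PF f) (hg : PF g) : PF fun a => f a && g a :=
  (hf.ite hg (PF.const false)).cast (fun a => a) (fun _ => rfl) fun a => by
    cases f a <;> rfl

@[fun_prop] theorem PF.or {f g : α → Bool} (hf : PF f) (hg : PF g) : PF fun a => f a || g a :=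
  (hf.ite (PF.const true) hg).cast (fun a => a) (fun _ => rfl) fun a => by
    cases f a <;> rfl

theorem foldl_or (p : β → Bool) (l : List β) : ∀ s, l.foldl (fun s b => s || p b) s = (s || l.any p) := by
  induction l with
  | nil => simp
  | cons b l ih => intro s; simp [ih, Bool.or_assoc]

@[fun_prop] theorem PF.any {l : α → List β} {p : α → β → Bool} (hl : PF l)
    (hp : PF fun x : α × β => p x.1 x.2) : PF fun a => (l a).any (p a) := by
  have := hl.foldl_fin (g := fun _ => false) (h := fun a s b => s || p a b) (.const _)
    (.or (by fun_prop) (PF.comp (f := fun x : α × Bool × β => (x.1, x.2.2)) hp (by fun_prop)))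
  simpa only [foldl_or, Bool.false_or] using this

@[fun_prop] theorem PF.all {l : α → List β} {p : α → β → Bool} (hl : PF l)
    (hp : PF fun x : α × β => p x.1 x.2) : PF fun a => (l a).all (p a) := by
  have : PF fun a => !((l a).any fun b => !p a b) := by fun_prop
  refine this.cast (fun a => a) (fun _ => rfl) fun a => ?_
  rw [← List.all_eq_not_any_not]

/-- The code of an element, as a string. -/
def toRaw (a : α) : Raw := ⟨enc a⟩

@[fun_prop] theorem PF.toRaw {f : α → β} (hf : PF f) : PF fun a => toRaw (f a) :=
  hf.cast (fun a => a) (fun _ => rfl) fun _ => rfl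

@[fun_prop] theorem PF.isEmpty {l : α → List β} (hl : PF l) : PF fun a => (l a).isEmpty :=
  (PF.rawIsNil.comp hl.toRaw).cast (fun a => a) (fun _ => rfl) fun a => by
    cases h : l a with
    | nil => simp [Raw.isNil, Machine.toRaw]
    | cons b m => cases e : enc b <;> simp [Raw.isNil, Machine.toRaw, e]

@[fun_prop] theorem PF.tail {l : α → List β} (hl : PF l) : PF fun a => (l a).tail :=
  (PF.rawSnd.comp hl.toRaw).cast (fun a => a) (fun _ => rfl) fun a => by
    cases h : l a with
    | nil => simp [Machine.toRaw, Raw.snd, unstr]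
    | cons b m => simp [Machine.toRaw, Raw.snd, unstr_encStr]

@[fun_prop] theorem PF.headD {l : α → List β} {d : α → β} (hl : PF l) (hd : PF d) :
    PF fun a => (l a).headD (d a) := by
  refine (hl.isEmpty.ite hd.toRaw (PF.rawFst.comp hl.toRaw)).cast (fun a => a) (fun _ => rfl) fun a => ?_
  cases h : l a with
  | nil => rfl
  | cons b m => simp [Machine.toRaw, Raw.fst, unstr_encStr]

theorem foldl_cons (l : List β) : ∀ s : List β, l.foldl (fun s b => b :: s) s = l.reverse ++ s := by
  induction l with
  | nil => simp
  | cons b l ih => intro s; simp [ih]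

@[fun_prop] theorem PF.reverse {l : α → List β} (hl : PF l) : PF fun a => (l a).reverse := by
  have := hl.foldl (g := fun _ => ([] : List β)) (h := fun _ s b => b :: s) (.const _) (by fun_prop)
    hl.pb_sz fun a m hm => by
      rw [foldl_cons, List.append_nil, sz_reverse]
      exact sz_sublist hm.sublist
  simpa only [foldl_cons, List.append_nil] using this

@[fun_prop] theorem PF.append {l m : α → List β} (hl : PF l) (hm : PF m) : PF fun a => l a ++ m a := by
  have := hl.reverse.foldl (g := m) (h := fun _ s b => b :: s) hm (by fun_prop)
    (hl.pb_sz.add hm.pb_sz) fun a k hk => by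
      rw [foldl_cons]
      have := sz_sublist hk.sublist
      simp at this ⊢
      exact this
  simpa only [foldl_cons, List.reverse_reverse] using this

theorem foldl_filter (p : β → Bool) (l : List β) : ∀ s : List β,
    l.foldl (fun s b => if p b then b :: s else s) s = (l.filter p).reverse ++ s := by
  induction l with
  | nil => simp
  | cons b l ih => intro s; by_cases h : p b <;> simp [ih, h]

@[fun_prop] theorem PF.filter {l : α → List β} {p : α → β → Bool} (hl : PF l)
    (hp : PF fun x : α × β => p x.1 x.2) : PF fun a => (l a).filter (p a) := by
  have hp' : PF fun x : α × List β × β => p x.1 x.2.2 :=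
    PF.comp (f := fun x : α × List β × β => (x.1, x.2.2)) hp (by fun_prop)
  have := hl.foldl (g := fun _ => ([] : List β)) (h := fun a s b => if p a b then b :: s else s)
    (.const _) (by fun_prop) hl.pb_sz fun a m hm => by
      rw [foldl_filter, List.append_nil, sz_reverse]
      exact sz_sublist (List.filter_sublist.trans hm.sublist)
  have := this.reverse
  simpa only [foldl_filter, List.append_nil, List.reverse_reverse] using this

theorem foldl_flatMap (f : β → List γ) (l : List β) : ∀ s : List γ,
    l.foldl (fun s b => (f b).reverse ++ s) s = (l.flatMap f).reverse ++ s := by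
  induction l with
  | nil => simp
  | cons b l ih => intro s; simp [ih]

theorem sz_flatMap_le {f : β → List γ} {l : List β} {M : ℕ} (h : ∀ b ∈ l, sz (f b) ≤ M) :
    sz (l.flatMap f) ≤ l.length * M := by
  induction l with
  | nil => simp
  | cons b l ih =>
    have h1 := h b (by simp)
    have h2 := ih fun a ha => h a (by simp [ha])
    simp only [List.flatMap_cons, sz_append, List.length_cons, add_mul]; omega

@[fun_prop] theorem PF.flatMap {l : α → List β} {f : α → β → List γ} (hl : PF l)
    (hf : PF fun x : α × β => f x.1 x.2) : PF fun a => (l a).flatMap (f a) := by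
  have hf' : PF fun x : α × List γ × β => f x.1 x.2.2 :=
    PF.comp (f := fun x : α × List γ × β => (x.1, x.2.2)) hf (by fun_prop)
  obtain ⟨p, hp⟩ := hf.pb_sz
  have := hl.foldl (g := fun _ => ([] : List γ)) (h := fun a s b => (f a b).reverse ++ s)
    (.const _) (by fun_prop) (B := fun a => sz (l a) * p.eval (2 * sz a + 1 + sz (l a)))
    (hl.pb_sz.mul (PB.eval ((((PB.const _ 2).mul (.self _)).add (.const _ 1)).add hl.pb_sz) p))
    fun a m hm => by
      rw [foldl_flatMap, List.append_nil, sz_reverse]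
      refine (sz_flatMap_le (M := p.eval (2 * sz a + 1 + sz (l a))) fun b hb => ?_).trans ?_
      · refine (hp (a, b)).trans (eval_mono p ?_)
        rw [sz_pair]
        have := sz_le_of_mem (hm.subset hb)
        omega
      · exact Nat.mul_le_mul_right _ (hm.length_le.trans (length_le_sz _))
  have := this.reverse
  simpa only [foldl_flatMap, List.append_nil, List.reverse_reverse] using this

@[fun_prop] theorem PF.map {l : α → List β} {f : α → β → γ} (hl : PF l)
    (hf : PF fun x : α × β => f x.1 x.2) : PF fun a => (l a).map (f a) := by
  have : PF fun a => (l a).flatMap fun b => [f a b] := by fun_prop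
  simpa only [← List.map_eq_flatMap] using this

/-- The code of an element, as a list of bits. -/
@[fun_prop] theorem PF.code {f : α → β} (hf : PF f) : PF fun a => enc (f a) :=
  PF.rawBits.comp hf.toRaw

@[fun_prop] theorem PF.bits {f : α → Raw} (hf : PF f) : PF fun a => (f a).bits :=
  PF.rawBits.comp hf

theorem foldl_rawCons (l : List Bool) : ∀ s : Raw,
    l.foldl (fun (s : Raw) b => Raw.cons (b, s)) s = ⟨l.reverse ++ s.bits⟩ := by
  induction l with
  | nil => intro s; rfl
  | cons b l ih => intro s; rw [List.foldl_cons, ih]; simp [Raw.cons]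

@[fun_prop] theorem PF.rawMk {f : α → List Bool} (hf : PF f) : PF fun a => Raw.mk (f a) := by
  have hc : PF fun x : α × Raw × Bool => Raw.cons (x.2.2, x.2.1) := PF.rawCons.comp (by fun_prop)
  have := hf.reverse.foldl (g := fun _ => Raw.mk []) (h := fun _ s b => Raw.cons (b, s))
    (.const _) hc hf.pb_sz fun a m hm => by
      rw [foldl_rawCons, sz_raw]
      have h1 := hm.length_le
      have h2 := length_le_sz (f a)
      simp at h1 ⊢
      omega
  refine this.cast (fun a => a) (fun _ => rfl) fun a => ?_
  rw [foldl_rawCons]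
  simp

/-- Equality of codes. -/
def eqb (a b : α) : Bool := decide (enc a = enc b)

/-- Equality of bit lists by a fold. -/
theorem foldl_eq (l : List Bool) : ∀ (m : List Bool) (s : Bool),
    (l.foldl (fun (s : Bool × List Bool) b => (s.1 && !s.2.isEmpty && (if b then s.2.headD false else !s.2.headD true),
      s.2.tail)) (s, m)) = (s && decide (l <+: m), m.drop l.length) := by
  induction l with
  | nil => simp
  | cons b l ih =>
    intro m s
    rw [List.foldl_cons, ih]
    cases m with
    | nil => simp
    | cons c m => cases b <;> cases c <;> simp [List.cons_prefix_cons] <;> rfl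

@[fun_prop] theorem PF.eqb {f g : α → β} (hf : PF f) (hg : PF g) : PF fun a => eqb (f a) (g a) := by
  have h := PF.foldl (l := fun a => enc (f a))
    (g := fun a => (true, (enc (g a))))
    (h := fun _ (s : Bool × List Bool) b => (s.1 && !s.2.isEmpty && (if b then s.2.headD false else !s.2.headD true),
      s.2.tail)) (by fun_prop) (by fun_prop) (by fun_prop)
    (B := fun a => 3 + sz (enc (g a)))
    ((PB.const _ 3).add (PF.pb_sz hg.code)) fun a m hm => by
      rw [foldl_eq]
      have := sz_sublist (List.drop_sublist m.length (enc (g a)))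
      simp; omega
  refine ((PF.fst h).and (PF.snd h).isEmpty).cast (fun a => a) (fun _ => rfl) fun a => ?_
  simp only [foldl_eq, Machine.eqb, enc_bool]
  congr 1
  generalize enc (f a) = x
  generalize enc (g a) = y
  rw [Bool.eq_iff_iff]
  simp only [Bool.true_and, Bool.and_eq_true, decide_eq_true_eq, List.isEmpty_iff, List.drop_eq_nil_iff]
  constructor
  · rintro ⟨h1, h2⟩; exact h1.eq_of_length_le h2
  · rintro rfl; exact ⟨List.prefix_rfl, le_rfl⟩

end
end Machine

namespace Machine
open Machine.Enc (enc)

/-! ## Programs and polynomial-time functions -/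

/-- Only `guess` offers a choice, for oracle answers are determined by `O`. Thus any given run of a
deterministic program ends where the explicitly constructed one does. -/
theorem Runs.det {O : Language Bool} {c : Cmd} {s s' : Store} {t k : ℕ} (h : Runs O c s t k s') :
    c.Deterministic → ∀ {t' k' : ℕ} {s'' : Store}, Runs O c s t' k' s'' → s'' = s' := by
  induction h with
  | skip => intro _ _ _ _ h'; cases h'; rfl
  | push => intro _ _ _ _ h'; cases h'; rfl
  | pop => intro _ _ _ _ h'; cases h'; rfl
  | seq _ _ ih ih' =>
    intro hd _ _ _ h'
    cases h' with
    | seq h1 h2 => cases ih hd.1 h1; exact ih' hd.2 h2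
  | cond_empty h _ ih =>
    intro hd _ _ _ h'
    cases h' with
    | cond_empty _ h2 => exact ih hd.1 h2
    | cond_false h1 _ => simp [h] at h1
    | cond_true h1 _ => simp [h] at h1
  | cond_false h _ ih =>
    intro hd _ _ _ h'
    cases h' with
    | cond_empty h1 _ => simp [h1] at h
    | cond_false _ h2 => exact ih hd.2.1 h2
    | cond_true h1 _ => simp [h] at h1
  | cond_true h _ ih =>
    intro hd _ _ _ h'
    cases h' with
    | cond_empty h1 _ => simp [h1] at h
    | cond_false h1 _ => simp [h] at h1
    | cond_true _ h2 => exact ih hd.2.2 h2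
  | loop_done h =>
    intro _ _ _ _ h'
    cases h' with
    | loop_done => rfl
    | loop_step h1 => exact absurd h h1
  | loop_step h _ _ ih ih' =>
    intro hd _ _ _ h'
    cases h' with
    | loop_done h1 => exact absurd h1 h
    | loop_step _ h1 h2 => cases ih hd h1; exact ih' hd h2
  | guess => intro hd; exact hd.elim
  | query s r a b h =>
    intro _ _ _ _ h'
    cases h' with
    | query _ _ _ b' h1 =>
      have : b = b' := Bool.eq_iff_iff.2 (h.trans h1.symm)
      rw [this]

theorem Runs.oracleFree {O : Language Bool} {c : Cmd} {s s' : Store} {t k : ℕ}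
    (h : Runs O c s t k s') (hc : c.OracleFree) (O' : Language Bool) : Runs O' c s t 0 s' := by
  induction h with
  | skip s => exact .skip s
  | push s r b => exact .push s r b
  | pop s r => exact .pop s r
  | seq _ _ ih ih' => exact .seq (ih hc.1) (ih' hc.2)
  | cond_empty h _ ih => exact .cond_empty h (ih hc.1)
  | cond_false h _ ih => exact .cond_false h (ih hc.2.1)
  | cond_true h _ ih => exact .cond_true h (ih hc.2.2)
  | loop_done h => exact .loop_done h
  | loop_step h _ _ ih ih' => exact .loop_step h (ih hc) (ih' hc)
  | guess s r b => exact .guess s r b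
  | query => exact hc.elim

theorem Ex.unique {O : Language Bool} {c : Cmd} {s s' s'' : Store} {T t k : ℕ} (h : Ex c s s' T)
    (hc : c.Deterministic) (h' : Runs O c s t k s'') : s'' = s' :=
  let ⟨_, _, r⟩ := h O
  r.det hc h'

/-- All registers of the program are below `c.width`. -/
def Cmd.width : Cmd → ℕ
  | .skip => 0
  | .push r _ => r + 1
  | .pop r => r + 1
  | .seq c d => max c.width d.width
  | .cond _ c d e => max c.width (max d.width e.width)
  | .loop _ c => c.width
  | .guess r => r + 1
  | .query _ a => a + 1

/-- The width takes account of the registers that are written; registers that are merely tested or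
sent to the oracle are irrelevant here. -/
theorem Runs.eq_of_width {O : Language Bool} {c : Cmd} {s s' : Store} {t k : ℕ}
    (h : Runs O c s t k s') {r : ℕ} (hr : c.width ≤ r) : s' r = s r := by
  induction h with
  | skip => rfl
  | push s q b => simp only [Cmd.width] at hr; rw [Function.update_of_ne (by omega)]
  | pop s q => simp only [Cmd.width] at hr; rw [Function.update_of_ne (by omega)]
  | seq _ _ h1 h2 =>
    simp only [Cmd.width, max_le_iff] at hr
    rw [h2 hr.2, h1 hr.1]
  | cond_empty _ _ ih => simp only [Cmd.width, max_le_iff] at hr; exact ih hr.1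
  | cond_false _ _ ih => simp only [Cmd.width, max_le_iff] at hr; exact ih hr.2.1
  | cond_true _ _ ih => simp only [Cmd.width, max_le_iff] at hr; exact ih hr.2.2
  | loop_done => rfl
  | loop_step _ _ _ h1 h2 => rw [h2 hr, h1 hr]
  | guess s q b => simp only [Cmd.width] at hr; rw [Function.update_of_ne (by omega)]
  | query s q a b _ => simp only [Cmd.width] at hr; rw [Function.update_of_ne (by omega)]

theorem Ex.clr_store (a : ℕ) (s : Store) :
    Ex (Machine.clr a) s (Function.update s a []) (4 * (s a).length + 1) := by
  have := Ex.bitLoop (a := a) (c := fun _ => .skip) (K := 2) (fun _ r => Function.update s a r)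
    (fun d r => by simp)
    (fun d b r => by
      refine Ex.seq (T := 1) (T' := 1) (fun O => ⟨1, le_rfl, ?_⟩) (Ex.skip _)
      simpa using Runs.pop (O := O) (Function.update s a (b :: r)) a) (s a) []
  rwa [Function.update_eq_self] at this

/-- Empty the registers `1, …, n`. -/
def clrs : ℕ → Cmd
  | 0 => .skip
  | n + 1 => clr (n + 1) ;; clrs n

theorem plain_clrs (n : ℕ) : (clrs n).Plain := by
  induction n <;> simp_all [clrs]

theorem ex_clrs (n M : ℕ) : ∀ s : Store, (∀ r, (s r).length ≤ M) →
    Ex (clrs n) s (fun r => if 1 ≤ r ∧ r ≤ n then [] else s r) (n * (4 * M + 1) + 1) := by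
  induction n with
  | zero =>
    intro s _
    have : (fun r => if 1 ≤ r ∧ r ≤ 0 then [] else s r) = s := by
      funext r; rw [if_neg (by omega)]
    rw [this]
    exact (Ex.skip s).mono (by omega)
  | succ n ih =>
    intro s hs
    have h2 := ih (Function.update s (n + 1) []) fun r => by
      by_cases h : r = n + 1
      · subst h; simp
      · simpa [h] using hs r
    have h1 := (Ex.clr_store (n + 1) s).seq h2
    have e : (fun r => if 1 ≤ r ∧ r ≤ n then [] else Function.update s (n + 1) [] r) =
        fun r => if 1 ≤ r ∧ r ≤ n + 1 then [] else s r := by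
      funext r
      by_cases h : r = n + 1
      · subst h; simp
      · have : (1 ≤ r ∧ r ≤ n) ↔ (1 ≤ r ∧ r ≤ n + 1) := by omega
        simp [h, this]
    rw [e] at h1
    have := hs (n + 1)
    exact h1.mono (by rw [add_mul, one_mul]; omega)

section
variable {α : Type*} {β : Type*} [Enc α] [Enc β]

/-- A program that leaves the value in register `0` computes it in polynomial time. -/
theorem PF.of_runs {f : α → β} (c : Cmd) (p : Polynomial ℕ) (hd : c.Deterministic)
    (ho : c.OracleFree) (h : ∀ a, ∃ t k s, Runs 0 c (start (enc a)) t k s ∧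
      t ≤ p.eval (enc a).length ∧ s 0 = enc (f a)) : PF f := by
  -- `PF` demands that all registers but `0` end up empty, which an arbitrary program need not
  -- ensure. Registers above the width were empty at the start and have not been written.
  refine ⟨c ;; clrs c.width, (plain_seq _ _).2 ⟨⟨hd, ho⟩, plain_clrs _⟩,
    fun a => p.eval (sz a) + (c.width * (4 * (sz a + p.eval (sz a)) + 1) + 1), ?_, fun a => ?_⟩
  · exact ((PB.self _).eval p).add (((PB.const _ _).mul (((PB.const _ 4).mul ((PB.self _).add
      ((PB.self _).eval p))).add (.const _ _))).add (.const _ _))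
  · obtain ⟨t, k, s, hr, ht, hs⟩ := h a
    have hM : ∀ r, (s r).length ≤ sz a + p.eval (sz a) := fun r => by
      refine (hr.length_le r).trans (add_le_add ?_ ht)
      by_cases h : r = 0 <;> simp [start, h, sz]
    have e : (fun r => if 1 ≤ r ∧ r ≤ c.width then [] else s r) = st [enc (f a)] := by
      funext r
      rcases r with _ | r
      · simp [hs, st]
      · by_cases h : r + 1 ≤ c.width
        · simp [h, st]
        · rw [if_neg (by omega), hr.eq_of_width (by omega)]
          simp [start, st]
    have h2 := ex_clrs c.width _ s hM
    rw [e] at h2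
    rw [← start_eq_st]
    refine Ex.seq (fun O => ⟨t, ht, hr.oracleFree ho O⟩) h2

/-- The representations of instances of a problem. -/
def CodeOf (Q : Problem) := {p : Q.Inst × List Bool // Q.Codes p.1 p.2}

instance (Q : Problem) : Enc (CodeOf Q) := ⟨fun z => z.1.2⟩

theorem enc_codeOf {Q : Problem} (z : CodeOf Q) : enc z = z.1.2 := rfl

-- A decision problem promises a correct output only on strings that represent an instance. With the
-- representations themselves as domain, the decision is a total function whose code-level
-- computation is the given program; of its output only the top bit matters.
open Classical in
theorem InP.pf {Q : Problem} (h : InP Q) : PF fun z : CodeOf Q => decide (Q.Yes z.1.1) := by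
  obtain ⟨c, p, hd, ho, h⟩ := h
  choose t k s hr ht hs using fun z : CodeOf Q => h z.1.1 z.1.2 z.2
  have h1 : PF fun z : CodeOf Q => (⟨s z 0⟩ : Raw) :=
    PF.of_runs c p hd ho fun z => ⟨_, _, _, hr z, ht z, rfl⟩
  have h2 : PF fun z : CodeOf Q => (⟨s z 0⟩ : Raw).bits.headD false := h1.bits.headD (.const _)
  refine h2.cast (fun z => z) (fun _ => rfl) fun z => ?_
  have := hs z
  simp only [Accepting] at this
  rw [enc_bool, enc_bool]
  congr 1
  rw [Bool.eq_iff_iff, decide_eq_true_eq, ← this]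
  cases s z 0 <;> simp

theorem PolyTimeComputable.pf {α : Type*} [Coded α] {w : α → ℕ} (h : PolyTimeComputable w) : PF w := by
  obtain ⟨c, p, hd, ho, h⟩ := h
  exact PF.of_runs c p hd ho h

/-! ## Nondeterministic machines -/

/-- Guess a string `y` of the same length as the input `x` and prepare the code of `(x, y)`. -/
def guessCmd : Cmd := mv2 0 1 2 ;; .loop 1 (.pop 1 ;; .guess 7) ;; mvEnc 2 7

theorem guessLoop_runs (O : Language Bool) (v y : List Bool) : ∀ z u : List Bool,
    z.length = u.length → ∃ t ≤ 3 * u.length + 1, Runs O (.loop 1 (.pop 1 ;; .guess 7))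
      (st [[], u, v, [], [], [], [], y]) t 0 (st [[], [], v, [], [], [], [], z.reverse ++ y]) := by
  intro z
  induction z generalizing y with
  | nil =>
    intro u hu
    obtain rfl := List.length_eq_zero_iff.1 hu.symm
    exact ⟨1, by simp, .loop_done rfl⟩
  | cons b z ih =>
    intro u hu
    obtain ⟨a, u, rfl⟩ : ∃ a u', u = a :: u' := by cases u <;> simp_all
    obtain ⟨t, ht, r⟩ := ih (b :: y) u (by simpa using hu)
    refine ⟨(1 + 1) + t + 1, by simp; omega, ?_⟩
    rw [List.reverse_cons, List.append_assoc]
    refine Runs.loop_step (k := 0) (k' := 0) (by simp [st]) (.seq (k := 0) (k' := 0)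
      (s' := st [[], u, v, [], [], [], [], y]) ?_ ?_) r
    · have := Runs.pop (O := O) (st [[], a :: u, v, [], [], [], [], y]) 1
      rwa [st_update _ (by simp)] at this
    · have := Runs.guess (O := O) (st [[], u, v, [], [], [], [], y]) 7 b
      rwa [st_update _ (by simp)] at this

theorem guessLoop_inv (O : Language Bool) (v : List Bool) : ∀ (u y : List Bool) {t k : ℕ} {s : Store},
    Runs O (.loop 1 (.pop 1 ;; .guess 7)) (st [[], u, v, [], [], [], [], y]) t k s →
    ∃ z : List Bool, z.length = u.length ∧ s = st [[], [], v, [], [], [], [], z ++ y] := by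
  intro u
  induction u with
  | nil =>
    intro y t k s h
    cases h with
    | loop_done => exact ⟨[], rfl, rfl⟩
    | loop_step h => exact absurd rfl h
  | cons a u ih =>
    intro y t k s h
    cases h with
    | loop_done h => simp [st] at h
    | loop_step _ h1 h2 =>
      cases h1 with
      | seq h3 h4 =>
        cases h3
        cases h4 with
        | guess _ _ b =>
        rw [st_update _ (by simp)] at h2
        rw [st_update _ (by simp)] at h2
        obtain ⟨z, hz, rfl⟩ := ih (b :: y) h2
        exact ⟨z ++ [b], by simp [hz], by simp⟩

theorem guessCmd_runs (O : Language Bool) (x y : List Bool) (h : y.length = x.length) :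
    ∃ t ≤ 13 * x.length + 4, Runs O guessCmd (start x) t 0
      (st [[], [], [], [], [], [], [], encStr x ++ y]) := by
  obtain ⟨t1, ht1, r1⟩ := Ex.mv2_0 x O
  obtain ⟨t2, ht2, r2⟩ := guessLoop_runs O x.reverse [] y.reverse x.reverse (by simpa)
  obtain ⟨t3, ht3, r3⟩ := Ex.mvEnc (l := [[], [], x.reverse, [], [], [], [], y]) 2 7 (by simp)
    (by simp) (by simp) O
  rw [start_eq_st, st8]
  simp at ht3 r3 ht2 r2
  exact ⟨_, by omega, r1.seq (r2.seq r3)⟩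

/-- Soundness of guessing: whatever is accepted after `guessCmd` has been accepted for an actual
string `y` of the right length. -/
theorem guessCmd_inv {O : Language Bool} {x : List Bool} {t k : ℕ} {s : Store}
    (h : Runs O guessCmd (start x) t k s) :
    ∃ y : List Bool, y.length = x.length ∧ s = st [[], [], [], [], [], [], [], encStr x ++ y] := by
  rw [start_eq_st, st8] at h
  cases h with
  | seq h1 h2 =>
    cases h2 with
    | seq h2 h3 =>
      cases (Ex.mv2_0 x).unique (plain_mv2 _ _ _).1 h1
      obtain ⟨y, hy, rfl⟩ := guessLoop_inv O _ _ _ h2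
      have h4 := (Ex.mvEnc (l := [[], [], x.reverse, [], [], [], [], y ++ []]) 2 7 (by simp)
        (by simp) (by simp)).unique (plain_mvEnc _ _).1 h3
      exact ⟨y, by simpa using hy, by simpa using h4⟩

/-- The projection of a polynomial-time relation is in `NP`. -/
theorem exists_np {V : α × Raw → Bool} (hV : PF V) : ∃ O : Language Bool, NP O ∧
    ∀ a, enc a ∈ O ↔ ∃ y : List Bool, y.length = (enc a).length ∧ V (a, ⟨y⟩) = true := by
  obtain ⟨c, hc, T, ⟨p, hp⟩, h⟩ := hV
  let N : Cmd := guessCmd ;; c.shift 7 ;; mv 7 0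
  -- `3n + 1 = (2n + 1) + n` is the length of the code of `(x, y)` when both strings have length
  -- `n`; the linear part pays for guessing and for moving the result.
  let P : Polynomial ℕ := .C 13 * .X + .C 9 + p.comp (.C 3 * .X + .C 1)
  have hP : ∀ n, P.eval n = 13 * n + 9 + p.eval (3 * n + 1) := fun n => by simp [P]
  -- The oracle is by definition what `N` accepts, so it lies in NP at once. Its meaning is needed
  -- only on strings that are codes.
  refine ⟨{x | AcceptsWithin 0 N x (P.eval x.length)}, ⟨N, P, ?_, fun x => Iff.rfl⟩, fun a => ?_⟩
  · simp [N, Cmd.OracleFree, guessCmd, mv2, mvEnc, mv, bitLoop, ((plain_shift 7 c).2 hc).2]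
  · have key : ∀ y : List Bool, y.length = (enc a).length →
        Ex (c.shift 7 ;; mv 7 0) (st [[], [], [], [], [], [], [], encStr (enc a) ++ y])
        (st [[V (a, ⟨y⟩)], [], [], [], [], [], [], []]) (p.eval (3 * (enc a).length + 1) + 5) := by
      intro y hy
      have h1 := (h (a, ⟨y⟩)).call7 [] [] [] [] [] [] []
      have h2 := Ex.mv (l := [[], [], [], [], [], [], [], [V (a, ⟨y⟩)]]) 7 0 (by simp) (by simp) (by simp)
      refine (h1.seq h2).mono (add_le_add ?_ le_rfl)
      refine (hp _).trans (eval_mono p ?_)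
      simp only [sz_pair, sz_raw, hy]
      simp only [sz]
      omega
    constructor
    · rintro ⟨t, k, s, hr, -, hacc⟩
      simp only [N] at hr
      cases hr with
      | seq h1 h2 =>
        obtain ⟨y, hy, rfl⟩ := guessCmd_inv h1
        have hpl : (c.shift 7 ;; mv 7 0).Plain := by simp [hc]
        cases (key y hy).unique hpl.1 h2
        refine ⟨y, hy, ?_⟩
        simpa [Accepting, st] using hacc
    · rintro ⟨y, hy, hV⟩
      obtain ⟨t, ht, r⟩ := guessCmd_runs 0 (enc a) y hy
      obtain ⟨t', ht', r'⟩ := key y hy 0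
      refine ⟨_, _, _, r.seq r', ?_, ?_⟩
      · rw [hP]; omega
      · simp [Accepting, st, hV]

/-- The machine for the complement guesses `y`, computes `V` and the query `F` together, and, if `V`
holds, asks the oracle once and negates the answer. -/
theorem InPi2.of_exists {Q : Problem} {V : CodeOf Q × Raw → Bool} {F : CodeOf Q × Raw → β} (hV : PF V)
    (hF : PF F) {O : Language Bool} (hO : NP O) (h : ∀ z : CodeOf Q, ¬ Q.Yes z.1.1 ↔
      ∃ y : List Bool, y.length = (enc z).length ∧ V (z, ⟨y⟩) = true ∧ enc (F (z, ⟨y⟩)) ∉ O) :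
    InPi2 Q := by
  obtain ⟨c, hc, T, ⟨p, hp⟩, hT⟩ := hV.mk hF
  let D : Cmd := c.shift 7 ;; .pop 7 ;; .cond 7 .skip .skip (.pop 7 ;; .pop 7 ;; .query 7 0 ;;
    .cond 0 .skip (.pop 0 ;; .push 0 true) (.pop 0 ;; .push 0 false))
  let P : Polynomial ℕ := .C 13 * .X + .C 19 + p.comp (.C 3 * .X + .C 1)
  have hP : ∀ n, P.eval n = 13 * n + 19 + p.eval (3 * n + 1) := fun n => by simp [P]
  have hD : D.Deterministic := by
    simp [D, Cmd.Deterministic, ((plain_shift 7 c).2 hc).1]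
  have key : ∀ (z : CodeOf Q) (y : List Bool), y.length = (enc z).length → ∃ t k s,
      Runs O D (st [[], [], [], [], [], [], [], encStr (enc z) ++ y]) t k s ∧
      t ≤ p.eval (3 * (enc z).length + 1) + 15 ∧
      (Accepting s ↔ V (z, ⟨y⟩) = true ∧ enc (F (z, ⟨y⟩)) ∉ O) := by
    intro z y hy
    obtain ⟨t, ht, r⟩ := (hT (z, ⟨y⟩)).call7 [] [] [] [] [] [] [] O
    have hT' : T (z, ⟨y⟩) ≤ p.eval (3 * (enc z).length + 1) := by
      refine (hp _).trans (eval_mono p ?_)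
      simp only [sz_pair, sz_raw, hy]
      simp only [sz]
      omega
    set q := enc (F (z, ⟨y⟩)) with hq
    -- One pop exposes the bit `V` for the branch; two more leave precisely the query in register
    -- `7`.
    have e : enc (V (z, ⟨y⟩), F (z, ⟨y⟩)) = true :: V (z, ⟨y⟩) :: false :: q := rfl
    rw [e] at r
    cases hv : V (z, ⟨y⟩)
    · rw [hv] at r
      obtain ⟨t2, ht2, r2⟩ := ((Ex.pop (l := [[], [], [], [], [], [], [], true :: false :: false :: q]) 7
        (by simp)).seq (Ex.cond_false (r := 7) (x := false :: q) (c := .skip) (e := .pop 7 ;; .pop 7 ;; .query 7 0 ;;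
        .cond 0 .skip (.pop 0 ;; .push 0 true) (.pop 0 ;; .push 0 false)) rfl (Ex.skip _))) O
      exact ⟨_, _, _, r.seq r2, by omega, by simp [Accepting, st]⟩
    · rw [hv] at r
      obtain ⟨t2, ht2, r2⟩ := Ex.pop (l := [[], [], [], [], [], [], [], true :: true :: false :: q]) 7
        (by simp) O
      obtain ⟨t3, ht3, r3⟩ := Ex.pop (l := [[], [], [], [], [], [], [], true :: false :: q]) 7
        (by simp) O
      obtain ⟨t4, ht4, r4⟩ := Ex.pop (l := [[], [], [], [], [], [], [], false :: q]) 7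
        (by simp) O
      classical
      have r5 := Runs.query (O := O) (st [[], [], [], [], [], [], [], q]) 7 0 (decide (q ∈ O))
        (by simp [st])
      rw [st_update _ (by simp)] at r5
      have r6 : ∃ t ≤ 3, Runs O (.cond 0 .skip (.pop 0 ;; .push 0 true) (.pop 0 ;; .push 0 false))
          (st [[decide (q ∈ O)], [], [], [], [], [], [], q]) t 0
          (st [[!decide (q ∈ O)], [], [], [], [], [], [], q]) := by
        cases decide (q ∈ O)
        · exact Ex.cond_false rfl ((Ex.pop (l := [[false], [], [], [], [], [], [], q]) 0 (by simp)).seq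
            (Ex.push 0 true (by simp))) O
        · exact Ex.cond_true rfl ((Ex.pop (l := [[true], [], [], [], [], [], [], q]) 0 (by simp)).seq
            (Ex.push 0 false (by simp))) O
      obtain ⟨t6, ht6, r6⟩ := r6
      refine ⟨_, _, _, r.seq (r2.seq (Runs.cond_true rfl (r3.seq (r4.seq (r5.seq r6))))), by omega, ?_⟩
      simp [Accepting, st]
  refine ⟨O, guessCmd ;; D, P, hO, fun I x hx => ?_⟩
  let z : CodeOf Q := ⟨(I, x), hx⟩
  refine (h z).trans ?_
  constructor
  · rintro ⟨y, hy, hVF⟩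
    obtain ⟨t, ht, r⟩ := guessCmd_runs O x y hy
    obtain ⟨t', k', s', r', ht', hs'⟩ := key z y hy
    refine ⟨_, _, _, r.seq r', ?_, hs'.2 hVF⟩
    rw [hP]
    have e : (enc z).length = x.length := rfl
    rw [e] at ht'
    omega
  · rintro ⟨t, k, s, hr, -, hacc⟩
    cases hr with
    | seq h1 h2 =>
      obtain ⟨y, hy, rfl⟩ := guessCmd_inv h1
      obtain ⟨t', k', s', r', -, hs'⟩ := key z y hy
      cases r'.det hD h2
      exact ⟨y, hy, hs'.1 hacc⟩

end
end Machine

namespace Machine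
open Machine.Enc (enc)

/-! ## Adaptive oracle queries -/

open Classical in
/-- The first `n` answers of the oracle `O`, the latest one first: each query consists of `x` and the
previous answers. -/
noncomputable def answers (O : Language Bool) (x : List Bool) : ℕ → List Bool
  | 0 => []
  | n + 1 => decide (encStr x ++ answers O x n ∈ O) :: answers O x n

theorem length_answers (O : Language Bool) (x : List Bool) (n : ℕ) : (answers O x n).length = n := by
  induction n <;> simp_all [answers]

/-- Ask the next query. -/
def askCmd : Cmd :=
  mv 2 3 ;; bitLoop 3 (fun b => .push 2 b ;; .push 7 b) ;; .push 7 false ;;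
    bitLoop 1 (fun b => .push 4 b ;; .push 7 b ;; .push 7 true) ;; mv 4 1 ;; .query 7 2 ;; clr 7

theorem askCmd_runs (O : Language Bool) (x l : List Bool) (n : ℕ) :
    ∃ t ≤ 20 * (x.length + n) + 20, Runs O askCmd
      (st [l, x.reverse, answers O x n, [], [], [], [], []]) t 1
      (st [l, x.reverse, answers O x (n + 1), [], [], [], [], []]) := by
  set a := answers O x n with ha
  have hlen : a.length = n := length_answers O x n
  have h1 : Ex (mv 2 3) (st [l, x.reverse, a, [], [], [], [], []])
      (st [l, x.reverse, [], a.reverse, [], [], [], []]) (4 * a.length + 1) := by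
    simpa using Ex.mv (l := [l, x.reverse, a, [], [], [], [], []]) 2 3 (by simp) (by simp) (by simp)
  have h2 := Ex.bitLoop (a := 3) (c := fun b => .push 2 b ;; .push 7 b) (K := 3)
    (fun d r => st [l, x.reverse, d, r, [], [], [], d]) (fun d r => rfl)
    (fun d b r => (Ex.pop (l := [l, x.reverse, d, b :: r, [], [], [], d]) 3 (by simp)).seq
      ((Ex.push 2 b (by simp)).seq (Ex.push 7 b (by simp)))) a.reverse []
  rw [List.reverse_reverse, List.append_nil] at h2
  have h3 := Ex.push (l := [l, x.reverse, a, [], [], [], [], a]) 7 false (by simp)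
  have h4 := Ex.bitLoop (a := 1) (c := fun b => .push 4 b ;; .push 7 b ;; .push 7 true) (K := 4)
    (fun d r => st [l, r, a, [], d, [], [], encStr d ++ a]) (fun d r => rfl)
    (fun d b r => (Ex.pop (l := [l, b :: r, a, [], d, [], [], encStr d ++ a]) 1
      (by simp)).seq ((Ex.push 4 b (by simp)).seq ((Ex.push 7 b (by simp)).seq
      (Ex.push 7 true (by simp))))) x.reverse []
  rw [List.reverse_reverse, List.append_nil] at h4
  have h5 : Ex (mv 4 1) (st [l, [], a, [], x, [], [], encStr x ++ a])
      (st [l, x.reverse, a, [], [], [], [], encStr x ++ a]) (4 * x.length + 1) := by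
    simpa using Ex.mv (l := [l, [], a, [], x, [], [], encStr x ++ a]) 4 1 (by simp) (by simp) (by simp)
  classical
  have r6 := Runs.query (O := O) (st [l, x.reverse, a, [], [], [], [], encStr x ++ a]) 7 2
    (decide (encStr x ++ a ∈ O)) (by simp [st])
  rw [st_update _ (by simp)] at r6
  have h7 := Ex.clr (l := [l, x.reverse, decide (encStr x ++ a ∈ O) :: a, [], [], [], [], encStr x ++ a])
    7 (by simp)
  obtain ⟨t1, ht1, r1⟩ := h1 O
  obtain ⟨t2, ht2, r2⟩ := h2 O
  obtain ⟨t3, ht3, r3⟩ := h3 O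
  obtain ⟨t4, ht4, r4⟩ := h4 O
  obtain ⟨t5, ht5, r5⟩ := h5 O
  obtain ⟨t7, ht7, r7⟩ := h7 O
  simp [length_encStr] at ht2 ht4 ht7
  refine ⟨_, ?_, r1.seq (r2.seq (r3.seq (r4.seq (r5.seq (r6.seq r7)))))⟩
  omega

/-- Register `0` serves as a unary counter: each of its bits, whatever its value, pays for one
query. -/
theorem askLoop_runs (O : Language Bool) (x : List Bool) (N : ℕ) : ∀ (w : List Bool) (n : ℕ),
    n + w.length ≤ N → ∃ t ≤ w.length * (20 * (x.length + N) + 22) + 1,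
      Runs O (.loop 0 (.pop 0 ;; askCmd)) (st [w, x.reverse, answers O x n, [], [], [], [], []]) t
        w.length (st [[], x.reverse, answers O x (n + w.length), [], [], [], [], []]) := by
  intro w
  induction w with
  | nil => intro n _; exact ⟨1, by simp, .loop_done rfl⟩
  | cons b w ih =>
    intro n hn
    simp only [List.length_cons] at hn
    obtain ⟨t1, ht1, r1⟩ := Ex.pop (l := [b :: w, x.reverse, answers O x n, [], [], [], [], []]) 0
      (by simp) O
    obtain ⟨t2, ht2, r2⟩ := askCmd_runs O x w n
    obtain ⟨t3, ht3, r3⟩ := ih (n + 1) (by omega)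
    have r := Runs.loop_step (r := 0) (by simp [st]) (r1.seq r2) r3
    refine ⟨t1 + t2 + t3 + 1, ?_, ?_⟩
    rotate_left
    · have e : n + (b :: w).length = n + 1 + w.length := by simp; omega
      have e' : (b :: w).length = 0 + 1 + w.length := by simp; omega
      rw [e, e']
      exact r
    · have : 20 * (x.length + n) ≤ 20 * (x.length + N) := by omega
      rw [List.length_cons, add_mul, one_mul]
      omega

section
variable {β : Type*} [Enc β] {Q : Problem}

/-- The program computes the fixed part `F z` of all queries and a counter, runs the query loop, and
accepts iff the last answer is negative. -/
theorem exists_adaptive {F : CodeOf Q → β} {W : CodeOf Q → List Bool} (hF : PF F) (hW : PF W)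
    (O : Language Bool) (h : ∀ z : CodeOf Q, Q.Yes z.1.1 ↔
      (answers O (enc (F z)) ((W z).length + 1)).head? = some false) :
    ∃ (c : Cmd) (p : Polynomial ℕ), c.Deterministic ∧
      ∀ z : CodeOf Q, ∃ t s, Runs O c (start z.1.2) t ((W z).length + 1) s ∧
        t ≤ p.eval z.1.2.length ∧ (Accepting s ↔ Q.Yes z.1.1) := by
  -- The counter is one longer than `W z`: one query per bit of `W z`, and the final one.
  have hW' : PF fun z => Raw.mk (true :: W z) := by fun_prop
  have hs := hF.pb_sz
  have hs' := hW'.pb_sz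
  obtain ⟨c, hc, T, hT, hcT⟩ := hF.mk hW'
  have hB : PB sz fun z => T z + (12 * sz (F z) + 6 * sz (Raw.mk (true :: W z)) + 30) +
      (sz (Raw.mk (true :: W z)) * (20 * (sz (F z) + sz (Raw.mk (true :: W z))) + 22) + 1) :=
    (hT.add ((((PB.const _ 12).mul hs).add ((PB.const _ 6).mul hs')).add (.const _ _))).add
      ((hs'.mul (((PB.const _ 20).mul (hs.add hs')).add (.const _ _))).add (.const _ _))
  obtain ⟨p, hp⟩ := hB
  refine ⟨c ;; dec 0 1 2 ;; .loop 0 (.pop 0 ;; askCmd) ;; .cond 2 .skip (.push 0 true) .skip, p, ?_,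
    fun z => ?_⟩
  · simp [Cmd.Deterministic, hc.1, (plain_dec 0 1 2).1, askCmd, (plain_mv _ _).1, (plain_clr _).1,
      bitLoop]
  · obtain ⟨t1, ht1, r1⟩ := hcT z O
    have h2 : Ex (dec 0 1 2) (st [enc (F z, Raw.mk (true :: W z))])
        (st [true :: W z, (enc (F z)).reverse, [], [], [], [], [], []])
        (6 * (enc (F z, Raw.mk (true :: W z))).length + 9) := by
      rw [st8]
      simpa [unstr_encStr] using Ex.dec (l := [enc (F z, Raw.mk (true :: W z)), [], [], [], [], [], [], []])
        0 1 2 (by simp) (by simp) (by simp) (by simp) (by simp) (by simp) rfl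
    obtain ⟨t2, ht2, r2⟩ := h2 O
    obtain ⟨t3, ht3, r3⟩ := askLoop_runs O (enc (F z)) (true :: W z).length (true :: W z) 0 (by simp)
    set a := answers O (enc (F z)) ((W z).length + 1) with ha
    have e : answers O (enc (F z)) (0 + (true :: W z).length) = a := by simp [ha]
    rw [e] at r3
    have h4 : ∃ s, Ex (.cond 2 .skip (.push 0 true) .skip)
        (st [[], (enc (F z)).reverse, a, [], [], [], [], []]) s 2 ∧
        (Accepting s ↔ a.head? = some false) := by
      rcases a with _ | ⟨_ | _, a⟩
      · exact ⟨_, Ex.cond_nil rfl (Ex.skip _), by simp [Accepting, st]⟩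
      · exact ⟨_, Ex.cond_false rfl (Ex.push 0 true (by simp)), by simp [Accepting, st]⟩
      · exact ⟨_, Ex.cond_true rfl (Ex.skip _), by simp [Accepting, st]⟩
    obtain ⟨s, h4, hs4⟩ := h4
    obtain ⟨t4, ht4, r4⟩ := h4 O
    have r := r1.seq (r2.seq (r3.seq r4))
    rw [← start_eq_st] at r
    refine ⟨t1 + (t2 + (t3 + t4)), s, ?_, ?_, hs4.trans (h z).symm⟩
    · have e : 0 + (0 + ((true :: W z).length + 0)) = (W z).length + 1 := by simp
      rw [e] at r
      exact r
    · refine le_trans ?_ (hp z)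
      have e1 : sz (F z) = (enc (F z)).length := rfl
      have e2 : sz (Raw.mk (true :: W z)) = (true :: W z).length := rfl
      rw [enc_pair, List.length_append, length_encStr] at ht2
      beta_reduce
      rw [e1, e2]
      simp only [enc_raw] at ht2
      omega

theorem InDelta2.of_answers {F : CodeOf Q → β} {W : CodeOf Q → List Bool} (hF : PF F) (hW : PF W)
    {O : Language Bool} (hO : NP O) (h : ∀ z : CodeOf Q, Q.Yes z.1.1 ↔
      (answers O (enc (F z)) ((W z).length + 1)).head? = some false) : InDelta2 Q := by
  obtain ⟨c, p, hc, hr⟩ := exists_adaptive hF hW O h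
  refine ⟨O, c, p, hO, hc, fun I x hx => ?_⟩
  obtain ⟨t, s, r, ht, hs⟩ := hr ⟨(I, x), hx⟩
  exact ⟨t, _, s, r, ht, hs⟩

theorem InDelta2Log.of_answers {F : CodeOf Q → β} {W : CodeOf Q → List Bool} (hF : PF F) (hW : PF W)
    {O : Language Bool} (hO : NP O) (h : ∀ z : CodeOf Q, Q.Yes z.1.1 ↔
      (answers O (enc (F z)) ((W z).length + 1)).head? = some false) (C : ℕ)
    (hC : ∀ z : CodeOf Q, (W z).length + 1 ≤ C * (Nat.log 2 (enc z).length + 1)) : InDelta2Log Q := by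
  obtain ⟨c, p, hc, hr⟩ := exists_adaptive hF hW O h
  refine ⟨O, c, p, C, hO, hc, fun I x hx => ?_⟩
  obtain ⟨t, s, r, ht, hs⟩ := hr ⟨(I, x), hx⟩
  exact ⟨t, _, s, r, ht, hC ⟨(I, x), hx⟩, hs⟩

end
end Machine

namespace Machine
open Machine.Enc (enc)

/-! ## Injective codes and finite types -/

/-- Distinct elements have distinct codes. -/
class LawfulEnc (α : Type*) [Enc α] : Prop where
  inj : Function.Injective (enc : α → List Bool)

section
variable {α : Type*} {β : Type*} {γ : Type*} {κ : Type*} [Enc α] [Enc β] [Enc γ] [Enc κ]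

theorem encStr_append_inj {x x' y y' : List Bool} (h : encStr x ++ y = encStr x' ++ y') :
    x = x' ∧ y = y' := by
  have := congrArg unstr h
  rwa [unstr_encStr, unstr_encStr, Prod.mk.injEq] at this

instance : LawfulEnc Raw := ⟨fun ⟨_⟩ ⟨_⟩ h => congrArg _ h⟩
instance : LawfulEnc Bool := ⟨fun _ _ h => (List.cons.inj h).1⟩

/-- The value of a bit list, least significant bit first. -/
def bitsVal : List Bool → ℕ
  | [] => 0
  | b :: l => b.toNat + 2 * bitsVal l

theorem bitsVal_bits (n : ℕ) : bitsVal n.bits = n := by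
  induction n using Nat.binaryRecFromOne with
  | zero => simp [bitsVal]
  | one => simp [bitsVal]
  | bit b n hn ih =>
    rw [Nat.bits_append_bit n b fun h => absurd h hn, bitsVal, ih, Nat.bit_val]
    ring

instance : LawfulEnc ℕ := ⟨fun m n h => by
  have := congrArg bitsVal h
  rwa [enc_nat, enc_nat, bitsVal_bits, bitsVal_bits] at this⟩
instance [LawfulEnc α] [LawfulEnc β] : LawfulEnc (α × β) := ⟨fun p q h => by
  obtain ⟨h1, h2⟩ := encStr_append_inj h
  exact Prod.ext (LawfulEnc.inj h1) (LawfulEnc.inj h2)⟩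
instance {α : Type*} [Coded α] : LawfulEnc α := ⟨Coded.code_injective⟩

@[simp] theorem eqb_iff [LawfulEnc α] {a b : α} : eqb a b = true ↔ a = b := by
  simp only [eqb, decide_eq_true_eq]
  exact ⟨fun h => LawfulEnc.inj h, fun h => h ▸ rfl⟩

/-- A code for finite types. -/
@[reducible] noncomputable def finEnc (κ : Type*) [Fintype κ] : Enc κ :=
  ⟨fun k => List.replicate (Fintype.equivFin κ k) true⟩

theorem finEnc_lawful (κ : Type*) [Fintype κ] : @LawfulEnc κ (finEnc κ) :=
  @LawfulEnc.mk κ (finEnc κ) fun a b h => by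
    have : (List.replicate (Fintype.equivFin κ a : ℕ) true).length =
      (List.replicate (Fintype.equivFin κ b : ℕ) true).length := congrArg List.length h
    exact (Fintype.equivFin κ).injective (Fin.ext (by simpa using this))

/-- A finite case distinction is a chain of equality tests, built along an enumeration of `κ`. No
uniformity in `i` is required, since the programs for all cases become parts of one program. -/
theorem PF.finite_cases [Finite κ] [LawfulEnc κ] {k : α → κ} {F : κ → α → β} (hk : PF k)
    (hF : ∀ i, PF (F i)) : PF fun a => F (k a) a := by
  classical
  cases nonempty_fintype κ
  by_cases hκ : Nonempty κ
  · obtain ⟨k₀⟩ := hκ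
    have key : ∀ l : List κ, ∃ G : α → β, PF G ∧ ∀ a, k a ∈ l → G a = F (k a) a := by
      intro l
      induction l with
      | nil => exact ⟨F k₀, hF k₀, by simp⟩
      | cons i l ih =>
        obtain ⟨G, hG, h⟩ := ih
        refine ⟨fun a => if Machine.eqb (k a) i then F i a else G a, (hk.eqb (.const i)).ite (hF i) hG, ?_⟩
        intro a ha
        by_cases e : k a = i
        · simp [e]
        · have : Machine.eqb (k a) i = false := by rw [Bool.eq_false_iff, Ne, eqb_iff]; exact e
          simp only [this]
          exact h a (by simpa [e] using ha)
    obtain ⟨G, hG, h⟩ := key Finset.univ.toList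
    exact hG.cast (fun a => a) (fun _ => rfl) fun a => by rw [h a (by simp)]
  -- If `κ` is empty, then so is `α`.
  · exact ⟨.skip, plain_skip, fun _ => 0, .const _ 0, fun a => absurd ⟨k a⟩ hκ⟩

theorem PF.of_finite [Finite κ] [LawfulEnc κ] {k : α → κ} (hk : PF k) (F : κ → β) : PF fun a => F (k a) :=
  hk.finite_cases (F := fun i _ => F i) fun i => .const (F i)

/-! ## Binary arithmetic -/

theorem sz_prod (p : α × β) : sz p = 2 * sz p.1 + 1 + sz p.2 := sz_pair p.1 p.2

theorem sz_bits (l : List Bool) : sz l = 3 * l.length := by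
  induction l with
  | nil => simp
  | cons b l ih => simp [ih]; omega


@[simp] theorem bitsVal_nil : bitsVal [] = 0 := rfl
@[simp] theorem bitsVal_cons (b : Bool) (l : List Bool) : bitsVal (b :: l) = b.toNat + 2 * bitsVal l := rfl

theorem bitsVal_append (l m : List Bool) : bitsVal (l ++ m) = bitsVal l + 2 ^ l.length * bitsVal m := by
  induction l with
  | nil => simp
  | cons b l ih => simp [ih, pow_succ]; ring

theorem bitsVal_lt (l : List Bool) : bitsVal l < 2 ^ l.length := by
  induction l with
  | nil => simp
  | cons b l ih => cases b <;> simp [pow_succ] <;> omega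

theorem bitsVal_headD (l : List Bool) : bitsVal l = (l.headD false).toNat + 2 * bitsVal l.tail := by
  cases l <;> simp

/-- One step of a digitwise operation on bit lists; the state consists of the remaining digits, the
carry and the digits of the result, the last one first. -/
def rippleStep (F : Bool × Bool × Bool → Bool × Bool)
    (s : List Bool × List Bool × Bool × List Bool) : List Bool × List Bool × Bool × List Bool :=
  (s.1.tail, s.2.1.tail, (F (s.1.headD false, s.2.1.headD false, s.2.2.1)).1,
    (F (s.1.headD false, s.2.1.headD false, s.2.2.1)).2 :: s.2.2.2)

/-- Digitwise operation with a carry: the final carry and the digits. -/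
def ripple (F : Bool × Bool × Bool → Bool × Bool) (x y : List Bool) : Bool × List Bool :=
  let s := (x ++ y).foldl (fun s _ => rippleStep F s) (x, y, false, [])
  (s.2.2.1, s.2.2.2.reverse)

/-- `ripple` runs for `x.length + y.length` digits, padding with `false`. This is more than enough:
the dropped lists are then empty, and all the information is in the carry and the output. -/
theorem foldl_rippleStep (F : Bool × Bool × Bool → Bool × Bool) (l : List Bool) :
    ∀ s : List Bool × List Bool × Bool × List Bool,
    (l.foldl (fun s _ => rippleStep F s) s).1 = s.1.drop l.length ∧
    (l.foldl (fun s _ => rippleStep F s) s).2.1 = s.2.1.drop l.length ∧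
    (l.foldl (fun s _ => rippleStep F s) s).2.2.2.length = s.2.2.2.length + l.length := by
  induction l with
  | nil => simp
  | cons b l ih =>
    intro s
    obtain ⟨h1, h2, h3⟩ := ih (rippleStep F s)
    rw [List.foldl_cons]
    refine ⟨h1.trans ?_, h2.trans ?_, h3.trans ?_⟩
    · simp [rippleStep]
    · simp [rippleStep]
    · simp [rippleStep]; omega

theorem length_ripple (F : Bool × Bool × Bool → Bool × Bool) (x y : List Bool) :
    (ripple F x y).2.length = x.length + y.length := by
  simp [ripple, (foldl_rippleStep F _ _).2.2]

theorem PF.ripple (F : Bool × Bool × Bool → Bool × Bool) {x y : α → List Bool} (hx : PF x) (hy : PF y) :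
    PF fun a => ripple F (x a) (y a) := by
  have hF : PF fun s : α × (List Bool × List Bool × Bool × List Bool) × Bool => rippleStep F s.2.1 := by
    have h := PF.of_finite (k := fun s : α × (List Bool × List Bool × Bool × List Bool) × Bool =>
      (s.2.1.1.headD false, s.2.1.2.1.headD false, s.2.1.2.2.1)) (by fun_prop) F
    unfold rippleStep
    exact PF.mk (by fun_prop) (PF.mk (by fun_prop) (PF.mk h.fst (PF.cons h.snd (by fun_prop))))
  have h := PF.foldl (l := fun a => x a ++ y a) (g := fun a => (x a, y a, false, ([] : List Bool)))
    (h := fun _ s _ => rippleStep F s) (by fun_prop) (by fun_prop) hF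
    (B := fun a => 20 * (sz (x a) + sz (y a)) + 20)
    (((PB.const _ 20).mul (hx.pb_sz.add hy.pb_sz)).add (.const _ _)) fun a m hm => by
      obtain ⟨h1, h2, h3⟩ := foldl_rippleStep F m (x a, y a, false, [])
      have hl := hm.length_le
      rw [sz_prod, sz_prod, sz_prod, h1, h2, sz_bits, sz_bits, sz_bits, sz_bits, sz_bits, h3, sz_bool]
      simp only [List.length_drop, List.length_append, List.length_nil] at hl ⊢
      omega
  unfold Machine.ripple
  exact PF.mk (by fun_prop) (by fun_prop)

/-- Sum of two bit lists. -/
def addBits (x y : List Bool) : List Bool :=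
  let r := ripple (fun p => ((p.1 && p.2.1) || (p.1 && p.2.2) || (p.2.1 && p.2.2), p.1 ^^ p.2.1 ^^ p.2.2)) x y
  r.2 ++ [r.1]

/-- Difference of two bit lists, together with the final borrow. -/
def subBits (x y : List Bool) : Bool × List Bool :=
  ripple (fun p => ((!p.1 && p.2.1) || (!p.1 && p.2.2) || (p.2.1 && p.2.2), p.1 ^^ p.2.1 ^^ p.2.2)) x y

theorem length_addBits (x y : List Bool) : (addBits x y).length = x.length + y.length + 1 := by
  simp [addBits, length_ripple]

@[fun_prop] theorem PF.addBits {x y : α → List Bool} (hx : PF x) (hy : PF y) :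
    PF fun a => addBits (x a) (y a) := by
  have h := PF.ripple (fun p => ((p.1 && p.2.1) || (p.1 && p.2.2) || (p.2.1 && p.2.2), p.1 ^^ p.2.1 ^^ p.2.2)) hx hy
  exact h.snd.append (h.fst.cons (.const []))

@[fun_prop] theorem PF.subBits {x y : α → List Bool} (hx : PF x) (hy : PF y) :
    PF fun a => subBits (x a) (y a) := PF.ripple _ hx hy

/-- The invariant is: value of the digits produced, plus `2^(their number)` times the sum of the two
remainders and the carry. One step preserves it by the identity of the full adder, which is checked
on all eight inputs. -/
theorem bitsVal_addBits (x y : List Bool) : bitsVal (addBits x y) = bitsVal x + bitsVal y := by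
  let F : Bool × Bool × Bool → Bool × Bool := fun p =>
    ((p.1 && p.2.1) || (p.1 && p.2.2) || (p.2.1 && p.2.2), p.1 ^^ p.2.1 ^^ p.2.2)
  have key : ∀ (l : List Bool) (s : List Bool × List Bool × Bool × List Bool) (V : ℕ),
      bitsVal s.2.2.2.reverse + 2 ^ s.2.2.2.length * (bitsVal s.1 + bitsVal s.2.1 + s.2.2.1.toNat) = V →
      let s' := l.foldl (fun s _ => rippleStep F s) s
      bitsVal s'.2.2.2.reverse + 2 ^ s'.2.2.2.length * (bitsVal s'.1 + bitsVal s'.2.1 + s'.2.2.1.toNat) = V := by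
    intro l
    induction l with
    | nil => intro s V h; exact h
    | cons b l ih =>
      rintro ⟨x, y, c, o⟩ V h
      refine ih _ V ?_
      rw [← h]
      simp only [rippleStep, List.reverse_cons, bitsVal_append, List.length_reverse, List.length_cons,
        bitsVal_headD x, bitsVal_headD y, bitsVal_cons, bitsVal_nil, pow_succ]
      have : ∀ a b c : Bool, (F (a, b, c)).2.toNat + 2 * (F (a, b, c)).1.toNat = a.toNat + b.toNat + c.toNat := by
        decide
      have := this (x.headD false) (y.headD false) c
      rw [add_assoc]
      congr 1
      rw [show 2 ^ o.length * 2 * (bitsVal x.tail + bitsVal y.tail +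
        (F (x.headD false, y.headD false, c)).1.toNat) = 2 ^ o.length * (2 * bitsVal x.tail +
        2 * bitsVal y.tail + 2 * (F (x.headD false, y.headD false, c)).1.toNat) by ring, ← mul_add]
      congr 1
      omega
  have h := key (x ++ y) (x, y, false, []) _ rfl
  obtain ⟨h1, h2, h3⟩ := foldl_rippleStep F (x ++ y) (x, y, false, [])
  simp only [h1, h2] at h
  simp only [List.reverse_nil, bitsVal_nil, List.length_nil, pow_zero, one_mul, Bool.toNat_false,
    zero_add, add_zero] at h
  rw [← h, List.drop_of_length_le (by simp), List.drop_of_length_le (by simp)]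
  simp [addBits, ripple, bitsVal_append, F]

/-- The same invariant as for addition, now in `ℤ` with a borrow, ends in `x - y = digits - 2^length
· borrow`. As the digits have value below `2^length`, the borrow is the sign of the difference. -/
theorem subBits_spec (x y : List Bool) :
    ((subBits x y).1 = true ↔ bitsVal x < bitsVal y) ∧
    ((subBits x y).1 = false → bitsVal (subBits x y).2 = bitsVal x - bitsVal y) := by
  let F : Bool × Bool × Bool → Bool × Bool := fun p =>
    ((!p.1 && p.2.1) || (!p.1 && p.2.2) || (p.2.1 && p.2.2), p.1 ^^ p.2.1 ^^ p.2.2)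
  have key : ∀ (l : List Bool) (s : List Bool × List Bool × Bool × List Bool) (V : ℤ),
      (bitsVal s.2.2.2.reverse : ℤ) + 2 ^ s.2.2.2.length * (bitsVal s.1 - bitsVal s.2.1 - s.2.2.1.toNat) = V →
      let s' := l.foldl (fun s _ => rippleStep F s) s
      (bitsVal s'.2.2.2.reverse : ℤ) + 2 ^ s'.2.2.2.length * (bitsVal s'.1 - bitsVal s'.2.1 - s'.2.2.1.toNat) = V := by
    intro l
    induction l with
    | nil => intro s V h; exact h
    | cons b l ih =>
      rintro ⟨x, y, c, o⟩ V h
      refine ih _ V ?_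
      rw [← h]
      simp only [rippleStep, List.reverse_cons, bitsVal_append, List.length_reverse, List.length_cons,
        bitsVal_headD x, bitsVal_headD y, bitsVal_cons, bitsVal_nil, pow_succ]
      have : ∀ a b c : Bool, ((F (a, b, c)).2.toNat : ℤ) - 2 * (F (a, b, c)).1.toNat =
          a.toNat - b.toNat - c.toNat := by
        decide
      have := this (x.headD false) (y.headD false) c
      push_cast
      linear_combination (2 : ℤ) ^ o.length * this
  have h := key (x ++ y) (x, y, false, []) _ rfl
  obtain ⟨h1, h2, h3⟩ := foldl_rippleStep F (x ++ y) (x, y, false, [])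
  simp only [h1, h2] at h
  rw [List.drop_of_length_le (by simp), List.drop_of_length_le (by simp)] at h
  have hlt := bitsVal_lt (subBits x y).2
  have e1 : (subBits x y).1 = ((x ++ y).foldl (fun s _ => rippleStep F s) (x, y, false, [])).2.2.1 := rfl
  have e2 : (subBits x y).2 = ((x ++ y).foldl (fun s _ => rippleStep F s) (x, y, false, [])).2.2.2.reverse := rfl
  have e3 : (subBits x y).2.length = ((x ++ y).foldl (fun s _ => rippleStep F s) (x, y, false, [])).2.2.2.length := by
    rw [e2, List.length_reverse]
  rw [← e1, ← e2, ← e3] at h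
  simp at h
  have hlt' : (bitsVal (subBits x y).2 : ℤ) < 2 ^ (subBits x y).2.length := by exact_mod_cast hlt
  cases hb : (subBits x y).1
  · rw [hb] at h; simp at h; constructor
    · simp; omega
    · intro _; omega
  · rw [hb] at h; simp at h; constructor
    · simp; omega
    · simp

/-- Comparison of two bit lists. -/
def leBits (x y : List Bool) : Bool := !(subBits y x).1

@[fun_prop] theorem PF.leBits {x y : α → List Bool} (hx : PF x) (hy : PF y) :
    PF fun a => leBits (x a) (y a) := by unfold Machine.leBits; fun_prop

theorem leBits_iff {x y : List Bool} : leBits x y = true ↔ bitsVal x ≤ bitsVal y := by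
  have := (subBits_spec y x).1
  cases h : (subBits y x).1 <;> simp [leBits, h] at this ⊢ <;> omega

/-- Sum of a list of numbers. -/
def sumBits (l : List (List Bool)) : List Bool := l.foldl addBits []

/-- `addBits` returns more digits than necessary, but along the fold the lengths only add up, so
iterated sums remain of polynomial size. -/
theorem foldl_addBits (l : List (List Bool)) : ∀ s : List Bool,
    bitsVal (l.foldl addBits s) = bitsVal s + (l.map bitsVal).sum ∧
    (l.foldl addBits s).length = s.length + (l.map fun x => x.length + 1).sum := by
  induction l with
  | nil => simp
  | cons b l ih => intro s; simp [ih, bitsVal_addBits, length_addBits]; omega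

theorem bitsVal_sumBits (l : List (List Bool)) : bitsVal (sumBits l) = (l.map bitsVal).sum := by
  simp [sumBits, foldl_addBits]

@[fun_prop] theorem PF.sumBits {l : α → List (List Bool)} (hl : PF l) : PF fun a => sumBits (l a) :=
  hl.foldl (g := fun _ => ([] : List Bool)) (h := fun _ s b => Machine.addBits s b) (.const _)
    (by fun_prop) (B := fun a => 3 * sz (l a)) ((PB.const _ 3).mul hl.pb_sz) fun a m hm => by
      have h1 := (foldl_addBits m []).2
      have h2 := sz_sublist hm.sublist
      have h3 : ∀ m : List (List Bool), (m.map fun x => x.length + 1).sum ≤ sz m := by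
        intro m
        induction m with
        | nil => simp
        | cons b m ih => simp only [List.map_cons, List.sum_cons, sz_cons, sz_bits]; omega
      have := h3 m
      rw [sz_bits, h1, List.length_nil]
      omega

/-- Remove leading zeros (at the end of the list). -/
def trim (l : List Bool) : List Bool :=
  l.reverse.foldl (fun s b => if s.isEmpty && !b then [] else b :: s) []

theorem trim_cons (b : Bool) (l : List Bool) :
    trim (b :: l) = if (trim l).isEmpty && !b then [] else b :: trim l := by
  simp [trim]

theorem length_trim_le (l : List Bool) : (trim l).length ≤ l.length := by
  induction l with
  | nil => simp [trim]
  | cons b l ih => rw [trim_cons]; split_ifs <;> simp ; omega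

theorem bitsVal_trim (l : List Bool) : bitsVal (trim l) = bitsVal l := by
  induction l with
  | nil => rfl
  | cons b l ih =>
    rw [trim_cons, bitsVal_cons, ← ih]
    cases h : trim l <;> cases b <;> simp

/-- The top digit of a trimmed list is `1`. This turns a bound on the value into a logarithmic bound
on the number of digits, hence of oracle calls. -/
theorem pow_le_bitsVal_trim (l : List Bool) (h : trim l ≠ []) : 2 ^ ((trim l).length - 1) ≤ bitsVal (trim l) := by
  induction l with
  | nil => exact absurd rfl h
  | cons b l ih =>
    rw [trim_cons] at h ⊢
    cases e : trim l with
    | nil => cases b <;> simp_all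
    | cons c m =>
      rw [e] at ih
      have := ih (by simp)
      simp only [List.length_cons, List.isEmpty_cons, Bool.false_and, Bool.false_eq_true, if_false,
        bitsVal_cons (b := b), pow_succ, Nat.add_sub_cancel] at this ⊢
      omega

theorem PF.trim {l : α → List Bool} (hl : PF l) : PF fun a => trim (l a) :=
  hl.reverse.foldl (g := fun _ => ([] : List Bool))
    (h := fun _ s b => if s.isEmpty && !b then [] else b :: s) (.const _) (by fun_prop)
    hl.pb_sz fun a m hm => by
      have h1 : m.foldl (fun s b => if s.isEmpty && !b then [] else b :: s) [] = Machine.trim m.reverse := by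
        simp [Machine.trim]
      have h2 := length_trim_le m.reverse
      have h3 := hm.length_le
      rw [h1, sz_bits, sz_bits]
      simp at h2 h3
      omega

end
end Machine

namespace GXPath
open Machine
open Machine.Enc (enc)

/-! ## Graphs as lists -/

section
variable {Lab : Type u} {Val : Type v}

/-- The nodes with their data values, and the edges. -/
abbrev Lists (Lab : Type u) (Val : Type v) := List (ℕ × Val) × List (ℕ × Lab × ℕ)

/-- The lists describe a data-graph. -/
def Lists.Valid (p : Lists Lab Val) : Prop :=
  (p.1.map Prod.fst).Nodup ∧ p.2.Nodup ∧
    ∀ e ∈ p.2, e.1 ∈ p.1.map Prod.fst ∧ e.2.2 ∈ p.1.map Prod.fst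

/-- Data-graphs given by lists. -/
abbrev GLists (Lab : Type u) (Val : Type v) := {p : Lists Lab Val // p.Valid}

theorem exists_data {p : Lists Lab Val} {v : ℕ} (h : v ∈ (p.1.map Prod.fst).toFinset) :
    ∃ c, (v, c) ∈ p.1 := by
  simpa using h

open Classical in
/-- The data-graph given by lists. -/
noncomputable def GLists.graph (g : GLists Lab Val) : DataGraph Lab Val where
  V := (g.1.1.map Prod.fst).toFinset
  E := g.1.2.toFinset
  src_mem e he := List.mem_toFinset.2 (g.2.2.2 e (List.mem_toFinset.1 he)).1
  tgt_mem e he := List.mem_toFinset.2 (g.2.2.2 e (List.mem_toFinset.1 he)).2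
  D _ h := (exists_data h).choose

theorem GLists.mem_V {g : GLists Lab Val} {v : ℕ} : v ∈ g.graph.V ↔ ∃ c, (v, c) ∈ g.1.1 := by
  simp [GLists.graph]

theorem GLists.mem_E {g : GLists Lab Val} {e : ℕ × Lab × ℕ} : e ∈ g.graph.E ↔ e ∈ g.1.2 := by
  simp [GLists.graph]

theorem GLists.D_mem (g : GLists Lab Val) {v : ℕ} (h : v ∈ g.graph.V) : (v, g.graph.D v h) ∈ g.1.1 :=
  (exists_data (p := g.1) h).choose_spec

theorem data_unique {l : List (ℕ × Val)} (h : (l.map Prod.fst).Nodup) {v : ℕ} {c d : Val}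
    (hc : (v, c) ∈ l) (hd : (v, d) ∈ l) : c = d :=
  congrArg Prod.snd (List.inj_on_of_nodup_map h hc hd rfl)

theorem GLists.D_eq (g : GLists Lab Val) {v : ℕ} {c : Val} (hc : (v, c) ∈ g.1.1) (h : v ∈ g.graph.V) :
    g.graph.D v h = c := data_unique g.2.1 (g.D_mem h) hc

-- All relations live on the nodes. This matters because the list operations below search for pairs
-- only among the pairs of nodes.
mutual
theorem pathSem_sub (G : DataGraph Lab Val) : ∀ (α : PathExpr Lab Val) {p : ℕ × ℕ},
    p ∈ pathSem G α → p.1 ∈ G.V ∧ p.2 ∈ G.V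
  | .eps, p, h => by
    simp only [pathSem, Set.mem_ofPred_eq] at h
    exact ⟨h.1, h.2 ▸ h.1⟩
  | .wild, p, h => by
    simp only [pathSem, Set.mem_ofPred_eq] at h
    obtain ⟨a, h⟩ := h
    exact ⟨G.src_mem _ h, G.tgt_mem _ h⟩
  | .lab a, p, h => by
    simp only [pathSem, Set.mem_ofPred_eq] at h
    exact ⟨G.src_mem _ h, G.tgt_mem _ h⟩
  | .inv a, p, h => by
    simp only [pathSem, Set.mem_ofPred_eq] at h
    exact ⟨G.tgt_mem _ h, G.src_mem _ h⟩
  | .test φ, p, h => by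
    simp only [pathSem, Set.mem_ofPred_eq] at h
    have := nodeSem_sub G φ h.1
    exact ⟨this, h.2 ▸ this⟩
  | .comp α β, p, h => by
    simp only [pathSem, Set.mem_ofPred_eq] at h
    obtain ⟨z, h1, h2⟩ := h
    exact ⟨(pathSem_sub G α h1).1, (pathSem_sub G β h2).2⟩
  | .union α β, p, h => by
    simp only [pathSem] at h
    exact h.elim (fun h => pathSem_sub G α h) fun h => pathSem_sub G β h
  | .inter α β, p, h => by
    simp only [pathSem] at h
    exact pathSem_sub G α h.1
  | .star α, p, h => by
    simp only [pathSem, Set.mem_ofPred_eq] at h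
    refine ⟨h.1, ?_⟩
    rcases h.2.cases_tail with h' | ⟨z, -, h'⟩
    · rw [h']; exact h.1
    · exact (pathSem_sub G α h').2
  | .compl α, p, h => by
    simp only [pathSem, Set.mem_ofPred_eq] at h
    exact ⟨h.1, h.2.1⟩
  | .iter α n m, p, h => by
    simp only [pathSem, Set.mem_ofPred_eq] at h
    obtain ⟨k, -, -, h⟩ := h
    have key : ∀ k, ∀ p : ℕ × ℕ, p ∈ relPow G.V (pathSem G α) k → p.1 ∈ G.V ∧ p.2 ∈ G.V := by
      intro k
      induction k with
      | zero => rintro p ⟨h1, h2⟩; exact ⟨h1, h2 ▸ h1⟩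
      | succ k ih =>
        rintro p ⟨z, h1, h2⟩
        exact ⟨(pathSem_sub G α h1).1, (ih _ h2).2⟩
    exact key k p h

theorem nodeSem_sub (G : DataGraph Lab Val) : ∀ (φ : NodeExpr Lab Val) {u : ℕ},
    u ∈ nodeSem G φ → u ∈ G.V
  | .not φ, u, h => by simp only [nodeSem, Set.mem_ofPred_eq] at h; exact h.1
  | .and φ ψ, u, h => by simp only [nodeSem] at h; exact nodeSem_sub G φ h.1
  | .or φ ψ, u, h => by
    simp only [nodeSem] at h
    exact h.elim (fun h => nodeSem_sub G φ h) fun h => nodeSem_sub G ψ h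
  | .dataEq c, u, h => by simp only [nodeSem, Set.mem_ofPred_eq] at h; exact h.1
  | .dataNe c, u, h => by simp only [nodeSem, Set.mem_ofPred_eq] at h; exact h.1
  | .ex α, u, h => by
    simp only [nodeSem, Set.mem_ofPred_eq] at h
    obtain ⟨v, h⟩ := h
    exact (pathSem_sub G α h).1
  | .exEq α β, u, h => by
    simp only [nodeSem, Set.mem_ofPred_eq] at h
    obtain ⟨v, w, hv, hw, h, -⟩ := h
    exact (pathSem_sub G α h).1
  | .exNe α β, u, h => by
    simp only [nodeSem, Set.mem_ofPred_eq] at h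
    obtain ⟨v, w, hv, hw, h, -⟩ := h
    exact (pathSem_sub G α h).1
end

theorem relPow_add {V : Finset ℕ} {S : Set (ℕ × ℕ)} (hS : ∀ p ∈ S, p.1 ∈ V ∧ p.2 ∈ V) (i j : ℕ)
    (p : ℕ × ℕ) : p ∈ relPow V S (i + j) ↔ ∃ z, (p.1, z) ∈ relPow V S i ∧ (z, p.2) ∈ relPow V S j := by
  induction i generalizing p with
  | zero =>
    rw [zero_add]
    constructor
    · intro h
      refine ⟨p.1, ⟨?_, rfl⟩, h⟩
      cases j with
      | zero => exact h.1
      | succ j => obtain ⟨z, h1, -⟩ := h; exact (hS _ h1).1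
    · rintro ⟨z, ⟨-, h1⟩, h2⟩
      simp only at h1
      subst h1
      exact h2
  | succ i ih =>
    rw [Nat.succ_add]
    constructor
    · rintro ⟨y, h1, h2⟩
      obtain ⟨z, h3, h4⟩ := (ih _).1 h2
      exact ⟨z, ⟨y, h1, h3⟩, h4⟩
    · rintro ⟨z, ⟨y, h1, h2⟩, h3⟩
      exact ⟨y, h1, (ih _).2 ⟨z, h2, h3⟩⟩

theorem relPow_one {V : Finset ℕ} {S : Set (ℕ × ℕ)} (hS : ∀ p ∈ S, p.1 ∈ V ∧ p.2 ∈ V) :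
    relPow V S 1 = S := by
  ext p
  constructor
  · rintro ⟨z, h1, -, h2⟩
    simp only at h2
    subst h2
    exact h1
  · intro h
    exact ⟨p.2, h, (hS _ h).2, rfl⟩

/-- Once the identity is added, a step may be idle, so a single power replaces the union of all
powers up to `j`. That power can be obtained by repeated squaring although `j` may be exponential in
the input length. -/
theorem relPow_refl {V : Finset ℕ} {S : Set (ℕ × ℕ)} (j : ℕ)
    (p : ℕ × ℕ) : p ∈ relPow V ({p | p.1 ∈ V ∧ p.1 = p.2} ∪ S) j ↔ ∃ k ≤ j, p ∈ relPow V S k := by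
  induction j generalizing p with
  | zero => simp [relPow]
  | succ j ih =>
    constructor
    · rintro ⟨z, h1, h2⟩
      obtain ⟨k, hk, h3⟩ := (ih _).1 h2
      rcases h1 with ⟨-, h1⟩ | h1
      · simp only at h1
        subst h1
        exact ⟨k, by omega, h3⟩
      · exact ⟨k + 1, by omega, z, h1, h3⟩
    · rintro ⟨k, hk, h⟩
      cases k with
      | zero => exact ⟨p.1, .inl ⟨h.1, rfl⟩, (ih _).2 ⟨0, by omega, h⟩⟩
      | succ k =>
        obtain ⟨z, h1, h2⟩ := h
        exact ⟨z, .inr h1, (ih _).2 ⟨k, by omega, h2⟩⟩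

end

/-! ## Operations on relations -/

/-- Finite relations. -/
abbrev Rel := List (ℕ × ℕ)

section
variable {Lab : Type u} {Val : Type v} [Coded Lab] [Coded Val]

/-- All pairs of nodes. -/
def pairs (ns : List (ℕ × Val)) : Rel := ns.flatMap fun u => ns.map fun v => (u.1, v.1)

/-- Membership in a relation. -/
def memR (A : Rel) (p : ℕ × ℕ) : Bool := A.any fun q => eqb q p

/-- The operations filter `pairs ns` instead of building up lists, so no result, however deeply
nested, outgrows that list. This is the size bound for all folds over relations. -/
def idR (ns : List (ℕ × Val)) : Rel := (pairs ns).filter fun p => eqb p.1 p.2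
def wildR (g : Lists Lab Val) : Rel :=
  (pairs g.1).filter fun p => g.2.any fun e => eqb e.1 p.1 && eqb e.2.2 p.2
def labR (g : Lists Lab Val) (a : Raw) : Rel :=
  (pairs g.1).filter fun p => g.2.any fun e => eqb e.1 p.1 && eqb e.2.2 p.2 && eqb (toRaw e.2.1) a
def invR (g : Lists Lab Val) (a : Raw) : Rel :=
  (pairs g.1).filter fun p => g.2.any fun e => eqb e.1 p.2 && eqb e.2.2 p.1 && eqb (toRaw e.2.1) a
def compR (ns : List (ℕ × Val)) (A B : Rel) : Rel :=
  (pairs ns).filter fun p => ns.any fun z => memR A (p.1, z.1) && memR B (z.1, p.2)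
def unionR (ns : List (ℕ × Val)) (A B : Rel) : Rel := (pairs ns).filter fun p => memR A p || memR B p
def interR (ns : List (ℕ × Val)) (A B : Rel) : Rel := (pairs ns).filter fun p => memR A p && memR B p
def complR (ns : List (ℕ × Val)) (A : Rel) : Rel := (pairs ns).filter fun p => !memR A p
/-- Allow `z` as an intermediate node. -/
def stepR (ns : List (ℕ × Val)) (A : Rel) (z : ℕ × Val) : Rel :=
  (pairs ns).filter fun p => memR A p || (memR A (p.1, z.1) && memR A (z.1, p.2))
-- Warshall's algorithm: the nodes are admitted one by one as intermediate nodes of paths.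
def starR (ns : List (ℕ × Val)) (A : Rel) : Rel := ns.foldl (stepR ns) (unionR ns (idR ns) A)
/-- One step of repeated squaring; the state consists of the result so far and the current square. -/
def sqStep (ns : List (ℕ × Val)) (s : Rel × Rel) (b : Bool) : Rel × Rel :=
  (if b then compR ns s.1 s.2 else s.1, compR ns s.2 s.2)
/-- Powers with an exponent in binary. -/
def powR (ns : List (ℕ × Val)) (A : Rel) (n : List Bool) : Rel := (n.foldl (sqStep ns) (idR ns, unionR ns [] A)).1
-- A borrow in `m - n` means `m < n`, an empty union. Otherwise the relation is `A^n` followed by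
-- `(id ∪ A)^(m - n)`.
def iterR (ns : List (ℕ × Val)) (A : Rel) (n m : List Bool) : Rel :=
  if (subBits m n).1 then [] else
    compR ns (powR ns A n) (powR ns (unionR ns (idR ns) A) (subBits m n).2)
def dataR (ns : List (ℕ × Val)) (c : Raw) : Rel :=
  (pairs ns).filter fun p => eqb p.1 p.2 && ns.any fun z => eqb z.1 p.1 && eqb (toRaw z.2) c
def exR (ns : List (ℕ × Val)) (A : Rel) : Rel :=
  (pairs ns).filter fun p => eqb p.1 p.2 && A.any fun q => eqb q.1 p.1
def exEqR (ns : List (ℕ × Val)) (A B : Rel) : Rel :=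
  (pairs ns).filter fun p => eqb p.1 p.2 && ns.any fun z => ns.any fun z' =>
    memR A (p.1, z.1) && memR B (p.1, z'.1) && eqb z.2 z'.2
def exNeR (ns : List (ℕ × Val)) (A B : Rel) : Rel :=
  (pairs ns).filter fun p => eqb p.1 p.2 && ns.any fun z => ns.any fun z' =>
    memR A (p.1, z.1) && memR B (p.1, z'.1) && !eqb z.2 z'.2

section PF
variable {α : Type*} [Enc α] {ns : α → List (ℕ × Val)} {g : α → Lists Lab Val} {A B : α → Rel}

@[fun_prop] theorem PF.pairs (hn : PF ns) : PF fun a => pairs (ns a) := by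
  unfold GXPath.pairs; fun_prop
@[fun_prop] theorem PF.memR {p : α → ℕ × ℕ} (hA : PF A) (hp : PF p) : PF fun a => memR (A a) (p a) := by
  unfold GXPath.memR; fun_prop
@[fun_prop] theorem PF.idR (hn : PF ns) : PF fun a => idR (ns a) := by unfold GXPath.idR; fun_prop
@[fun_prop] theorem PF.wildR (hg : PF g) : PF fun a => wildR (g a) := by unfold GXPath.wildR; fun_prop
@[fun_prop] theorem PF.labR {c : α → Raw} (hg : PF g) (hc : PF c) : PF fun a => labR (g a) (c a) := by
  unfold GXPath.labR; fun_prop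
@[fun_prop] theorem PF.invR {c : α → Raw} (hg : PF g) (hc : PF c) : PF fun a => invR (g a) (c a) := by
  unfold GXPath.invR; fun_prop
@[fun_prop] theorem PF.compR (hn : PF ns) (hA : PF A) (hB : PF B) :
    PF fun a => compR (ns a) (A a) (B a) := by unfold GXPath.compR; fun_prop
@[fun_prop] theorem PF.unionR (hn : PF ns) (hA : PF A) (hB : PF B) :
    PF fun a => unionR (ns a) (A a) (B a) := by unfold GXPath.unionR; fun_prop
@[fun_prop] theorem PF.interR (hn : PF ns) (hA : PF A) (hB : PF B) :
    PF fun a => interR (ns a) (A a) (B a) := by unfold GXPath.interR; fun_prop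
@[fun_prop] theorem PF.complR (hn : PF ns) (hA : PF A) : PF fun a => complR (ns a) (A a) := by
  unfold GXPath.complR; fun_prop
@[fun_prop] theorem PF.stepR {z : α → ℕ × Val} (hn : PF ns) (hA : PF A) (hz : PF z) :
    PF fun a => stepR (ns a) (A a) (z a) := by unfold GXPath.stepR; fun_prop

theorem foldl_sub {σ τ : Type*} {P : σ → Prop} {f : σ → τ → σ} (hf : ∀ s t, P s → P (f s t)) (l : List τ) :
    ∀ s, P s → P (l.foldl f s) := by
  induction l with
  | nil => exact fun _ h => h
  | cons t l ih => exact fun s h => ih _ (hf s t h)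

@[fun_prop] theorem PF.starR (hn : PF ns) (hA : PF A) : PF fun a => starR (ns a) (A a) := by
  refine hn.foldl (g := fun a => GXPath.unionR (ns a) (GXPath.idR (ns a)) (A a))
    (h := fun a R z => GXPath.stepR (ns a) R z) (by fun_prop) (by fun_prop)
    (PF.pairs hn).pb_sz fun a m hm => ?_
  exact foldl_sub (P := fun R => sz R ≤ sz (GXPath.pairs (ns a))) (fun _ _ _ => sz_sublist List.filter_sublist) m _
    (sz_sublist List.filter_sublist)

-- The union with `[]` in `powR` prunes `A` to a sublist of the pairs of nodes, so that both
-- components of the state respect the size bound from the start.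
@[fun_prop] theorem PF.powR {n : α → List Bool} (hn : PF ns) (hA : PF A) (hm : PF n) :
    PF fun a => powR (ns a) (A a) (n a) := by
  have hs : PF fun x : α × (Rel × Rel) × Bool => sqStep (ns x.1) x.2.1 x.2.2 := by
    unfold sqStep; fun_prop
  have := hm.foldl (g := fun a => (GXPath.idR (ns a), GXPath.unionR (ns a) [] (A a)))
    (h := fun a s b => sqStep (ns a) s b) (by fun_prop) hs
    (B := fun a => 3 * sz (GXPath.pairs (ns a)) + 1) (((PB.const _ 3).mul (PF.pairs hn).pb_sz).add (.const _ 1))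
    fun a m hm => by
      have := foldl_sub (f := fun s b => sqStep (ns a) s b)
        (P := fun s : Rel × Rel => sz s.1 ≤ sz (GXPath.pairs (ns a)) ∧ sz s.2 ≤ sz (GXPath.pairs (ns a)))
        (fun s t hs => by
          refine ⟨?_, sz_sublist List.filter_sublist⟩
          simp only [sqStep]
          split_ifs
          · exact sz_sublist List.filter_sublist
          · exact hs.1) m (GXPath.idR (ns a), GXPath.unionR (ns a) [] (A a))
        ⟨sz_sublist List.filter_sublist, sz_sublist List.filter_sublist⟩
      rw [sz_prod]
      omega
  unfold GXPath.powR
  exact this.fst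

@[fun_prop] theorem PF.iterR {n m : α → List Bool} (hn : PF ns) (hA : PF A) (h1 : PF n) (h2 : PF m) :
    PF fun a => iterR (ns a) (A a) (n a) (m a) := by unfold GXPath.iterR; fun_prop
@[fun_prop] theorem PF.dataR {c : α → Raw} (hn : PF ns) (hc : PF c) : PF fun a => dataR (ns a) (c a) := by
  unfold GXPath.dataR; fun_prop
@[fun_prop] theorem PF.exR (hn : PF ns) (hA : PF A) : PF fun a => exR (ns a) (A a) := by
  unfold GXPath.exR; fun_prop
@[fun_prop] theorem PF.exEqR (hn : PF ns) (hA : PF A) (hB : PF B) :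
    PF fun a => exEqR (ns a) (A a) (B a) := by unfold GXPath.exEqR; fun_prop
@[fun_prop] theorem PF.exNeR (hn : PF ns) (hA : PF A) (hB : PF B) :
    PF fun a => exNeR (ns a) (A a) (B a) := by unfold GXPath.exNeR; fun_prop
end PF

end
end GXPath

namespace GXPath
open Machine
open Machine.Enc (enc)

section
variable {Lab : Type u} {Val : Type v} [Coded Lab] [Coded Val]

/-! ## Correctness of the operations -/

@[simp] theorem memR_iff {A : Rel} {p : ℕ × ℕ} : memR A p = true ↔ p ∈ A := by
  simp [memR]

theorem mem_pairs (g : GLists Lab Val) {p : ℕ × ℕ} :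
    p ∈ pairs g.1.1 ↔ p.1 ∈ g.graph.V ∧ p.2 ∈ g.graph.V := by
  obtain ⟨u, v⟩ := p
  simp only [pairs, List.mem_flatMap, List.mem_map, GLists.mem_V, Prod.mk.injEq]
  constructor
  · rintro ⟨⟨x, c⟩, hx, ⟨y, d⟩, hy, rfl, rfl⟩
    exact ⟨⟨c, hx⟩, d, hy⟩
  · rintro ⟨⟨c, hx⟩, d, hy⟩
    exact ⟨_, hx, _, hy, rfl, rfl⟩

theorem mem_filter_pairs (g : GLists Lab Val) {P : ℕ × ℕ → Bool} {S : Set (ℕ × ℕ)}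
    (hS : ∀ p ∈ S, p.1 ∈ g.graph.V ∧ p.2 ∈ g.graph.V)
    (h : ∀ p, p.1 ∈ g.graph.V → p.2 ∈ g.graph.V → (P p = true ↔ p ∈ S)) (p : ℕ × ℕ) :
    p ∈ (pairs g.1.1).filter P ↔ p ∈ S := by
  rw [List.mem_filter, mem_pairs]
  exact ⟨fun ⟨h1, h2⟩ => (h p h1.1 h1.2).1 h2, fun h' => ⟨hS p h', (h p (hS p h').1 (hS p h').2).2 h'⟩⟩

theorem toRaw_code {α : Type*} [Coded α] {a b : α} : toRaw a = ⟨Coded.code b⟩ ↔ a = b := by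
  rw [toRaw, Raw.mk.injEq]
  exact ⟨fun h => Coded.code_injective h, fun h => h ▸ rfl⟩

variable (g : GLists Lab Val) {A B : Rel} {S T : Set (ℕ × ℕ)}

/-- The relation holds between nodes only. -/
abbrev InV (g : GLists Lab Val) (S : Set (ℕ × ℕ)) : Prop := ∀ p ∈ S, p.1 ∈ g.graph.V ∧ p.2 ∈ g.graph.V

theorem any_iff {P : ℕ × Val → Bool} {Q : ℕ → Prop} (h : ∀ z, P z = true ↔ Q z.1) :
    g.1.1.any P = true ↔ ∃ z ∈ g.graph.V, Q z := by
  simp only [List.any_eq_true, h, GLists.mem_V]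
  exact ⟨fun ⟨z, h1, h2⟩ => ⟨z.1, ⟨z.2, h1⟩, h2⟩, fun ⟨z, ⟨c, h1⟩, h2⟩ => ⟨(z, c), h1, h2⟩⟩

theorem mem_idR (p : ℕ × ℕ) : p ∈ idR g.1.1 ↔ p ∈ {p : ℕ × ℕ | p.1 ∈ g.graph.V ∧ p.1 = p.2} :=
  mem_filter_pairs g (by rintro p ⟨h1, h2⟩; exact ⟨h1, h2 ▸ h1⟩) (fun p h _ => by simp [h]) p

theorem mem_wildR (p : ℕ × ℕ) : p ∈ wildR g.1 ↔ p ∈ pathSem g.graph .wild := by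
  refine mem_filter_pairs g (fun p h => pathSem_sub _ _ h) (fun p _ _ => ?_) p
  simp only [pathSem, List.any_eq_true, Set.mem_ofPred_eq, GLists.mem_E, Bool.and_eq_true, eqb_iff]
  exact ⟨fun ⟨e, he, h1, h2⟩ => ⟨e.2.1, by rw [← h1, ← h2]; exact he⟩, fun ⟨a, h⟩ => ⟨_, h, rfl, rfl⟩⟩

theorem mem_labR (a : Lab) (p : ℕ × ℕ) : p ∈ labR g.1 ⟨Coded.code a⟩ ↔ p ∈ pathSem g.graph (.lab a) := by
  refine mem_filter_pairs g (fun p h => pathSem_sub _ _ h) (fun p _ _ => ?_) p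
  simp only [pathSem, List.any_eq_true, Set.mem_ofPred_eq, GLists.mem_E, Bool.and_eq_true, eqb_iff, toRaw_code]
  exact ⟨fun ⟨e, he, ⟨h1, h2⟩, h3⟩ => by rw [← h1, ← h2, ← h3]; exact he, fun h => ⟨_, h, ⟨rfl, rfl⟩, rfl⟩⟩

theorem mem_invR (a : Lab) (p : ℕ × ℕ) : p ∈ invR g.1 ⟨Coded.code a⟩ ↔ p ∈ pathSem g.graph (.inv a) := by
  refine mem_filter_pairs g (fun p h => pathSem_sub _ _ h) (fun p _ _ => ?_) p
  simp only [pathSem, List.any_eq_true, Set.mem_ofPred_eq, GLists.mem_E, Bool.and_eq_true, eqb_iff, toRaw_code]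
  exact ⟨fun ⟨e, he, ⟨h1, h2⟩, h3⟩ => by rw [← h1, ← h2, ← h3]; exact he, fun h => ⟨_, h, ⟨rfl, rfl⟩, rfl⟩⟩

variable {g}

theorem mem_compR (hS : InV g S) (hT : InV g T) (hA : ∀ p, p ∈ A ↔ p ∈ S) (hB : ∀ p, p ∈ B ↔ p ∈ T)
    (p : ℕ × ℕ) : p ∈ compR g.1.1 A B ↔ p ∈ {p : ℕ × ℕ | ∃ z, (p.1, z) ∈ S ∧ (z, p.2) ∈ T} := by
  refine mem_filter_pairs g (by rintro p ⟨z, h1, h2⟩; exact ⟨(hS _ h1).1, (hT _ h2).2⟩) (fun p _ _ => ?_) p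
  rw [any_iff g (Q := fun z => (p.1, z) ∈ S ∧ (z, p.2) ∈ T) (by simp [hA, hB])]
  exact ⟨fun ⟨z, _, h⟩ => ⟨z, h⟩, fun ⟨z, h⟩ => ⟨z, (hS _ h.1).2, h⟩⟩

theorem mem_unionR (hS : InV g S) (hT : InV g T) (hA : ∀ p, p ∈ A ↔ p ∈ S) (hB : ∀ p, p ∈ B ↔ p ∈ T)
    (p : ℕ × ℕ) : p ∈ unionR g.1.1 A B ↔ p ∈ S ∪ T :=
  mem_filter_pairs g (fun p h => h.elim (hS p) (hT p)) (fun p _ _ => by simp [hA, hB]) p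

theorem mem_interR (hS : InV g S) (hA : ∀ p, p ∈ A ↔ p ∈ S) (hB : ∀ p, p ∈ B ↔ p ∈ T)
    (p : ℕ × ℕ) : p ∈ interR g.1.1 A B ↔ p ∈ S ∩ T :=
  mem_filter_pairs g (by rintro p ⟨h, -⟩; exact hS p h) (fun p _ _ => by simp [hA, hB]) p

theorem mem_complR (hA : ∀ p, p ∈ A ↔ p ∈ S) (p : ℕ × ℕ) :
    p ∈ complR g.1.1 A ↔ p ∈ {p : ℕ × ℕ | p.1 ∈ g.graph.V ∧ p.2 ∈ g.graph.V ∧ p ∉ S} :=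
  mem_filter_pairs g (by rintro p ⟨h1, h2, -⟩; exact ⟨h1, h2⟩)
    (fun p h h' => by simp only [Bool.not_eq_true', Bool.eq_false_iff, Ne, memR_iff, hA]; simp [h, h']) p

/-- The invariant: the current relation lies in the reflexive transitive closure and is closed under
joining two pairs at an admitted node `z ∈ Z`. In the end all nodes are admitted, so the relation is
transitive, and it contains `id ∪ S`. -/
theorem mem_starR (hS : InV g S) (hA : ∀ p, p ∈ A ↔ p ∈ S) (p : ℕ × ℕ) :
    p ∈ starR g.1.1 A ↔ p.1 ∈ g.graph.V ∧ Relation.ReflTransGen (fun u v => (u, v) ∈ S) p.1 p.2 := by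
  have h0 := mem_unionR (fun p h => ⟨h.1, h.2 ▸ h.1⟩) hS (mem_idR g) hA
  have hmem : ∀ (R : Rel) (z : ℕ × Val) (p : ℕ × ℕ), p ∈ stepR g.1.1 R z ↔
      (p.1 ∈ g.graph.V ∧ p.2 ∈ g.graph.V) ∧ (p ∈ R ∨ ((p.1, z.1) ∈ R ∧ (z.1, p.2) ∈ R)) := by
    intro R z p
    rw [stepR, List.mem_filter, mem_pairs]
    simp
  have key : ∀ (l : List (ℕ × Val)) (R : Rel) (Z : Set ℕ), (∀ q ∈ R, q.1 ∈ g.graph.V ∧ q.2 ∈ g.graph.V) →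
      (∀ q ∈ R, Relation.ReflTransGen (fun u v => (u, v) ∈ S) q.1 q.2) →
      (∀ u v, ∀ z ∈ Z, (u, z) ∈ R → (z, v) ∈ R → (u, v) ∈ R) →
      (∀ q ∈ R, q ∈ l.foldl (stepR g.1.1) R) ∧
      (∀ q ∈ l.foldl (stepR g.1.1) R, Relation.ReflTransGen (fun u v => (u, v) ∈ S) q.1 q.2) ∧
      (∀ q ∈ l.foldl (stepR g.1.1) R, q.1 ∈ g.graph.V ∧ q.2 ∈ g.graph.V) ∧
      (∀ u v z, (z ∈ Z ∨ ∃ c, (z, c) ∈ l) → (u, z) ∈ l.foldl (stepR g.1.1) R →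
        (z, v) ∈ l.foldl (stepR g.1.1) R → (u, v) ∈ l.foldl (stepR g.1.1) R) := by
    intro l
    induction l with
    | nil => intro R Z h1 h2 h3; exact ⟨fun _ h => h, h2, h1, fun u v z hz => h3 u v z (by simpa using hz)⟩
    | cons z l ih =>
      intro R Z h1 h2 h3
      obtain ⟨i1, i2, i3, i4⟩ := ih (stepR g.1.1 R z) (insert z.1 Z) (fun q hq => ((hmem _ _ _).1 hq).1)
        (fun q hq => ((hmem _ _ _).1 hq).2.elim (h2 q) fun h => (h2 _ h.1).trans (h2 _ h.2))
        (fun u v y hy hu hv => by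
          rw [hmem] at hu hv ⊢
          refine ⟨⟨hu.1.1, hv.1.2⟩, ?_⟩
          obtain ⟨-, hu⟩ := hu
          obtain ⟨-, hv⟩ := hv
          simp only at hu hv ⊢
          -- At the new node, either form of membership yields a pair of the old relation. At an old
          -- node `y`, closure of the old relation joins the parts; if both pairs already pass
          -- through the new node, the detour via `y` is dropped.
          rcases hy with rfl | hy
          · have hu' : (u, z.1) ∈ R := hu.elim id fun h => h.1
            have hv' : (z.1, v) ∈ R := hv.elim id fun h => h.2
            exact .inr ⟨hu', hv'⟩
          · rcases hu with hu | hu <;> rcases hv with hv | hv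
            · exact .inl (h3 u v y hy hu hv)
            · exact .inr ⟨h3 _ _ y hy hu hv.1, hv.2⟩
            · exact .inr ⟨hu.1, h3 _ _ y hy hu.2 hv⟩
            · exact .inr ⟨hu.1, hv.2⟩)
      refine ⟨fun q hq => i1 q ((hmem _ _ _).2 ⟨h1 q hq, .inl hq⟩), i2, i3, fun u v y hy => i4 u v y ?_⟩
      rcases hy with hy | ⟨c, hy⟩
      · exact .inl (.inr hy)
      · rcases List.mem_cons.1 hy with h | h
        · exact .inl (.inl (congrArg Prod.fst h))
        · exact .inr ⟨c, h⟩
  obtain ⟨k1, k2, k3, k4⟩ := key g.1.1 (unionR g.1.1 (idR g.1.1) A) ∅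
    (fun q hq => ((h0 q).1 hq).elim (fun h => ⟨h.1, h.2 ▸ h.1⟩) (hS q))
    (fun q hq => ((h0 q).1 hq).elim (fun h => by rw [h.2]) fun h => .single h) (by simp)
  constructor
  · exact fun h => ⟨(k3 p h).1, k2 p h⟩
  · obtain ⟨u, v⟩ := p
    rintro ⟨hp, h⟩
    simp only at hp h
    induction h with
    | refl => exact k1 _ ((h0 _).2 (.inl ⟨hp, rfl⟩))
    | tail _ h ih =>
      obtain ⟨c, hc⟩ := GLists.mem_V.1 (hS _ h).1
      exact k4 _ _ _ (.inr ⟨c, hc⟩) ih (k1 _ ((h0 _).2 (.inr h)))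

theorem relPow_inV (hS : InV g S) (k : ℕ) : InV g (relPow g.graph.V S k) := by
  induction k with
  | zero => exact fun p h => ⟨h.1, h.2 ▸ h.1⟩
  | succ k ih => exact fun p ⟨z, h1, h2⟩ => ⟨(hS _ h1).1, (ih _ h2).2⟩

theorem mem_powR (hS : InV g S) (hA : ∀ p, p ∈ A ↔ p ∈ S) (n : List Bool) (p : ℕ × ℕ) :
    p ∈ powR g.1.1 A n ↔ p ∈ relPow g.graph.V S (bitsVal n) := by
  have hadd : ∀ (R R' : Rel) (i j : ℕ), (∀ p, p ∈ R ↔ p ∈ relPow g.graph.V S i) →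
      (∀ p, p ∈ R' ↔ p ∈ relPow g.graph.V S j) → ∀ p, p ∈ compR g.1.1 R R' ↔ p ∈ relPow g.graph.V S (i + j) := by
    intro R R' i j h1 h2 p
    rw [mem_compR (relPow_inV hS i) (relPow_inV hS j) h1 h2, relPow_add hS, Set.mem_ofPred_eq]
  -- If the state holds the powers `i` and `j`, reading the digits `n`, lowest first, leads to the
  -- power `i + j · n`.
  have key : ∀ (n : List Bool) (s : Rel × Rel) (i j : ℕ), (∀ p, p ∈ s.1 ↔ p ∈ relPow g.graph.V S i) →
      (∀ p, p ∈ s.2 ↔ p ∈ relPow g.graph.V S j) →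
      ∀ p, p ∈ (n.foldl (sqStep g.1.1) s).1 ↔ p ∈ relPow g.graph.V S (i + j * bitsVal n) := by
    intro n
    induction n with
    | nil => intro s i j h1 _ p; simpa using h1 p
    | cons b n ih =>
      intro s i j h1 h2 p
      have h3 := hadd _ _ _ _ h2 h2
      cases b
      · rw [List.foldl_cons, ih _ i (j + j) (by simpa [sqStep] using h1) h3]
        simp only [bitsVal_cons, Bool.toNat_false, zero_add]
        rw [show i + (j + j) * bitsVal n = i + j * (2 * bitsVal n) by ring]
      · have h4 := hadd _ _ _ _ h1 h2
        rw [List.foldl_cons, ih _ (i + j) (j + j) (by simpa [sqStep] using h4) h3]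
        simp only [bitsVal_cons, Bool.toNat_true]
        rw [show i + j + (j + j) * bitsVal n = i + j * (1 + 2 * bitsVal n) by ring]
  have := key n (idR g.1.1, unionR g.1.1 [] A) 0 1 (mem_idR g) (fun p => by
    rw [relPow_one hS, mem_unionR (S := ∅) (by simp) hS (by simp) hA]; simp) p
  simpa [powR] using this

theorem mem_iterR (hS : InV g S) (hA : ∀ p, p ∈ A ↔ p ∈ S) (n m : ℕ) (p : ℕ × ℕ) :
    p ∈ iterR g.1.1 A n.bits m.bits ↔ ∃ k, n ≤ k ∧ k ≤ m ∧ p ∈ relPow g.graph.V S k := by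
  obtain ⟨h1, h2⟩ := subBits_spec m.bits n.bits
  simp only [bitsVal_bits] at h1 h2
  rw [iterR]
  split_ifs with hb
  · rw [h1] at hb
    simp only [List.not_mem_nil, false_iff]
    rintro ⟨k, hk, hk', -⟩
    omega
  · rw [Bool.not_eq_true] at hb
    have hnm : n ≤ m := by
      rw [hb] at h1; simp at h1; exact h1
    have hU : InV g ({p | p.1 ∈ g.graph.V ∧ p.1 = p.2} ∪ S) := fun p h =>
      h.elim (fun h => ⟨h.1, h.2 ▸ h.1⟩) (hS p)
    rw [mem_compR (relPow_inV hS _) (relPow_inV hU _) (mem_powR hS hA _)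
      (mem_powR hU (mem_unionR (fun p h => ⟨h.1, h.2 ▸ h.1⟩) hS (mem_idR g) hA) _), h2 hb, bitsVal_bits]
    simp only [Set.mem_ofPred_eq, relPow_refl]
    constructor
    · rintro ⟨z, h3, k, hk, h4⟩
      exact ⟨n + k, by omega, by omega, (relPow_add hS _ _ _).2 ⟨z, h3, h4⟩⟩
    · rintro ⟨k, hk, hk', h⟩
      obtain ⟨j, rfl⟩ := Nat.exists_eq_add_of_le hk
      obtain ⟨z, h3, h4⟩ := (relPow_add hS _ _ _).1 h
      exact ⟨z, h3, j, by omega, h4⟩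

variable (g) in
theorem mem_dataR (c : Val) (p : ℕ × ℕ) : p ∈ dataR g.1.1 ⟨Coded.code c⟩ ↔
    p ∈ {p : ℕ × ℕ | p.1 = p.2 ∧ p.1 ∈ nodeSem g.graph (.dataEq c)} := by
  refine mem_filter_pairs g (by rintro p ⟨h1, h2⟩; exact ⟨nodeSem_sub _ _ h2, h1 ▸ nodeSem_sub _ _ h2⟩) (fun p hp _ => ?_) p
  simp only [nodeSem, List.any_eq_true, Set.mem_ofPred_eq, Bool.and_eq_true, eqb_iff, toRaw_code]
  refine and_congr_right fun _ => ?_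
  constructor
  · rintro ⟨z, hz, h1, h2⟩
    exact ⟨hp, g.D_eq (by rw [← h1, ← h2]; exact hz) hp⟩
  · rintro ⟨h, h1⟩
    exact ⟨_, h1 ▸ g.D_mem h, rfl, rfl⟩

theorem mem_exR (hS : InV g S) (hA : ∀ p, p ∈ A ↔ p ∈ S) (p : ℕ × ℕ) : p ∈ exR g.1.1 A ↔
    p ∈ {p : ℕ × ℕ | p.1 = p.2 ∧ ∃ v, (p.1, v) ∈ S} := by
  refine mem_filter_pairs g (by rintro p ⟨h1, v, h2⟩; exact ⟨(hS _ h2).1, h1 ▸ (hS _ h2).1⟩) (fun p hp _ => ?_) p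
  simp only [List.any_eq_true, Set.mem_ofPred_eq, Bool.and_eq_true, eqb_iff, hA]
  refine and_congr_right fun _ => ?_
  exact ⟨fun ⟨q, h1, h2⟩ => ⟨q.2, by rw [← h2]; exact h1⟩, fun ⟨v, h⟩ => ⟨_, h, rfl⟩⟩

theorem mem_exEqR (hS : InV g S) (hA : ∀ p, p ∈ A ↔ p ∈ S) (hB : ∀ p, p ∈ B ↔ p ∈ T)
    (p : ℕ × ℕ) : p ∈ exEqR g.1.1 A B ↔ p ∈ {p : ℕ × ℕ | p.1 = p.2 ∧ ∃ (v w : ℕ) (hv : v ∈ g.graph.V)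
      (hw : w ∈ g.graph.V), (p.1, v) ∈ S ∧ (p.1, w) ∈ T ∧ g.graph.D v hv = g.graph.D w hw} := by
  refine mem_filter_pairs g (by rintro p ⟨h1, v, w, _, _, h2, _⟩; exact ⟨(hS _ h2).1, h1 ▸ (hS _ h2).1⟩) (fun p hp _ => ?_) p
  simp only [List.any_eq_true, Set.mem_ofPred_eq, Bool.and_eq_true, eqb_iff, memR_iff, hA, hB]
  refine and_congr_right fun _ => ?_
  constructor
  · rintro ⟨⟨v, c⟩, hv, ⟨w, d⟩, hw, ⟨h1, h2⟩, h3⟩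
    have hv' := GLists.mem_V.2 ⟨_, hv⟩
    have hw' := GLists.mem_V.2 ⟨_, hw⟩
    exact ⟨v, w, hv', hw', h1, h2, by rw [g.D_eq hv, g.D_eq hw]; exact h3⟩
  · rintro ⟨v, w, hv, hw, h1, h2, h3⟩
    exact ⟨_, g.D_mem hv, _, g.D_mem hw, ⟨h1, h2⟩, h3⟩

theorem mem_exNeR (hS : InV g S) (hA : ∀ p, p ∈ A ↔ p ∈ S) (hB : ∀ p, p ∈ B ↔ p ∈ T)
    (p : ℕ × ℕ) : p ∈ exNeR g.1.1 A B ↔ p ∈ {p : ℕ × ℕ | p.1 = p.2 ∧ ∃ (v w : ℕ) (hv : v ∈ g.graph.V)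
      (hw : w ∈ g.graph.V), (p.1, v) ∈ S ∧ (p.1, w) ∈ T ∧ g.graph.D v hv ≠ g.graph.D w hw} := by
  refine mem_filter_pairs g (by rintro p ⟨h1, v, w, _, _, h2, _⟩; exact ⟨(hS _ h2).1, h1 ▸ (hS _ h2).1⟩) (fun p hp _ => ?_) p
  simp only [List.any_eq_true, Set.mem_ofPred_eq, Bool.and_eq_true, eqb_iff, memR_iff, hA, hB,
    Bool.not_eq_true', Bool.eq_false_iff, Ne]
  refine and_congr_right fun _ => ?_
  constructor
  · rintro ⟨⟨v, c⟩, hv, ⟨w, d⟩, hw, ⟨h1, h2⟩, h3⟩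
    have hv' := GLists.mem_V.2 ⟨_, hv⟩
    have hw' := GLists.mem_V.2 ⟨_, hw⟩
    exact ⟨v, w, hv', hw', h1, h2, by rw [g.D_eq hv, g.D_eq hw]; exact h3⟩
  · rintro ⟨v, w, hv, hw, h1, h2, h3⟩
    exact ⟨_, g.D_mem hv, _, g.D_mem hw, ⟨h1, h2⟩, h3⟩

end

/-! ## Expressions as token lists -/

/-- Operators of expressions in Polish form. -/
inductive Op
  | eps | wild | lab | inv | comp | union | inter | star | compl | iter | dataEq | ex | exEq | exNe | num
  deriving DecidableEq

instance : Fintype Op :=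
  ⟨{.eps, .wild, .lab, .inv, .comp, .union, .inter, .star, .compl, .iter, .dataEq, .ex, .exEq, .exNe, .num},
    fun o => by cases o <;> decide⟩

noncomputable instance : Enc Op := finEnc Op
instance : LawfulEnc Op := finEnc_lawful Op

/-- An operator with its argument. -/
abbrev Tok := Op × Raw

/-- An operator without argument. -/
def Op.tok (o : Op) : Tok := (o, ⟨[]⟩)

/-- A stack of values. -/
abbrev Stack := List (Rel × Raw)

section
variable {Lab : Type u} {Val : Type v} [Coded Lab] [Coded Val]

mutual
/-- The tokens of a path expression. -/
def pathToks : PathExpr Lab Val → List Tok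
  | .eps => [Op.eps.tok]
  | .wild => [Op.wild.tok]
  | .lab a => [(.lab, ⟨Coded.code a⟩)]
  | .inv a => [(.inv, ⟨Coded.code a⟩)]
  | .test φ => nodeToks φ
  | .comp α β => Op.comp.tok :: (pathToks α ++ pathToks β)
  | .union α β => Op.union.tok :: (pathToks α ++ pathToks β)
  | .inter α β => Op.inter.tok :: (pathToks α ++ pathToks β)
  | .star α => Op.star.tok :: pathToks α
  | .compl α => Op.compl.tok :: pathToks α
  | .iter α n m => Op.iter.tok :: (pathToks α ++ [(.num, ⟨n.bits⟩), (.num, ⟨m.bits⟩)])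

/-- The tokens of a node expression; its value is a subset of the diagonal. -/
def nodeToks : NodeExpr Lab Val → List Tok
  | .not φ => Op.inter.tok :: Op.eps.tok :: Op.compl.tok :: nodeToks φ
  | .and φ ψ => Op.inter.tok :: (nodeToks φ ++ nodeToks ψ)
  | .or φ ψ => Op.union.tok :: (nodeToks φ ++ nodeToks ψ)
  | .dataEq c => [(.dataEq, ⟨Coded.code c⟩)]
  | .dataNe c => [Op.inter.tok, Op.eps.tok, Op.compl.tok, (.dataEq, ⟨Coded.code c⟩)]
  | .ex α => Op.ex.tok :: pathToks α
  | .exEq α β => Op.exEq.tok :: (pathToks α ++ pathToks β)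
  | .exNe α β => Op.exNe.tok :: (pathToks α ++ pathToks β)
end

/-- The `i`-th entry of a stack. -/
def Stack.get (s : Stack) : ℕ → Rel × Raw
  | 0 => s.headD ([], ⟨[]⟩)
  | i + 1 => Stack.get s.tail i

/-- Remove `n` entries. -/
def Stack.pop (s : Stack) : ℕ → Stack
  | 0 => s
  | n + 1 => Stack.pop s.tail n

/-- The number of arguments on the stack. -/
def Op.arity : Op → ℕ
  | .eps | .wild | .lab | .inv | .dataEq | .num => 0
  | .star | .compl | .ex => 1
  | .comp | .union | .inter | .exEq | .exNe => 2
  | .iter => 3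

/-- Apply an operator. -/
def Op.apply (g : Lists Lab Val) (r : Raw) (s : Stack) : Op → Rel
  | .eps => idR g.1
  | .wild => wildR g
  | .lab => labR g r
  | .inv => invR g r
  | .comp => compR g.1 (s.get 0).1 (s.get 1).1
  | .union => unionR g.1 (s.get 0).1 (s.get 1).1
  | .inter => interR g.1 (s.get 0).1 (s.get 1).1
  | .star => starR g.1 (s.get 0).1
  | .compl => complR g.1 (s.get 0).1
  | .iter => iterR g.1 (s.get 0).1 (s.get 1).2.bits (s.get 2).2.bits
  | .dataEq => dataR g.1 r
  | .ex => exR g.1 (s.get 0).1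
  | .exEq => exEqR g.1 (s.get 0).1 (s.get 1).1
  | .exNe => exNeR g.1 (s.get 0).1 (s.get 1).1
  | .num => []

/-- Evaluate a token. -/
def evalTok (g : Lists Lab Val) (s : Stack) (t : Tok) : Stack :=
  (t.1.apply g t.2 s, t.2) :: s.pop t.1.arity

/-- Evaluate a reversed token list. -/
def evalToks (g : Lists Lab Val) (ts : List Tok) : Rel := ((ts.foldl (evalTok g) []).headD ([], ⟨[]⟩)).1

section PF
variable {α : Type*} [Enc α]

@[fun_prop] theorem PF.get {s : α → Stack} (hs : PF s) (i : ℕ) : PF fun a => (s a).get i := by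
  induction i generalizing s with
  | zero => exact hs.headD (.const _)
  | succ i ih => exact ih hs.tail

@[fun_prop] theorem PF.pop {s : α → Stack} (hs : PF s) (i : ℕ) : PF fun a => (s a).pop i := by
  induction i generalizing s with
  | zero => exact hs
  | succ i ih => exact ih hs.tail

@[fun_prop] theorem PF.evalTok {g : α → Lists Lab Val} {s : α → Stack} {t : α → Tok} (hg : PF g) (hs : PF s)
    (ht : PF t) : PF fun a => evalTok (g a) (s a) (t a) := by
  unfold GXPath.evalTok
  refine PF.cons (PF.mk ?_ (by fun_prop)) ?_
  · refine PF.finite_cases (k := fun a => (t a).1) (F := fun o a => o.apply (g a) (t a).2 (s a)) ht.fst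
      fun o => ?_
    cases o <;> simp only [Op.apply] <;> fun_prop
  · exact PF.finite_cases (k := fun a => (t a).1) (F := fun o a => (s a).pop o.arity) ht.fst
      fun o => PF.pop hs _

theorem Stack.pop_suffix (s : Stack) (i : ℕ) : s.pop i <:+ s := by
  induction i generalizing s with
  | zero => exact List.suffix_rfl
  | succ i ih => exact (ih s.tail).trans (List.tail_suffix s)

theorem apply_le (g : Lists Lab Val) (r : Raw) (s : Stack) (o : Op) : sz (o.apply g r s) ≤ sz (pairs g.1) := by
  cases o <;> simp only [Op.apply, sz_nil, zero_le] <;>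
    first
    | exact sz_sublist List.filter_sublist
    | skip
  · exact foldl_sub (P := fun R => sz R ≤ sz (GXPath.pairs g.1))
      (fun _ _ _ => sz_sublist List.filter_sublist) g.1 _ (sz_sublist List.filter_sublist)
  · rw [iterR]
    split_ifs
    · simp
    · exact sz_sublist List.filter_sublist

-- The stack has at most one entry per token, and each entry consists of a sublist of the pairs of
-- nodes, up to code size, and of a string copied from a token.
@[fun_prop] theorem PF.evalToks {g : α → Lists Lab Val} {ts : α → List Tok} (hg : PF g) (ht : PF ts) :
    PF fun a => evalToks (g a) (ts a) := by
  have h := ht.foldl (g := fun _ => ([] : Stack)) (h := fun a s t => GXPath.evalTok (g a) s t) (.const _)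
    (by fun_prop) (B := fun a => sz (ts a) * (2 * (2 * sz (GXPath.pairs (g a).1) + 1 + sz (ts a)) + 1))
    (ht.pb_sz.mul (((PB.const _ 2).mul ((((PB.const _ 2).mul (PF.pairs hg.fst).pb_sz).add (.const _ 1)).add
      ht.pb_sz)).add (.const _ 1))) fun a m hm => by
      have key : ∀ (l : List Tok) (s : Stack), (∀ t ∈ l, t ∈ ts a) →
          (∀ e ∈ s, sz e ≤ 2 * sz (GXPath.pairs (g a).1) + 1 + sz (ts a)) →
          (∀ e ∈ l.foldl (GXPath.evalTok (g a)) s, sz e ≤ 2 * sz (GXPath.pairs (g a).1) + 1 + sz (ts a)) ∧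
          (l.foldl (GXPath.evalTok (g a)) s).length ≤ s.length + l.length := by
        intro l
        induction l with
        | nil => intro s _ hs; exact ⟨hs, le_rfl⟩
        | cons t l ih =>
          intro s hl hs
          obtain ⟨h1, h2⟩ := ih (GXPath.evalTok (g a) s t) (fun t ht => hl t (by simp [ht])) (fun e he => by
            rcases List.mem_cons.1 he with rfl | he
            · have h1 := apply_le (g a) t.2 s t.1
              have h2 := sz_le_of_mem (hl t (by simp))
              rw [sz_prod] at h2 ⊢
              simp only
              omega
            · exact hs e ((Stack.pop_suffix _ _).subset he))
          refine ⟨h1, h2.trans ?_⟩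
          have := (Stack.pop_suffix s t.1.arity).length_le
          simp only [GXPath.evalTok, List.length_cons]
          omega
      obtain ⟨h1, h2⟩ := key m [] (fun t ht => hm.subset ht) (by simp)
      refine (sz_le_mul h1).trans (Nat.mul_le_mul_right _ ?_)
      have := hm.length_le
      have := length_le_sz (ts a)
      simp at h2
      omega
  exact (PF.headD h (.const _)).fst

end PF

section
variable (g : GLists Lab Val)

/-- The tokens evaluate to the relation `S`. -/
def Evals (ts : List Tok) (S : Set (ℕ × ℕ)) : Prop :=
  ∀ s : Stack, ∃ A r, ts.foldr (fun t s => evalTok g.1 s t) s = (A, r) :: s ∧ ∀ p, p ∈ A ↔ p ∈ S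

variable {g} {ts ts' : List Tok} {S T U : Set (ℕ × ℕ)}

theorem Evals.leaf {o : Op} {r : Raw} (ho : o.arity = 0) (h : ∀ s p, p ∈ o.apply g.1 r s ↔ p ∈ S) :
    Evals g [(o, r)] S := fun s =>
  ⟨_, r, by simp only [List.foldr_cons, List.foldr_nil, evalTok, ho]; rfl, h s⟩

theorem Evals.unary {o : Op} (ho : o.arity = 1) (h1 : Evals g ts S)
    (h : ∀ A r s, (∀ p, p ∈ A ↔ p ∈ S) → ∀ p, p ∈ o.apply g.1 ⟨[]⟩ ((A, r) :: s) ↔ p ∈ U) :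
    Evals g (o.tok :: ts) U := fun s => by
  obtain ⟨A, r, e, hA⟩ := h1 s
  refine ⟨_, ⟨[]⟩, ?_, h A r s hA⟩
  simp only [List.foldr_cons, e]
  simp only [evalTok, Op.tok, ho]
  rfl

theorem Evals.binary {o : Op} (ho : o.arity = 2) (h1 : Evals g ts S) (h2 : Evals g ts' T)
    (h : ∀ A B r r' s, (∀ p, p ∈ A ↔ p ∈ S) → (∀ p, p ∈ B ↔ p ∈ T) →
      ∀ p, p ∈ o.apply g.1 ⟨[]⟩ ((A, r) :: (B, r') :: s) ↔ p ∈ U) :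
    Evals g (o.tok :: (ts ++ ts')) U := fun s => by
  obtain ⟨B, r', e', hB⟩ := h2 s
  obtain ⟨A, r, e, hA⟩ := h1 ((B, r') :: s)
  refine ⟨_, ⟨[]⟩, ?_, h A B r r' s hA hB⟩
  simp only [List.foldr_cons, List.foldr_append, e', e]
  simp only [evalTok, Op.tok, ho]
  rfl

theorem Evals.congr (h : Evals g ts S) (hS : ∀ p, p ∈ S ↔ p ∈ T) : Evals g ts T := fun s => by
  obtain ⟨A, r, e, hA⟩ := h s
  exact ⟨A, r, e, fun p => (hA p).trans (hS p)⟩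

theorem Evals.eps : Evals g [Op.eps.tok] {p | p.1 ∈ g.graph.V ∧ p.1 = p.2} :=
  .leaf rfl fun _ p => mem_idR g p

theorem Evals.compl (h : Evals g ts S) :
    Evals g (Op.compl.tok :: ts) {p | p.1 ∈ g.graph.V ∧ p.2 ∈ g.graph.V ∧ p ∉ S} :=
  h.unary rfl fun _ _ _ hA p => mem_complR hA p

theorem Evals.union (h : Evals g ts S) (h' : Evals g ts' T) (hS : InV g S) (hT : InV g T) :
    Evals g (Op.union.tok :: (ts ++ ts')) (S ∪ T) :=
  h.binary rfl h' fun _ _ _ _ _ hA hB p => mem_unionR hS hT hA hB p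

theorem Evals.inter (h : Evals g ts S) (h' : Evals g ts' T) (hS : InV g S) :
    Evals g (Op.inter.tok :: (ts ++ ts')) (S ∩ T) :=
  h.binary rfl h' fun _ _ _ _ _ hA hB p => mem_interR hS hA hB p

/-- The diagonal of a set of nodes. -/
def diag (N : Set ℕ) : Set (ℕ × ℕ) := {p | p.1 = p.2 ∧ p.1 ∈ N}

/-- Complementing the diagonal of `N` among all pairs and cutting back to the diagonal complements
`N`. -/
theorem Evals.not {N : Set ℕ} (h : Evals g ts (diag N)) :
    Evals g (Op.inter.tok :: Op.eps.tok :: Op.compl.tok :: ts) (diag {u | u ∈ g.graph.V ∧ u ∉ N}) := by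
  refine (Evals.eps.inter h.compl fun p h => ⟨h.1, h.2 ▸ h.1⟩).congr fun ⟨a, b⟩ => ?_
  simp only [diag, Set.mem_inter_iff, Set.mem_ofPred_eq]
  constructor
  · rintro ⟨⟨h1, h2⟩, -, -, h3⟩; exact ⟨h2, h1, fun h => h3 ⟨h2, h⟩⟩
  · rintro ⟨h1, h2, h3⟩; exact ⟨⟨h2, h1⟩, h2, h1 ▸ h2, fun h => h3 h.2⟩

theorem diag_inV (φ : NodeExpr Lab Val) : InV g (diag (nodeSem g.graph φ)) := fun p h =>
  ⟨nodeSem_sub _ _ h.2, by have := nodeSem_sub _ _ h.2; rwa [h.1] at this⟩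

mutual
theorem evals_path (g : GLists Lab Val) : ∀ α : PathExpr Lab Val, Evals g (pathToks α) (pathSem g.graph α)
  | .eps => by rw [pathToks, pathSem]; exact .eps
  | .wild => by rw [pathToks]; exact .leaf rfl fun _ p => mem_wildR g p
  | .lab a => by rw [pathToks]; exact .leaf rfl fun _ p => mem_labR g a p
  | .inv a => by rw [pathToks]; exact .leaf rfl fun _ p => mem_invR g a p
  | .test φ => by
    rw [pathToks, pathSem]
    exact (evals_node g φ).congr fun p => and_comm
  | .comp α β => by
    rw [pathToks, pathSem]
    exact (evals_path g α).binary rfl (evals_path g β) fun _ _ _ _ _ hA hB p =>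
      mem_compR (fun _ h => pathSem_sub _ _ h) (fun _ h => pathSem_sub _ _ h) hA hB p
  | .union α β => by
    rw [pathToks, pathSem]
    exact (evals_path g α).union (evals_path g β) (fun _ h => pathSem_sub _ _ h) fun _ h => pathSem_sub _ _ h
  | .inter α β => by
    rw [pathToks, pathSem]
    exact (evals_path g α).inter (evals_path g β) (fun _ h => pathSem_sub _ _ h)
  | .star α => by
    rw [pathToks, pathSem]
    exact (evals_path g α).unary rfl fun _ _ _ hA p => mem_starR (fun _ h => pathSem_sub _ _ h) hA p
  | .compl α => by
    rw [pathToks, pathSem]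
    exact (evals_path g α).compl
  | .iter α n m => by
    rw [pathToks, pathSem]
    intro s
    -- Tokens are evaluated from the right, so the two counters are on the stack before `α`; they
    -- sit in the string components of their entries.
    obtain ⟨A, r, e, hA⟩ := evals_path g α (([], ⟨n.bits⟩) :: ([], ⟨m.bits⟩) :: s)
    refine ⟨_, ⟨[]⟩, ?_, mem_iterR (fun _ h => pathSem_sub _ _ h) hA n m⟩
    simp only [List.foldr_cons, List.foldr_append, List.foldr_nil]
    have h1 : evalTok g.1 (evalTok g.1 s (.num, ⟨m.bits⟩)) (.num, ⟨n.bits⟩) =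
      ([], ⟨n.bits⟩) :: ([], ⟨m.bits⟩) :: s := rfl
    rw [h1, e]
    rfl

theorem evals_node (g : GLists Lab Val) : ∀ φ : NodeExpr Lab Val, Evals g (nodeToks φ) (diag (nodeSem g.graph φ))
  | .not φ => by
    rw [nodeToks, nodeSem]
    exact (evals_node g φ).not
  | .and φ ψ => by
    rw [nodeToks, nodeSem]
    refine ((evals_node g φ).inter (evals_node g ψ) (diag_inV φ)).congr fun p => ?_
    simp only [diag, Set.mem_inter_iff, Set.mem_ofPred_eq]; tauto
  | .or φ ψ => by
    rw [nodeToks, nodeSem]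
    refine ((evals_node g φ).union (evals_node g ψ) (diag_inV φ) (diag_inV ψ)).congr fun p => ?_
    simp only [diag, Set.mem_union, Set.mem_ofPred_eq]; tauto
  | .dataEq c => by
    rw [nodeToks]
    exact .leaf rfl fun _ p => mem_dataR g c p
  | .dataNe c => by
    rw [nodeToks]
    have h : Evals g [(.dataEq, ⟨Coded.code c⟩)] (diag (nodeSem g.graph (.dataEq c))) :=
      .leaf rfl fun _ p => mem_dataR g c p
    refine h.not.congr fun p => ?_
    simp only [diag, nodeSem, Set.mem_ofPred_eq]
    refine and_congr_right fun _ => ?_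
    constructor
    · rintro ⟨h1, h2⟩; exact ⟨h1, fun h => h2 ⟨h1, h⟩⟩
    · rintro ⟨h1, h2⟩; exact ⟨h1, fun ⟨_, h⟩ => h2 h⟩
  | .ex α => by
    rw [nodeToks, nodeSem]
    exact (evals_path g α).unary rfl fun _ _ _ hA p => mem_exR (fun _ h => pathSem_sub _ _ h) hA p
  | .exEq α β => by
    rw [nodeToks, nodeSem]
    exact (evals_path g α).binary rfl (evals_path g β) fun _ _ _ _ _ hA hB p =>
      mem_exEqR (fun _ h => pathSem_sub _ _ h) hA hB p
  | .exNe α β => by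
    rw [nodeToks, nodeSem]
    exact (evals_path g α).binary rfl (evals_path g β) fun _ _ _ _ _ hA hB p =>
      mem_exNeR (fun _ h => pathSem_sub _ _ h) hA hB p
end

theorem Evals.mem (h : Evals g ts S) (p : ℕ × ℕ) : p ∈ evalToks g.1 ts.reverse ↔ p ∈ S := by
  obtain ⟨A, r, e, hA⟩ := h []
  rw [evalToks, List.foldl_reverse, e]
  exact hA p

/-- The tokens of an expression; the relation contains all pairs of nodes if and only if the
expression holds everywhere. -/
def exprToks : Expr Lab Val → List Tok
  | .inl α => pathToks α
  | .inr φ => Op.union.tok :: Op.compl.tok :: Op.eps.tok :: nodeToks φ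

/-- The tokens of the conjunction of a list of expressions. -/
def conjToks : List (Expr Lab Val) → List Tok
  | [] => [Op.union.tok, Op.eps.tok, Op.compl.tok, Op.eps.tok]
  | e :: l => Op.inter.tok :: (exprToks e ++ conjToks l)

/-- An expression holds everywhere. -/
def Holds (G : DataGraph Lab Val) : Expr Lab Val → Prop
  | .inl α => ∀ v ∈ G.V, ∀ w ∈ G.V, (v, w) ∈ pathSem G α
  | .inr φ => ∀ v ∈ G.V, v ∈ nodeSem G φ

/-- For a node expression the off-diagonal pairs are added for free, so that node and path
constraints alike are tested by totality. Totality, unlike mere truth at nodes, passes through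
intersections, which gives the conjunction. -/
theorem evals_expr (g : GLists Lab Val) (e : Expr Lab Val) : ∃ S, InV g S ∧ Evals g (exprToks e) S ∧
    (Holds g.graph e ↔ ∀ v ∈ g.graph.V, ∀ w ∈ g.graph.V, (v, w) ∈ S) := by
  rcases e with α | φ
  · exact ⟨_, fun _ h => pathSem_sub _ _ h, evals_path g α, Iff.rfl⟩
  · have hc : InV g {p : ℕ × ℕ | p.1 ∈ g.graph.V ∧ p.2 ∈ g.graph.V ∧ p ∉ {p : ℕ × ℕ | p.1 ∈ g.graph.V ∧ p.1 = p.2}} :=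
      fun p h => ⟨h.1, h.2.1⟩
    refine ⟨_, ?_, Evals.eps.compl.union (evals_node g φ) hc (diag_inV φ), ?_⟩
    · exact fun p h => h.elim (hc p) (diag_inV φ p)
    · simp only [Holds, Set.mem_union, Set.mem_ofPred_eq, diag]
      constructor
      · intro h v hv w hw
        by_cases e : v = w
        · exact .inr ⟨e, h v hv⟩
        · exact .inl ⟨hv, hw, fun h => e h.2⟩
      · intro h v hv
        rcases h v hv v hv with h | h
        · exact absurd ⟨hv, rfl⟩ h.2.2
        · exact h.2

theorem evals_conj (g : GLists Lab Val) (l : List (Expr Lab Val)) : ∃ S, InV g S ∧ Evals g (conjToks l) S ∧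
    ((∀ e ∈ l, Holds g.graph e) ↔ ∀ v ∈ g.graph.V, ∀ w ∈ g.graph.V, (v, w) ∈ S) := by
  induction l with
  | nil =>
    have he : InV g {p : ℕ × ℕ | p.1 ∈ g.graph.V ∧ p.1 = p.2} := fun p h => ⟨h.1, h.2 ▸ h.1⟩
    have hc : InV g {p : ℕ × ℕ | p.1 ∈ g.graph.V ∧ p.2 ∈ g.graph.V ∧ p ∉ {p : ℕ × ℕ | p.1 ∈ g.graph.V ∧ p.1 = p.2}} :=
      fun p h => ⟨h.1, h.2.1⟩
    refine ⟨_, ?_, Evals.eps.union Evals.eps.compl he hc, ?_⟩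
    · exact fun p h => h.elim (he p) (hc p)
    · simp only [List.not_mem_nil, false_imp_iff, implies_true, true_iff]
      intro v hv w hw
      by_cases e : v = w
      · exact .inl ⟨hv, e⟩
      · exact .inr ⟨hv, hw, fun h => e h.2⟩
  | cons e l ih =>
    obtain ⟨S, h1, h2, h3⟩ := ih
    obtain ⟨T, h4, h5, h6⟩ := evals_expr g e
    refine ⟨_, fun p h => h4 p h.1, h5.inter h2 h4, ?_⟩
    simp only [List.mem_cons, forall_eq_or_imp, h6, h3, Set.mem_inter_iff]
    exact ⟨fun h v hv w hw => ⟨h.1 v hv w hw, h.2 v hv w hw⟩,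
      fun h => ⟨fun v hv w hw => (h v hv w hw).1, fun v hv w hw => (h v hv w hw).2⟩⟩

theorem consistent_iff {G : DataGraph Lab Val} {R : Finset (Expr Lab Val)} :
    Consistent G R ↔ ∀ e ∈ R, Holds G e := by
  constructor
  · rintro ⟨h1, h2⟩ (α | φ) he
    · exact h2 α he
    · exact h1 φ he
  · exact fun h => ⟨fun φ hφ => h _ hφ, fun α hα => h _ hα⟩

/-- Does the graph satisfy the constraints given by the reversed tokens of their conjunction? -/
def consB (g : Lists Lab Val) (ts : List Tok) : Bool :=
  let A := evalToks g ts
  (pairs g.1).all fun p => memR A p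

@[fun_prop] theorem PF.consB {α : Type*} [Enc α] {g : α → Lists Lab Val} {ts : α → List Tok} (hg : PF g)
    (ht : PF ts) : PF fun a => consB (g a) (ts a) := by
  unfold GXPath.consB; fun_prop

theorem consB_iff {l : List (Expr Lab Val)} :
    consB g.1 (conjToks l).reverse = true ↔ ∀ e ∈ l, Holds g.graph e := by
  obtain ⟨S, h1, h2, h3⟩ := evals_conj g l
  rw [h3, consB, List.all_eq_true]
  simp only [mem_pairs, memR_iff, h2.mem]
  exact ⟨fun h v hv w hw => h (v, w) ⟨hv, hw⟩, fun h p hp => h _ hp.1 _ hp.2⟩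

end
end
end GXPath

namespace GXPath
open Machine
open Machine.Enc (enc)

/-! ## Reading the input -/

/-- Remove the first bit. -/
def _root_.Machine.Raw.tail (r : Raw) : Raw := ⟨r.bits.tail⟩

/-- The first bit. -/
def _root_.Machine.Raw.head (r : Raw) : Bool := r.bits.headD false

section
variable {α : Type*} [Enc α]

@[fun_prop] theorem PF.rawTail {r : α → Raw} (hr : PF r) : PF fun a => (r a).tail := by
  unfold Raw.tail; fun_prop
@[fun_prop] theorem PF.rawHead {r : α → Raw} (hr : PF r) : PF fun a => (r a).head := by
  unfold Raw.head; fun_prop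
@[fun_prop] theorem PF.rawFst' {r : α → Raw} (hr : PF r) : PF fun a => (r a).fst := PF.rawFst.comp hr
@[fun_prop] theorem PF.rawSnd' {r : α → Raw} (hr : PF r) : PF fun a => (r a).snd := PF.rawSnd.comp hr

end

theorem rawFst_encStr (x y : List Bool) : (Raw.mk (encStr x ++ y)).fst = ⟨x⟩ := by
  rw [Raw.fst, unstr_encStr]

theorem rawSnd_encStr (x y : List Bool) : (Raw.mk (encStr x ++ y)).snd = ⟨y⟩ := by
  rw [Raw.snd, unstr_encStr]

theorem sz_rawTail (r : Raw) : sz r.tail ≤ sz r := by simp [sz_raw, Raw.tail]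

theorem sz_rawFst (r : Raw) : sz r.fst ≤ sz r := length_unstr_fst r.bits
theorem sz_rawSnd (r : Raw) : sz r.snd ≤ sz r := length_unstr_snd r.bits

noncomputable instance : Enc (Fin 12) := finEnc _
instance : LawfulEnc (Fin 12) := finEnc_lawful _

/-- Read a constructor number, of at most `n`. -/
def readTag : ℕ → Raw → Fin 12 × Raw
  | 0, r => (0, r)
  | n + 1, r => if r.head then ((readTag n r.tail).1 + 1, (readTag n r.tail).2) else (0, r.tail)

theorem PF.readTag (n : ℕ) : PF (readTag n) := by
  induction n with
  | zero => exact PF.mk (.const 0) .id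
  | succ n ih =>
    have h : PF fun r : Raw => GXPath.readTag n r.tail := ih.comp (by fun_prop)
    exact PF.ite (by fun_prop) ((PF.of_finite h.fst fun i => i + 1).mk h.snd) (by fun_prop)

/-- Constructor numbers are read into the finite type `Fin 12`, so that the parsing table is a
finite case distinction. The largest number in use is `10`, so reading with `n = 11` never truncates
and nothing wraps around. -/
theorem readTag_encTag {n k : ℕ} (h : k < n) (x : List Bool) :
    readTag n ⟨encTag k ++ x⟩ = (Fin.ofNat 12 k, ⟨x⟩) := by
  induction n generalizing k with
  | zero => omega
  | succ n ih =>
    cases k with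
    | zero => rfl
    | succ k =>
      have := ih (k := k) (by omega)
      simp [encTag] at this
      simp [readTag, encTag, List.replicate_succ, Raw.head, Raw.tail, this, Fin.ext_iff, Fin.val_add]

theorem sz_readTag (n : ℕ) (r : Raw) : sz (readTag n r).2 ≤ sz r := by
  induction n generalizing r with
  | zero => rfl
  | succ n ih =>
    rw [readTag]
    split_ifs
    · exact (ih _).trans (sz_rawTail r)
    · exact sz_rawTail r

/-- The syntactic categories. -/
inductive Kind
  | path | node | exprs
  deriving DecidableEq

instance : Fintype Kind := ⟨{.path, .node, .exprs}, fun k => by cases k <;> decide⟩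

/-- Symbols: a syntactic category to be read, or an operator whose argument has to be read. -/
abbrev Sym := Kind ⊕ Op

noncomputable instance : Enc Sym := finEnc _
instance : LawfulEnc Sym := finEnc_lawful _

/-- The operators and the symbols that replace a syntactic category. -/
def table : Kind → Fin 12 → List Op × List Sym
  | .path, 0 => ([.eps], [])
  | .path, 1 => ([.wild], [])
  | .path, 2 => ([], [.inr .lab])
  | .path, 3 => ([], [.inr .inv])
  | .path, 4 => ([], [.inl .node])
  | .path, 5 => ([.comp], [.inl .path, .inl .path])
  | .path, 6 => ([.union], [.inl .path, .inl .path])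
  | .path, 7 => ([.inter], [.inl .path, .inl .path])
  | .path, 8 => ([.star], [.inl .path])
  | .path, 9 => ([.compl], [.inl .path])
  | .path, 10 => ([.iter], [.inl .path, .inr .num, .inr .num])
  | .node, 0 => ([.inter, .eps, .compl], [.inl .node])
  | .node, 1 => ([.inter], [.inl .node, .inl .node])
  | .node, 2 => ([.union], [.inl .node, .inl .node])
  | .node, 3 => ([], [.inr .dataEq])
  | .node, 4 => ([.inter, .eps, .compl], [.inr .dataEq])
  | .node, 5 => ([.ex], [.inl .path])
  | .node, 6 => ([.exEq], [.inl .path, .inl .path])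
  | .node, 7 => ([.exNe], [.inl .path, .inl .path])
  | .exprs, 0 => ([.union, .eps, .compl, .eps], [])
  | .exprs, 1 => ([.inter], [.inl .path, .inl .exprs])
  | .exprs, 2 => ([.inter, .union, .compl, .eps], [.inl .node, .inl .exprs])
  | _, _ => ([], [])

/-- The symbols to be read, the remaining input, and the tokens read, the last one first. -/
abbrev LexState := List Sym × Raw × List Tok

/-- Read a symbol. -/
def lexSym (s : LexState) : Sym → LexState
  | .inl k => ((table k (readTag 11 s.2.1).1).2 ++ s.1.tail, (readTag 11 s.2.1).2,
      ((table k (readTag 11 s.2.1).1).1.map Op.tok).reverse ++ s.2.2)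
  | .inr o => (s.1.tail, s.2.1.snd, (o, s.2.1.fst) :: s.2.2)

/-- Read the first symbol. -/
def lexStep (s : LexState) : LexState := if s.1.isEmpty then s else lexSym s (s.1.headD (.inl .path))

/-- Read an element of a syntactic category: the remaining input, and the tokens read, the last one
first. -/
def lex (k : Kind) (r : Raw) : Raw × List Tok := (r.bits.foldl (fun s _ => lexStep s) ([.inl k], r, [])).2

theorem PF.lexSym (y : Sym) : PF fun s => lexSym s y := by
  cases y with
  | inl k =>
    have h : PF fun s : LexState => GXPath.readTag 11 s.2.1 := (PF.readTag 11).comp (by fun_prop)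
    exact PF.mk ((PF.of_finite h.fst fun i => (table k i).2).append (by fun_prop))
      (h.snd.mk ((PF.of_finite h.fst fun i => ((table k i).1.map Op.tok).reverse).append (by fun_prop)))
  | inr o => unfold GXPath.lexSym; fun_prop

theorem PF.lexStep : PF lexStep := by
  refine PF.ite (by fun_prop) (by fun_prop) ?_
  exact PF.finite_cases (k := fun s : LexState => s.1.headD (.inl .path)) (F := fun y s => GXPath.lexSym s y)
    (by fun_prop) PF.lexSym

/-- The table is finite, so each step adds a constant amount of symbols and tokens, apart from a
string copied from the input. Only polynomial growth over the whole run results. -/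
theorem exists_lexStep_bound : ∃ K : ℕ, ∀ s : LexState, sz (lexStep s).1 ≤ sz s.1 + K ∧
    sz (lexStep s).2.1 ≤ sz s.2.1 ∧ sz (lexStep s).2.2 ≤ sz s.2.2 + K + 2 * sz s.2.1 := by
  classical
  have hfin : ∀ {κ : Type} [Fintype κ] (f : κ → ℕ), ∃ K, ∀ k, f k ≤ K := fun f =>
    ⟨Finset.univ.sup f, fun k => Finset.le_sup (f := f) (Finset.mem_univ k)⟩
  obtain ⟨K, hf⟩ := hfin fun p : Kind × Fin 12 =>
    sz (table p.1 p.2).2 + sz ((table p.1 p.2).1.map Op.tok).reverse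
  -- A token is a pair inside a list; each of these two layers doubles the code of the operator.
  obtain ⟨K', hf'⟩ := hfin fun o : Op => 4 * sz o + 3
  refine ⟨K + K', fun s => ?_⟩
  rw [lexStep]
  split_ifs
  · omega
  · have h1 : sz s.1.tail ≤ sz s.1 := sz_sublist (List.tail_sublist _)
    cases s.1.headD (.inl .path) with
    | inl k =>
      have h2 := hf (k, (readTag 11 s.2.1).1)
      have h3 := sz_readTag 11 s.2.1
      simp only at h2
      simp only [lexSym, sz_append]
      omega
    | inr o =>
      have h2 := hf' o
      have h3 := sz_rawFst s.2.1
      have h4 := sz_rawSnd s.2.1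
      simp only [lexSym, sz_cons, sz_pair] at h2 ⊢
      omega

theorem PF.lex (k : Kind) : PF (lex k) := by
  obtain ⟨K, hK⟩ := exists_lexStep_bound
  have h := (PF.bits (PF.id (α := Raw))).foldl (g := fun r => (([.inl k], r, []) : LexState))
    (h := fun _ s _ => GXPath.lexStep s) (by fun_prop) (PF.lexStep.comp (by fun_prop))
    (B := fun r => 2 * (sz [(.inl k : Sym)] + sz r * K) + 1 + (2 * sz r + 1 + sz r * (K + 2 * sz r)))
    (by
      have hs := PB.self (fun r : Raw => sz r)
      exact (((PB.const _ 2).mul ((PB.const _ _).add (hs.mul (.const _ K)))).add (.const _ 1)).add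
        ((((PB.const _ 2).mul hs).add (.const _ 1)).add (hs.mul ((PB.const _ K).add ((PB.const _ 2).mul hs)))))
    fun r m hm => by
      have key : ∀ (m : List Bool) (s : LexState), sz s.2.1 ≤ sz r →
          sz (m.foldl (fun s _ => GXPath.lexStep s) s).1 ≤ sz s.1 + m.length * K ∧
          sz (m.foldl (fun s _ => GXPath.lexStep s) s).2.1 ≤ sz r ∧
          sz (m.foldl (fun s _ => GXPath.lexStep s) s).2.2 ≤ sz s.2.2 + m.length * (K + 2 * sz r) := by
        intro m
        induction m with
        | nil => intro s hs; simpa using hs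
        | cons b m ih =>
          intro s hs
          obtain ⟨h1, h2, h3⟩ := hK s
          obtain ⟨i1, i2, i3⟩ := ih (GXPath.lexStep s) (h2.trans hs)
          simp only [List.foldl_cons, List.length_cons, add_mul, one_mul]
          omega
      obtain ⟨h1, h2, h3⟩ := key m ([.inl k], r, []) le_rfl
      have hm' : m.length ≤ sz r := hm.length_le
      have h4 := Nat.mul_le_mul_right K hm'
      have h5 := Nat.mul_le_mul_right (K + 2 * sz r) hm'
      have hfin : ∀ S : LexState, sz S.1 ≤ sz [(.inl k : Sym)] + m.length * K → sz S.2.1 ≤ sz r →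
          sz S.2.2 ≤ 0 + m.length * (K + 2 * sz r) →
          sz S ≤ 2 * (sz [(.inl k : Sym)] + sz r * K) + 1 + (2 * sz r + 1 + sz r * (K + 2 * sz r)) := by
        intro S h1 h2 h3
        rw [sz_prod, sz_prod]
        omega
      exact hfin _ h1 h2 h3
  exact h.snd

/-- The bits `x` are read as the symbols `y`, which yields the tokens `ts`. -/
def Lexes (y : List Sym) (x : List Bool) (ts : List Tok) : Prop :=
  ∀ z r out, ∃ n ≤ x.length, lexStep^[n] (y ++ z, ⟨x ++ r⟩, out) = (z, ⟨r⟩, ts.reverse ++ out)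

theorem Lexes.nil : Lexes [] [] [] := fun _ _ _ => ⟨0, le_rfl, rfl⟩

theorem Lexes.append {y y' : List Sym} {x x' : List Bool} {ts ts' : List Tok} (h : Lexes y x ts)
    (h' : Lexes y' x' ts') : Lexes (y ++ y') (x ++ x') (ts ++ ts') := fun z r out => by
  obtain ⟨n, hn, e⟩ := h (y' ++ z) (x' ++ r) out
  obtain ⟨n', hn', e'⟩ := h' z r (ts.reverse ++ out)
  refine ⟨n' + n, by simp; omega, ?_⟩
  rw [Function.iterate_add_apply, List.append_assoc, List.append_assoc, e, e', List.reverse_append,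
    List.append_assoc]

theorem Lexes.str (o : Op) (x : List Bool) : Lexes [.inr o] (encStr x) [(o, ⟨x⟩)] := fun z r out =>
  ⟨1, by simp [length_encStr], by simp [lexStep, lexSym, rawFst_encStr, rawSnd_encStr]⟩

theorem Lexes.tag (k : Kind) (t : ℕ) (ht : t < 11) {x : List Bool} {ts ts' : List Tok}
    (h : Lexes (table k (Fin.ofNat 12 t)).2 x ts)
    (e : ts' = (table k (Fin.ofNat 12 t)).1.map Op.tok ++ ts := by rfl) :
    Lexes [.inl k] (encTag t ++ x) ts' := fun z r out => by
  obtain ⟨n, hn, e'⟩ := h z r (((table k (Fin.ofNat 12 t)).1.map Op.tok).reverse ++ out)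
  refine ⟨n + 1, by simp [encTag]; omega, ?_⟩
  rw [Function.iterate_succ_apply, e, List.reverse_append, List.append_assoc, List.append_assoc, ← e']
  simp [lexStep, lexSym, readTag_encTag ht]

mutual
variable {Lab : Type u} {Val : Type v} [Coded Lab] [Coded Val]

theorem lexes_path : ∀ α : PathExpr Lab Val, Lexes [.inl .path] (encPath α) (pathToks α)
  | .eps => by
    rw [encPath, pathToks, ← List.append_nil (encTag 0)]
    exact .tag .path 0 (by omega) .nil
  | .wild => by
    rw [encPath, pathToks, ← List.append_nil (encTag 1)]
    exact .tag .path 1 (by omega) .nil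
  | .lab a => by
    rw [encPath, pathToks]
    exact .tag .path 2 (by omega) (.str _ _)
  | .inv a => by
    rw [encPath, pathToks]
    exact .tag .path 3 (by omega) (.str _ _)
  | .test φ => by
    rw [encPath, pathToks]
    exact .tag .path 4 (by omega) (lexes_node φ)
  | .comp α β => by
    rw [encPath, pathToks, List.append_assoc]
    exact .tag .path 5 (by omega) ((lexes_path α).append (lexes_path β))
  | .union α β => by
    rw [encPath, pathToks, List.append_assoc]
    exact .tag .path 6 (by omega) ((lexes_path α).append (lexes_path β))
  | .inter α β => by
    rw [encPath, pathToks, List.append_assoc]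
    exact .tag .path 7 (by omega) ((lexes_path α).append (lexes_path β))
  | .star α => by
    rw [encPath, pathToks]
    exact .tag .path 8 (by omega) (lexes_path α)
  | .compl α => by
    rw [encPath, pathToks]
    exact .tag .path 9 (by omega) (lexes_path α)
  | .iter α n m => by
    rw [encPath, pathToks, List.append_assoc, List.append_assoc]
    exact .tag .path 10 (by omega) ((lexes_path α).append ((Lexes.str .num _).append (Lexes.str .num _)))

theorem lexes_node : ∀ φ : NodeExpr Lab Val, Lexes [.inl .node] (encNode φ) (nodeToks φ)
  | .not φ => by
    rw [encNode, nodeToks]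
    exact .tag .node 0 (by omega) (lexes_node φ)
  | .and φ ψ => by
    rw [encNode, nodeToks, List.append_assoc]
    exact .tag .node 1 (by omega) ((lexes_node φ).append (lexes_node ψ))
  | .or φ ψ => by
    rw [encNode, nodeToks, List.append_assoc]
    exact .tag .node 2 (by omega) ((lexes_node φ).append (lexes_node ψ))
  | .dataEq c => by
    rw [encNode, nodeToks]
    exact .tag .node 3 (by omega) (.str _ _)
  | .dataNe c => by
    rw [encNode, nodeToks]
    exact .tag .node 4 (by omega) (.str _ _)
  | .ex α => by
    rw [encNode, nodeToks]
    exact .tag .node 5 (by omega) (lexes_path α)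
  | .exEq α β => by
    rw [encNode, nodeToks, List.append_assoc]
    exact .tag .node 6 (by omega) ((lexes_path α).append (lexes_path β))
  | .exNe α β => by
    rw [encNode, nodeToks, List.append_assoc]
    exact .tag .node 7 (by omega) ((lexes_path α).append (lexes_path β))
end

section
variable {Lab : Type u} {Val : Type v} [Coded Lab] [Coded Val]

/-- The `true` before a list entry merges with the unary tag of the expression, and the final
`false` is the tag `0`. A list of expressions thus reads like a syntactic category with three
constructors: end, path first, node first. -/
theorem lexes_exprs (l : List (Expr Lab Val)) : Lexes [.inl .exprs] (encList encExpr l) (conjToks l) := by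
  induction l with
  | nil =>
    rw [conjToks]
    exact .tag .exprs 0 (x := []) (by omega) .nil
  | cons e l ih =>
    rcases e with α | φ
    · have : encList encExpr (.inl α :: l) = encTag 1 ++ (encPath α ++ encList encExpr l) := by
        simp [encList, encExpr, encTag]
      rw [this, conjToks, exprToks]
      exact .tag .exprs 1 (by omega) ((lexes_path α).append ih)
    · have : encList encExpr (.inr φ :: l) = encTag 2 ++ (encNode φ ++ encList encExpr l) := by
        simp [encList, encExpr, encTag]
      rw [this, conjToks, exprToks]
      exact .tag .exprs 2 (by omega) ((lexes_node φ).append ih)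

end

theorem foldl_const_eq_iterate {σ τ : Type*} (f : σ → σ) (l : List τ) : ∀ s,
    l.foldl (fun s _ => f s) s = f^[l.length] s := by
  induction l with
  | nil => exact fun _ => rfl
  | cons t l ih => exact fun s => ih (f s)

/-- Parsing is iterated once per input bit, which suffices since at most `x.length` steps are
needed. The surplus steps do nothing, because a state without pending symbols is fixed. -/
theorem Lexes.lex_eq {k : Kind} {x : List Bool} {ts : List Tok} (h : Lexes [.inl k] x ts) (r : List Bool) :
    lex k ⟨x ++ r⟩ = (⟨r⟩, ts.reverse) := by
  obtain ⟨n, hn, e⟩ := h [] r []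
  rw [lex, foldl_const_eq_iterate]
  obtain ⟨m, hm⟩ := Nat.exists_eq_add_of_le' (show n ≤ (x ++ r).length by simp; omega)
  rw [hm, Function.iterate_add_apply]
  rw [List.append_nil] at e
  rw [e, Function.iterate_fixed (by simp [lexStep]), List.append_nil]

/-! ## Lists of items -/

section
variable {β : Type*} [Enc β]

/-- Read an item of a list, if there is one; the state consists of the items read, the last one first,
and the remaining input. -/
def itemStep (item : Raw → β × Raw) (s : List β × Raw) : List β × Raw :=
  if s.2.head then ((item s.2.tail).1 :: s.1, (item s.2.tail).2) else s

/-- Read a list. -/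
def readList (item : Raw → β × Raw) (r : Raw) : List β × Raw :=
  let s := r.bits.foldl (fun s _ => itemStep item s) ([], r)
  (s.1.reverse, s.2.tail)

theorem sz_itemStep {item : Raw → β × Raw} (hs : ∀ r, sz (item r).2 ≤ sz r) (s : List β × Raw) :
    sz (itemStep item s).2 ≤ sz s.2 := by
  rw [itemStep]
  split_ifs
  · exact (hs _).trans (sz_rawTail _)
  · rfl

theorem sz_readList {item : Raw → β × Raw} (hs : ∀ r, sz (item r).2 ≤ sz r) (r : Raw) :
    sz (readList item r).2 ≤ sz r :=
  (sz_rawTail _).trans (foldl_sub (P := fun s : List β × Raw => sz s.2 ≤ sz r)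
    (fun s _ h => (sz_itemStep hs s).trans h) r.bits ([], r) le_rfl)

theorem PF.readList {item : Raw → β × Raw} (hi : PF item) (hs : ∀ r, sz (item r).2 ≤ sz r) :
    PF (readList item) := by
  obtain ⟨p, hp⟩ := hi.fst.pb_sz
  have hstep : PF (itemStep item) := by
    have h : PF fun s : List β × Raw => item s.2.tail := hi.comp (by fun_prop)
    exact PF.ite (by fun_prop) ((h.fst.cons (by fun_prop)).mk h.snd) (by fun_prop)
  have h := (PF.bits (PF.id (α := Raw))).foldl (g := fun r => (([], r) : List β × Raw))
    (h := fun _ s _ => itemStep item s) (by fun_prop) (hstep.comp (by fun_prop))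
    (B := fun r => 2 * (sz r * (2 * p.eval (sz r) + 1)) + 1 + sz r)
    (by
      have hs := PB.self (fun r : Raw => sz r)
      exact (((PB.const _ 2).mul (hs.mul (((PB.const _ 2).mul (hs.eval p)).add (.const _ 1)))).add
        (.const _ 1)).add hs)
    fun r m hm => by
      have key : ∀ (m : List Bool) (s : List β × Raw), sz s.2 ≤ sz r →
          sz (m.foldl (fun s _ => itemStep item s) s).1 ≤ sz s.1 + m.length * (2 * p.eval (sz r) + 1) ∧
          sz (m.foldl (fun s _ => itemStep item s) s).2 ≤ sz r := by
        intro m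
        induction m with
        | nil => intro s hs; simpa using hs
        | cons b m ih =>
          intro s hs'
          obtain ⟨i1, i2⟩ := ih (itemStep item s) ((sz_itemStep hs s).trans hs')
          have h1 : sz (itemStep item s).1 ≤ sz s.1 + (2 * p.eval (sz r) + 1) := by
            rw [itemStep]
            split_ifs
            · have : sz (item s.2.tail).1 ≤ p.eval (sz r) :=
                (hp s.2.tail).trans (eval_mono p ((sz_rawTail s.2).trans hs'))
              simp only [sz_cons]
              omega
            · omega
          simp only [List.foldl_cons, List.length_cons, add_mul, one_mul]
          omega
      obtain ⟨h1, h2⟩ := key m ([], r) le_rfl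
      have hm' : m.length ≤ sz r := hm.length_le
      have h5 := Nat.mul_le_mul_right (2 * p.eval (sz r) + 1) hm'
      rw [sz_prod]
      simp only [sz_nil] at h1
      omega
  exact h.fst.reverse.mk (PF.rawTail h.snd)

/-- Each entry uses up at least its leading `true`, so one step per input bit is enough; in front of
the closing `false` the state is fixed, and the final `tail` removes that bit. -/
theorem readList_encList {γ : Type*} {item : Raw → β × Raw} {e : γ → List Bool} {f : γ → β}
    (h : ∀ c x, item ⟨e c ++ x⟩ = (f c, ⟨x⟩)) (l : List γ) (x : List Bool) :
    readList item ⟨encList e l ++ x⟩ = (l.map f, ⟨x⟩) := by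
  have key : ∀ (l : List γ) (out : List β), ∃ n ≤ (encList e l).length,
      (itemStep item)^[n] (out, ⟨encList e l ++ x⟩) = ((l.map f).reverse ++ out, ⟨false :: x⟩) := by
    intro l
    induction l with
    | nil => exact fun out => ⟨0, by simp, by simp [encList]⟩
    | cons c l ih =>
      intro out
      obtain ⟨n, hn, e'⟩ := ih (f c :: out)
      refine ⟨n + 1, by simp [encList] at hn ⊢; omega, ?_⟩
      have : encList e (c :: l) ++ x = true :: (e c ++ (encList e l ++ x)) := by simp [encList]
      rw [Function.iterate_succ_apply, this, itemStep]
      simp only [Raw.head, List.headD_cons, if_true, Raw.tail, List.tail_cons, h]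
      rw [e']
      simp
  obtain ⟨n, hn, e'⟩ := key l []
  obtain ⟨m, hm⟩ := Nat.exists_eq_add_of_le' (show n ≤ (encList e l ++ x).length by simp; omega)
  rw [readList, foldl_const_eq_iterate]
  simp only
  rw [hm, Function.iterate_add_apply, e', Function.iterate_fixed (by simp [itemStep, Raw.head])]
  simp [Raw.tail]

end

/-! ## The items of the input -/

/-- Read a node with its data value. -/
def readNode (r : Raw) : (Raw × Raw) × Raw := ((r.fst, r.snd.fst), r.snd.snd)

/-- Read an edge. -/
def readEdge (r : Raw) : (Raw × Raw × Raw) × Raw := ((r.fst, r.snd.fst, r.snd.snd.fst), r.snd.snd.snd)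

/-- Facts with their components as bit strings. -/
abbrev FactR := Bool × Raw × Raw × Raw

/-- Read a fact. -/
def readFact (r : Raw) : FactR × Raw :=
  if r.head then ((true, (readEdge r.tail.tail).1), (readEdge r.tail.tail).2)
  else ((false, r.tail.fst, ⟨[]⟩, ⟨[]⟩), r.tail.snd)

theorem PF.readNode : PF readNode := by unfold GXPath.readNode; fun_prop
theorem PF.readEdge : PF readEdge := by unfold GXPath.readEdge; fun_prop
theorem PF.readFact : PF readFact := by
  have h : PF fun r : Raw => GXPath.readEdge r.tail.tail := PF.readEdge.comp (by fun_prop)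
  exact PF.ite (by fun_prop) (((PF.const true).mk h.fst).mk h.snd) (by fun_prop)

theorem sz_readNode (r : Raw) : sz (readNode r).2 ≤ sz r := (sz_rawSnd _).trans (sz_rawSnd _)
theorem sz_readEdge (r : Raw) : sz (readEdge r).2 ≤ sz r :=
  (sz_rawSnd _).trans ((sz_rawSnd _).trans (sz_rawSnd _))
theorem sz_readFact (r : Raw) : sz (readFact r).2 ≤ sz r := by
  rw [readFact]
  split_ifs
  · exact (sz_readEdge _).trans ((sz_rawTail _).trans (sz_rawTail _))
  · exact (sz_rawSnd _).trans (sz_rawTail _)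

section
variable {Lab : Type u} {Val : Type v} [Coded Lab] [Coded Val]

/-- The components of a node entry. -/
def nodeR (p : ℕ × Val) : Raw × Raw := (toRaw p.1, toRaw p.2)

/-- The components of an edge. -/
def edgeR (e : ℕ × Lab × ℕ) : Raw × Raw × Raw := (toRaw e.1, toRaw e.2.1, toRaw e.2.2)

/-- The components of a fact. -/
def factR : Fact Lab → FactR
  | .inl v => (false, toRaw v, ⟨[]⟩, ⟨[]⟩)
  | .inr e => (true, edgeR e)

theorem enc_toRaw {α : Type*} [Enc α] (a : α) : enc (toRaw a) = enc a := rfl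

/-- The parser delivers bare strings, for labels and data values are abstract. They have the same
codes as the objects they stand for, so `PF.cast` replaces the former by the latter without any
decoding. -/
theorem enc_nodeR (p : ℕ × Val) : enc (nodeR p) = enc p := rfl
theorem enc_edgeR (e : ℕ × Lab × ℕ) : enc (edgeR e) = enc e := rfl

theorem enc_map {α β : Type*} [Enc α] [Enc β] {f : α → β} (h : ∀ a, enc (f a) = enc a) (l : List α) :
    enc (l.map f) = enc l := by
  induction l with
  | nil => rfl
  | cons a l ih => rw [List.map_cons, enc_cons, enc_cons, h, ih]

theorem readNode_enc (p : ℕ × Val) (x : List Bool) : readNode ⟨encNodeEntry p ++ x⟩ = (nodeR p, ⟨x⟩) := by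
  simp [readNode, encNodeEntry, encNat, rawFst_encStr, rawSnd_encStr, nodeR, toRaw]; rfl

theorem readEdge_enc (e : ℕ × Lab × ℕ) (x : List Bool) : readEdge ⟨encEdge e ++ x⟩ = (edgeR e, ⟨x⟩) := by
  simp [readEdge, encEdge, encNat, rawFst_encStr, rawSnd_encStr, edgeR, toRaw]; rfl

theorem readFact_enc (f : Fact Lab) (x : List Bool) : readFact ⟨encFact f ++ x⟩ = (factR f, ⟨x⟩) := by
  rcases f with v | e
  · simp [readFact, encFact, encTag, Raw.head, Raw.tail, encNat, rawFst_encStr, rawSnd_encStr, factR, toRaw]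
  · have := readEdge_enc e x
    simp [readFact, encFact, encTag, Raw.head, Raw.tail, factR, this]

/-- Read an input; the last component is the remaining bit string. -/
def readInput (r : Raw) :
    ((List (Raw × Raw) × List (Raw × Raw × Raw)) × List Tok × List Tok × Raw × Raw) × Raw :=
  let a := readList readNode r
  let b := readList readEdge a.2
  let c := lex .exprs b.2
  let d := lex .path c.1
  (((a.1, b.1), c.2, d.2, d.1.fst, d.1.snd.fst), d.1.snd.snd)

theorem PF.readInput : PF readInput := by
  have ha : PF (GXPath.readList GXPath.readNode) := PF.readList PF.readNode sz_readNode
  have hb : PF (fun r : Raw => GXPath.readList GXPath.readEdge (GXPath.readList GXPath.readNode r).2) :=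
    (PF.readList PF.readEdge sz_readEdge).comp ha.snd
  have hc : PF _ := (PF.lex .exprs).comp hb.snd
  have hd : PF _ := (PF.lex .path).comp hc.fst
  have h1 := PF.rawFst.comp hd.fst
  have h2 := PF.rawSnd.comp hd.fst
  exact ((ha.fst.mk hb.fst).mk (hc.snd.mk (hd.snd.mk (h1.mk (PF.rawFst.comp h2))))).mk (PF.rawSnd.comp h2)

theorem readInput_eq (ns : List (ℕ × Val)) (es : List (ℕ × Lab × ℕ)) (rs : List (Expr Lab Val))
    (q : PathExpr Lab Val) (v w : ℕ) (x : List Bool) :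
    readInput ⟨encList encNodeEntry ns ++ (encList encEdge es ++ (encList encExpr rs ++ (encPath q ++
      (encNat v ++ (encNat w ++ x)))))⟩ = (((ns.map nodeR, es.map edgeR), (conjToks rs).reverse,
        (pathToks q).reverse, toRaw v, toRaw w), ⟨x⟩) := by
  simp only [readInput, readList_encList readNode_enc, readList_encList readEdge_enc,
    (lexes_exprs rs).lex_eq, (lexes_path q).lex_eq, encNat, rawFst_encStr, rawSnd_encStr]
  rfl

end
end GXPath

namespace GXPath
open Machine
open Machine.Enc (enc)

section
variable {Lab : Type u} {Val : Type v} [Coded Lab] [Coded Val]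

/-! ## Instances -/

theorem DataGraph.ext_of {G G' : DataGraph Lab Val} (hV : G.V = G'.V) (hE : G.E = G'.E)
    (hD : ∀ v (h : v ∈ G.V) (h' : v ∈ G'.V), G.D v h = G'.D v h') : G = G' := by
  obtain ⟨V, E, h1, h2, D⟩ := G
  obtain ⟨V', E', h1', h2', D'⟩ := G'
  obtain rfl : V = V' := hV
  obtain rfl : E = E' := hE
  obtain rfl : D = D' := funext fun v => funext fun h => hD v h h
  rfl

theorem _root_.Machine.Enumerates.nodup {α : Type*} {l : List α} {S : Finset α} (h : Enumerates l S) : l.Nodup := by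
  have := S.nodup
  rw [← h] at this
  exact Multiset.coe_nodup.1 this

theorem _root_.Machine.Enumerates.mem {α : Type*} {l : List α} {S : Finset α} (h : Enumerates l S) {a : α} :
    a ∈ l ↔ a ∈ S := by
  rw [← Finset.mem_val, ← h, Multiset.mem_coe]

theorem enumerates_toFinset {α : Type*} [DecidableEq α] {l : List α} (h : l.Nodup) : Enumerates l l.toFinset := by
  rw [Enumerates, List.toFinset_val, h.dedup]

/-- The lists in the code of a data-graph. -/
theorem exists_gLists {G : DataGraph Lab Val} {ns : List (ℕ × Val)} {es : List (ℕ × Lab × ℕ)}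
    (h1 : Enumerates (ns.map Prod.fst) G.V) (h2 : ∀ p ∈ ns, ∃ h : p.1 ∈ G.V, G.D p.1 h = p.2)
    (h3 : Enumerates es G.E) : ∃ g : GLists Lab Val, g.1 = (ns, es) ∧ g.graph = G := by
  let g : GLists Lab Val := ⟨(ns, es), h1.nodup, h3.nodup, fun e he =>
    ⟨h1.mem.2 (G.src_mem e (h3.mem.1 he)), h1.mem.2 (G.tgt_mem e (h3.mem.1 he))⟩⟩
  refine ⟨g, rfl, DataGraph.ext_of ?_ ?_ ?_⟩
  · ext v; rw [← h1.mem]; simp [GLists.graph, g]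
  · ext e; rw [← h3.mem]; exact GLists.mem_E
  · intro v h h'
    obtain ⟨h4, h5⟩ := h2 _ (g.D_mem h)
    exact h5.symm

/-- The code of a data-graph that corresponds to its lists. -/
def codeLists (g : Lists Lab Val) : List Bool := encList encNodeEntry g.1 ++ encList encEdge g.2

theorem codes_graph (g : GLists Lab Val) : g.graph.Codes (codeLists g.1) := by
  classical
  refine ⟨g.1.1, g.1.2, ?_, fun p hp => ?_, ?_, rfl⟩
  · convert enumerates_toFinset g.2.1 using 1
    ext v; rw [GLists.mem_V]; simp
  · have h : p.1 ∈ g.graph.V := GLists.mem_V.2 ⟨p.2, hp⟩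
    exact ⟨h, g.D_eq hp h⟩
  · convert enumerates_toFinset g.2.2.1 using 1
    ext e; rw [GLists.mem_E]; simp

@[fun_prop] theorem PF.encStr {α : Type*} [Enc α] {f : α → List Bool} (hf : PF f) :
    PF fun a => encStr (f a) := by
  unfold Machine.encStr; fun_prop

theorem PF.codeLists : PF (codeLists (Lab := Lab) (Val := Val)) := by
  have h1 : PF fun p : ℕ × Val => encNodeEntry p :=
    PF.append (PF.encStr (PF.code (f := fun p : ℕ × Val => p.1) (by fun_prop)))
      (PF.encStr (PF.code (f := fun p : ℕ × Val => p.2) (by fun_prop)))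
  have h2 : PF fun p : ℕ × Lab × ℕ => encEdge p :=
    PF.append (PF.append (PF.encStr (PF.code (f := fun p : ℕ × Lab × ℕ => p.1) (by fun_prop)))
      (PF.encStr (PF.code (f := fun p : ℕ × Lab × ℕ => p.2.1) (by fun_prop))))
      (PF.encStr (PF.code (f := fun p : ℕ × Lab × ℕ => p.2.2) (by fun_prop)))
  unfold GXPath.codeLists encList
  fun_prop

/-- An instance: its data-graph, the reversed tokens of the constraints and of the query, and the two
nodes. -/
abbrev Instance (Lab : Type u) (Val : Type v) := GLists Lab Val × List Tok × List Tok × ℕ × ℕ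

variable {𝓛 𝓠 : Set (Expr Lab Val)}

/-- The instance describes the input. -/
structure Reads (I : Input 𝓛 𝓠) (t : Instance Lab Val) : Prop where
  graph : t.1.graph = I.G
  consistent : ∀ K : GLists Lab Val, consB K.1 t.2.1 = true ↔ Consistent K.graph I.R
  query : ∀ K : GLists Lab Val, ∀ p, p ∈ evalToks K.1 t.2.2.1 ↔ p ∈ pathSem K.graph I.q
  nodes : t.2.2.2 = (I.v, I.w)

theorem length_le_encList {α : Type*} (e : α → List Bool) (l : List α) : l.length ≤ (encList e l).length := by
  induction l with
  | nil => simp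
  | cons a l ih => simp [encList] at ih ⊢; omega

/-- The instance depends on the order in which the representation lists nodes, edges and
constraints, but its relevant properties do not. The trailing string `z` leaves room for the
prioritization. -/
theorem exists_reads {I : Input 𝓛 𝓠} {y : List Bool} (h : I.Codes y) : ∃ t : Instance Lab Val, Reads I t ∧
    t.1.1.1.length + t.1.1.2.length ≤ y.length ∧
    ∀ z, enc (readInput ⟨y ++ z⟩).1 = enc t ∧ (readInput ⟨y ++ z⟩).2 = ⟨z⟩ := by
  obtain ⟨_, _, ⟨ns, es, h1, h2, h3, rfl⟩, ⟨rs, h4, rfl⟩, rfl⟩ := h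
  obtain ⟨g, hg, hG⟩ := exists_gLists h1 h2 h3
  refine ⟨(g, (conjToks rs).reverse, (pathToks I.q).reverse, I.v, I.w), ⟨hG, fun K => ?_, fun K p => ?_, rfl⟩,
    ?_, fun z => ?_⟩
  · rw [consB_iff, consistent_iff]
    simp only [h4.mem]
  · exact (evals_path K I.q).mem p
  · have := length_le_encList encNodeEntry ns
    have := length_le_encList encEdge es
    simp only [hg, List.length_append]
    omega
  · have := readInput_eq ns es rs I.q I.v I.w z
    simp only [List.append_assoc, this, and_true]
    simp only [enc_pair, enc_map enc_nodeR, enc_map enc_edgeR, enc_subtype, hg, enc_toRaw]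

/-! ## Subsets of a data-graph -/

/-- The selected members of a list, and the remaining bits. -/
def select {β : Type*} : List β → List Bool → List β × List Bool
  | [], m => ([], m)
  | b :: l, m => (if m.headD false then b :: (select l m.tail).1 else (select l m.tail).1, (select l m.tail).2)

theorem select_sublist {β : Type*} (l : List β) : ∀ m, (select l m).1.Sublist l := by
  induction l with
  | nil => exact fun _ => .slnil
  | cons b l ih =>
    intro m
    rw [select]
    split_ifs
    · exact (ih _).cons_cons b
    · exact (ih _).cons b

theorem select_map_append {β : Type*} (p : β → Bool) (l : List β) (m : List Bool) :
    select l (l.map p ++ m) = (l.filter p, m) := by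
  induction l with
  | nil => rfl
  | cons b l ih => by_cases h : p b <;> simp [select, ih, h]

theorem foldl_select {β : Type*} (l : List β) : ∀ (m : List Bool) (out : List β),
    l.foldl (fun (s : List Bool × List β) b => (s.1.tail, if s.1.headD false then b :: s.2 else s.2)) (m, out) =
      ((select l m).2, (select l m).1.reverse ++ out) := by
  induction l with
  | nil => exact fun _ _ => rfl
  | cons b l ih =>
    intro m out
    rw [List.foldl_cons, ih, select]
    simp only
    split_ifs <;> simp

@[fun_prop] theorem PF.select {α β : Type*} [Enc α] [Enc β] {l : α → List β} {m : α → List Bool} (hl : PF l)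
    (hm : PF m) : PF fun a => select (l a) (m a) := by
  have h := hl.foldl (g := fun a => (m a, ([] : List β)))
    (h := fun a s b => (s.1.tail, if s.1.headD false then b :: s.2 else s.2)) (by fun_prop) (by fun_prop)
    (B := fun a => 2 * sz (m a) + 1 + sz (l a)) ((((PB.const _ 2).mul hm.pb_sz).add (.const _ 1)).add hl.pb_sz)
    fun a l' hl' => by
      have h2 : ∀ (l : List β) (m : List Bool), sz (GXPath.select l m).2 ≤ sz m := by
        intro l
        induction l with
        | nil => exact fun _ => le_rfl
        | cons b l ih => exact fun m => (ih m.tail).trans (sz_sublist (List.tail_sublist m))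
      have h3 := h2 l' (m a)
      have h4 := sz_sublist ((select_sublist l' (m a)).trans hl'.sublist)
      rw [foldl_select, sz_pair, List.append_nil, sz_reverse]
      omega
  have h' : PF fun a => ((GXPath.select (l a) (m a)).2, (GXPath.select (l a) (m a)).1.reverse) := by
    simpa only [foldl_select, List.append_nil] using h
  have h'' := h'.snd.reverse.mk h'.fst
  simpa only [List.reverse_reverse] using h''

/-- The lists of the selected part of a data-graph. -/
def subLists (g : Lists Lab Val) (y : Raw) : Lists Lab Val :=
  let s := select g.1 y.bits
  (s.1, (select g.2 s.2).1.filter fun e => (s.1.any fun p => eqb p.1 e.1) && s.1.any fun p => eqb p.1 e.2.2)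

theorem subLists_sublist (g : Lists Lab Val) (y : Raw) :
    (subLists g y).1.Sublist g.1 ∧ (subLists g y).2.Sublist g.2 :=
  ⟨select_sublist _ _, List.filter_sublist.trans (select_sublist _ _)⟩

/-- Selected edges that have lost an end point are discarded, so that every guessed string describes
a subgraph and no validity check is needed. -/
theorem valid_subLists {g : Lists Lab Val} (h : g.Valid) (y : Raw) : (subLists g y).Valid := by
  obtain ⟨h1, h2⟩ := subLists_sublist g y
  refine ⟨h.1.sublist (h1.map _), h.2.1.sublist h2, fun e he => ?_⟩
  have := (List.mem_filter.1 he).2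
  simp only [Bool.and_eq_true, List.any_eq_true, eqb_iff] at this
  obtain ⟨⟨p, hp, e1⟩, q, hq, e2⟩ := this
  exact ⟨List.mem_map.2 ⟨p, hp, e1⟩, List.mem_map.2 ⟨q, hq, e2⟩⟩

/-- The selected part of a data-graph. -/
def subG (g : GLists Lab Val) (y : Raw) : GLists Lab Val := ⟨subLists g.1 y, valid_subLists g.2 y⟩

@[fun_prop] theorem PF.val {α : Type*} [Enc α] {g : α → GLists Lab Val} (hg : PF g) : PF fun a => (g a).1 :=
  hg.cast (fun a => a) (fun _ => rfl) fun _ => rfl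

@[fun_prop] theorem PF.subLists {α : Type*} [Enc α] {g : α → Lists Lab Val} {y : α → Raw} (hg : PF g) (hy : PF y) :
    PF fun a => subLists (g a) (y a) := by
  unfold GXPath.subLists
  fun_prop

@[fun_prop] theorem PF.subG {α : Type*} [Enc α] {g : α → GLists Lab Val} {y : α → Raw} (hg : PF g) (hy : PF y) :
    PF fun a => subG (g a) (y a) :=
  (PF.subLists (PF.val hg) hy).cast (fun a => a) (fun _ => rfl) fun _ => rfl

/-- The lists of `H` are sublists of those of `G`. -/
def SubL (H G : GLists Lab Val) : Prop := H.1.1.Sublist G.1.1 ∧ H.1.2.Sublist G.1.2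

theorem subL_subG (g : GLists Lab Val) (y : Raw) : SubL (subG g y) g := subLists_sublist g.1 y

theorem SubL.refl (g : GLists Lab Val) : SubL g g := ⟨.refl _, .refl _⟩

theorem SubL.sub {H G : GLists Lab Val} (h : SubL H G) : H.graph.Sub G.graph := by
  refine ⟨fun v hv => ?_, fun e he => ?_, fun v h1 h2 => ?_⟩
  · obtain ⟨c, hc⟩ := GLists.mem_V.1 hv
    exact GLists.mem_V.2 ⟨c, h.1.subset hc⟩
  · exact GLists.mem_E.2 (h.2.subset (GLists.mem_E.1 he))
  · exact (G.D_eq (h.1.subset (H.D_mem h1)) h2).symm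

/-- The witness is the characteristic string of `H`, padded with `false`: the machines guess strings
of exactly the length of their input, so any sufficient length has to be attainable. -/
theorem exists_subG (g : GLists Lab Val) {H : DataGraph Lab Val} (h : H.Sub g.graph) {n : ℕ}
    (hn : g.1.1.length + g.1.2.length ≤ n) : ∃ y : List Bool, y.length = n ∧ (subG g ⟨y⟩).graph = H := by
  classical
  let y := g.1.1.map (fun p => decide (p.1 ∈ H.V)) ++ (g.1.2.map (fun e => decide (e ∈ H.E)) ++
    List.replicate (n - (g.1.1.length + g.1.2.length)) false)
  have hy : (subG g ⟨y⟩).1 = (g.1.1.filter fun p => decide (p.1 ∈ H.V), (g.1.2.filter fun e => decide (e ∈ H.E)).filter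
      fun e => ((g.1.1.filter fun p => decide (p.1 ∈ H.V)).any fun p => eqb p.1 e.1) &&
        (g.1.1.filter fun p => decide (p.1 ∈ H.V)).any fun p => eqb p.1 e.2.2) := by
    simp only [subG, subLists, y, select_map_append]
  have hV : ∀ v, v ∈ H.V ↔ ∃ c, (v, c) ∈ g.1.1.filter fun p => decide (p.1 ∈ H.V) := by
    intro v
    simp only [List.mem_filter, decide_eq_true_eq]
    constructor
    · intro hv
      obtain ⟨c, hc⟩ := GLists.mem_V.1 (h.1 hv)
      exact ⟨c, hc, hv⟩
    · rintro ⟨c, -, hv⟩; exact hv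
  refine ⟨y, by simp [y]; omega, DataGraph.ext_of ?_ ?_ fun v h1 h2 => ?_⟩
  · ext v
    rw [GLists.mem_V, hy, hV]
  · ext e
    rw [GLists.mem_E, hy, List.mem_filter, List.mem_filter]
    simp only [decide_eq_true_eq, Bool.and_eq_true, List.any_eq_true, eqb_iff]
    constructor
    · rintro ⟨⟨-, he⟩, -⟩; exact he
    · intro he
      refine ⟨⟨GLists.mem_E.1 (h.2.1 he), he⟩, ?_, ?_⟩
      · obtain ⟨c, hc⟩ := (hV _).1 (H.src_mem e he)
        exact ⟨_, hc, rfl⟩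
      · obtain ⟨c, hc⟩ := (hV _).1 (H.tgt_mem e he)
        exact ⟨_, hc, rfl⟩
  · rw [h.2.2 v h2 (h.1 h2)]
    exact (subL_subG g ⟨y⟩).sub.2.2 v h1 _

end
end GXPath

-- The common setup for all criteria, and the `Π₂ᵖ` algorithm

namespace GXPath
open Machine
open Machine.Enc (enc)

section
variable {Lab : Type u} {Val : Type v} [Coded Lab] [Coded Val] {𝓛 𝓠 : Set (Expr Lab Val)}
variable {ε : Type*} [Enc ε]

/-- Consistent query answering for the inputs `I z`, together with the information that is needed
for the algorithms. -/
structure Setup (Q : Problem) (𝓛 𝓠 : Set (Expr Lab Val)) (ε : Type*) [Enc ε] where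
  /-- the input -/
  I : CodeOf Q → Input 𝓛 𝓠
  /-- the criterion -/
  pref : CodeOf Q → Pref Lab Val
  yes : ∀ z, Q.Yes z.1.1 ↔ (I z).CertainAnswer (pref z)
  /-- the instance -/
  t : CodeOf Q → Instance Lab Val
  pf_t : PF t
  reads : ∀ z, Reads (I z) (t z)
  length_le : ∀ z, (t z).1.1.1.length + (t z).1.1.2.length ≤ (enc z).length
  /-- additional information on the criterion -/
  e : CodeOf Q → ε
  pf_e : PF e

/-- The pair of nodes is an answer to the query. -/
def answerB (t : Instance Lab Val) (H : Lists Lab Val) : Bool := memR (evalToks H t.2.2.1) t.2.2.2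

@[fun_prop] theorem PF.answerB {α : Type*} [Enc α] {t : α → Instance Lab Val} {H : α → Lists Lab Val} (ht : PF t)
    (hH : PF H) : PF fun a => answerB (t a) (H a) := by unfold GXPath.answerB; fun_prop

theorem Reads.answerB {I : Input 𝓛 𝓠} {t : Instance Lab Val} (h : Reads I t) (H : GLists Lab Val) :
    answerB t H.1 = true ↔ (I.v, I.w) ∈ pathSem H.graph I.q := by
  rw [GXPath.answerB, memR_iff, h.query, h.nodes]

variable {Q : Problem}

theorem Setup.exists_subG (S : Setup Q 𝓛 𝓠 ε) (z : CodeOf Q) {H : DataGraph Lab Val} (h : H.Sub (S.I z).G) {n : ℕ}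
    (hn : (S.t z).1.1.1.length + (S.t z).1.1.2.length ≤ n) :
    ∃ y : List Bool, y.length = n ∧ (subG (S.t z).1 ⟨y⟩).graph = H :=
  GXPath.exists_subG _ (by rwa [(S.reads z).graph]) hn

theorem Setup.sub (S : Setup Q 𝓛 𝓠 ε) (z : CodeOf Q) (y : Raw) : (subG (S.t z).1 y).graph.Sub (S.I z).G := by
  rw [← (S.reads z).graph]; exact (subL_subG _ _).sub

theorem length_le_sz_instance (t : Instance Lab Val) : t.1.1.1.length + t.1.1.2.length ≤ sz t := by
  have h1 := length_le_sz t.1.1.1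
  have h2 := length_le_sz t.1.1.2
  have h3 : sz t.1 = sz t.1.1 := rfl
  rw [sz_prod, h3, sz_prod]
  omega

/-- If the criterion can be decided in polynomial time, then CQA is in `Π₂ᵖ`. -/
theorem Setup.inPi2 (S : Setup Q 𝓛 𝓠 ε) {better : ε × GLists Lab Val × GLists Lab Val → Bool} (hb : PF better)
    (h : ∀ z H K, SubL H (S.t z).1 → SubL K (S.t z).1 →
      (better (S.e z, H, K) = true ↔ S.pref z H.graph K.graph)) : InPi2 Q := by
  -- The oracle receives the instance and `H`, and guesses a consistent `K` that is strictly better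
  -- than `H` and below `G`.
  obtain ⟨O, hO, hOiff⟩ := exists_np
    (V := fun x : ((Instance Lab Val × ε × GLists Lab Val)) × Raw =>
      consB (subG x.1.1.1 x.2).1 x.1.1.2.1 && (better (x.1.2.1, x.1.2.2, subG x.1.1.1 x.2) &&
        (!better (x.1.2.1, subG x.1.1.1 x.2, x.1.2.2) && better (x.1.2.1, subG x.1.1.1 x.2, x.1.1.1))))
    (by
      have h1 : PF fun x : ((Instance Lab Val × ε × GLists Lab Val)) × Raw => subG x.1.1.1 x.2 := by fun_prop
      exact PF.and (by fun_prop) (PF.and (hb.comp (by fun_prop)) (PF.and (PF.not (hb.comp (by fun_prop)))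
        (hb.comp (by fun_prop)))))
  have ht := S.pf_t
  have he := S.pf_e
  refine InPi2.of_exists (V := fun x => consB (subG (S.t x.1).1 x.2).1 (S.t x.1).2.1 &&
      !answerB (S.t x.1) (subG (S.t x.1).1 x.2).1)
    (F := fun x => (S.t x.1, S.e x.1, subG (S.t x.1).1 x.2)) ?_ ?_ hO fun z => ?_
  · have h1 : PF fun x : CodeOf Q × Raw => S.t x.1 := ht.comp (by fun_prop)
    fun_prop
  · have h1 : PF fun x : CodeOf Q × Raw => S.t x.1 := ht.comp (by fun_prop)
    have h2 : PF fun x : CodeOf Q × Raw => S.e x.1 := he.comp (by fun_prop)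
    fun_prop
  · have hR := S.reads z
    have key : ∀ y : List Bool, (consB (subG (S.t z).1 ⟨y⟩).1 (S.t z).2.1 &&
        !answerB (S.t z) (subG (S.t z).1 ⟨y⟩).1) = true ∧ enc (S.t z, S.e z, subG (S.t z).1 ⟨y⟩) ∉ O ↔
        IsRepair (S.pref z) (S.I z).G (S.I z).R (subG (S.t z).1 ⟨y⟩).graph ∧
          ((S.I z).v, (S.I z).w) ∉ pathSem (subG (S.t z).1 ⟨y⟩).graph (S.I z).q := by
      intro y
      have hO' : enc (S.t z, S.e z, subG (S.t z).1 ⟨y⟩) ∈ O ↔ ∃ K : DataGraph Lab Val,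
          K ≠ (subG (S.t z).1 ⟨y⟩).graph ∧ K.Sub (S.I z).G ∧ Consistent K (S.I z).R ∧
            Strict (S.pref z) (subG (S.t z).1 ⟨y⟩).graph K ∧ S.pref z K (S.I z).G := by
        rw [hOiff]
        simp only [Bool.and_eq_true, Bool.not_eq_true', Bool.eq_false_iff, Ne, hR.consistent,
          h z _ _ (subL_subG _ _) (subL_subG _ _), h z _ _ (subL_subG _ _) (SubL.refl _), hR.graph]
        constructor
        · rintro ⟨y', -, h1, h2, h3, h4⟩
          -- Strictness already forces `K ≠ H`, so the oracle does not test it.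
          refine ⟨_, fun e => ?_, S.sub z ⟨y'⟩, h1, ⟨h2, h3⟩, h4⟩
          rw [e] at h2 h3
          exact h3 h2
        · rintro ⟨K, -, h1, h2, ⟨h3, h4⟩, h5⟩
          obtain ⟨y', hy', rfl⟩ := S.exists_subG z h1
            (n := (enc (S.t z, S.e z, subG (S.t z).1 ⟨y⟩)).length)
            ((length_le_sz_instance (S.t z)).trans (by
              have := sz_pair (S.t z) (S.e z, subG (S.t z).1 ⟨y⟩)
              simp only [sz] at this ⊢
              omega))
          exact ⟨y', hy', h2, h3, h4, h5⟩
      rw [hO', IsRepair]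
      simp only [Bool.and_eq_true, Bool.not_eq_true', Bool.eq_false_iff, Ne, hR.consistent, hR.answerB]
      have := S.sub z ⟨y⟩
      tauto
    rw [S.yes]
    simp only [key]
    constructor
    · intro hn
      simp only [Input.CertainAnswer, not_forall] at hn
      obtain ⟨H, hH, hq⟩ := hn
      obtain ⟨y, hy, rfl⟩ := S.exists_subG z hH.2.1 (S.length_le z)
      exact ⟨y, hy, hH, hq⟩
    · rintro ⟨y, -, hH, hq⟩ hc
      exact hq (hc _ hH)

/-! ## Binary search -/

/-- One step of the binary search: with the digits of `M` above position `k` known, the digit at `k`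
is `1` iff `M` is at least the number with these digits, then `1`, then zeros. -/
theorem div_two_pow_succ (M k : ℕ) (b : Bool) (hb : b = true ↔ 2 ^ k * (1 + 2 * (M / 2 ^ (k + 1))) ≤ M) :
    b.toNat + 2 * (M / 2 ^ (k + 1)) = M / 2 ^ k := by
  have h1 : M / 2 ^ (k + 1) = M / 2 ^ k / 2 := by rw [pow_succ, Nat.div_div_eq_div_mul]
  rw [mul_comm, ← Nat.le_div_iff_mul_le (by positivity), h1] at hb
  rw [h1]
  cases b
  · simp only [Bool.false_eq_true, false_iff] at hb
    simp only [Bool.toNat_false]; omega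
  · simp only [true_iff] at hb
    simp only [Bool.toNat_true]; omega

/-- A list without as many members as another list has. -/
def dropBy {β : Type*} (l m : List β) : List β := m.foldl (fun s _ => s.tail) l

theorem dropBy_eq {β : Type*} (l m : List β) : dropBy l m = l.drop m.length := by
  induction m generalizing l with
  | nil => rfl
  | cons b m ih => rw [dropBy, List.foldl_cons]; exact (ih _).trans (by simp)

@[fun_prop] theorem PF.dropBy {α β : Type*} [Enc α] [Enc β] {l m : α → List β} (hl : PF l) (hm : PF m) :
    PF fun a => dropBy (l a) (m a) :=
  hm.foldl (g := l) (h := fun _ s _ => s.tail) hl (by fun_prop) (B := fun a => sz (l a)) hl.pb_sz fun a m' _ => by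
    have := dropBy_eq (l a) m'
    rw [GXPath.dropBy] at this
    rw [this]
    exact sz_sublist (List.drop_sublist _ _)

/-- The oracle's verifier: `x` consists of the instance, the additional information, an upper bound, the
previous answers and the selected part. As long as the leading digits of the maximal value are not known,
the question is whether the next digit can be `1`; afterwards, it is whether some optimal part is a
counterexample. -/
def verify (val : ε × GLists Lab Val → List Bool)
    (x : ((Instance Lab Val × ε × List Bool) × Raw) × Raw) : Bool :=
  let H := subG x.1.1.1.1 x.2
  let r := dropBy x.1.1.2.2 x.1.2.bits
  consB H.1 x.1.1.1.2.1 && if r.isEmpty then leBits x.1.2.bits (val (x.1.1.2.1, H)) && !answerB x.1.1.1 H.1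
    else leBits ((r.tail.map fun _ => false) ++ true :: x.1.2.bits) (val (x.1.1.2.1, H))

theorem PF.verify {val : ε × GLists Lab Val → List Bool} (hv : PF val) : PF (verify val) := by
  have h1 : PF fun x : ((Instance Lab Val × ε × List Bool) × Raw) × Raw => val (x.1.1.2.1, GXPath.subG x.1.1.1.1 x.2) :=
    hv.comp (by fun_prop)
  unfold GXPath.verify
  fun_prop

/-- Constraints quantify over nodes, so the empty graph satisfies them all; hence there is a maximal
value to search for. -/
theorem empty_sub (G : DataGraph Lab Val) (R : Finset (Expr Lab Val)) :
    ∃ H : DataGraph Lab Val, H.Sub G ∧ Consistent H R :=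
  ⟨⟨∅, ∅, by simp, by simp, fun v hv => absurd hv (by simp)⟩, ⟨by simp, by simp, fun v hv => absurd hv (by simp)⟩,
    fun _ _ v hv => absurd hv (by simp), fun _ _ v hv => absurd hv (by simp)⟩

/-- A criterion that is given by a value in binary. -/
structure Setup.Valued (S : Setup Q 𝓛 𝓠 ε) (val : ε × GLists Lab Val → List Bool) : Prop where
  pf : PF val
  le_iff : ∀ z H K, SubL H (S.t z).1 → SubL K (S.t z).1 →
    (S.pref z H.graph K.graph ↔ bitsVal (val (S.e z, H)) ≤ bitsVal (val (S.e z, K)))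
  mono : ∀ z H, SubL H (S.t z).1 → bitsVal (val (S.e z, H)) ≤ bitsVal (val (S.e z, (S.t z).1))

theorem Setup.Valued.exists_answers {S : Setup Q 𝓛 𝓠 ε} {val : ε × GLists Lab Val → List Bool}
    (hS : S.Valued val) : ∃ (F : CodeOf Q → Instance Lab Val × ε × List Bool) (W : CodeOf Q → List Bool)
      (O : Language Bool), PF F ∧ PF W ∧ NP O ∧ (∀ z, W z = trim (val (S.e z, (S.t z).1))) ∧
      ∀ z : CodeOf Q, Q.Yes z.1.1 ↔ (answers O (enc (F z)) ((W z).length + 1)).head? = some false := by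
  obtain ⟨O, hO, hOiff⟩ := exists_np (PF.verify hS.pf)
  let W : CodeOf Q → List Bool := fun z => trim (val (S.e z, (S.t z).1))
  have hW : PF W := PF.trim (hS.pf.comp (S.pf_e.mk S.pf_t.fst))
  refine ⟨fun z => (S.t z, S.e z, W z), W, O, S.pf_t.mk (S.pf_e.mk hW), hW, hO, fun _ => rfl, fun z => ?_⟩
  have hR := S.reads z
  set t := S.t z
  set e := S.e z
  set x := enc (t, e, W z)
  let f : List Bool → ℕ := fun y => bitsVal (val (e, subG t.1 ⟨y⟩))
  let C : List Bool → Prop := fun y => consB (subG t.1 ⟨y⟩).1 t.2.1 = true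
  -- `G` has the largest value, so the number of its digits is enough for all subgraphs; this fixes
  -- the number of search steps.
  have hfW : ∀ y, f y < 2 ^ (W z).length := fun y =>
    (hS.mono z _ (subL_subG _ _)).trans_lt (by rw [← bitsVal_trim]; exact bitsVal_lt _)
  have hlen : ∀ a : List Bool, t.1.1.1.length + t.1.1.2.length ≤ (encStr x ++ a).length := fun a =>
    (length_le_sz_instance t).trans (by
      have := sz_pair t (e, W z)
      simp only [sz] at this
      simp only [sz, List.length_append, length_encStr, x]
      omega)
  have hq : ∀ a : List Bool, encStr x ++ a ∈ O ↔ ∃ y : List Bool, C y ∧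
      if a.length < (W z).length then 2 ^ ((W z).length - a.length - 1) * (1 + 2 * bitsVal a) ≤ f y
        else bitsVal a ≤ f y ∧ ((S.I z).v, (S.I z).w) ∉ pathSem (subG t.1 ⟨y⟩).graph (S.I z).q := by
    intro a
    have hv : ∀ y, verify val (((t, e, W z), ⟨a⟩), ⟨y⟩) = true ↔ C y ∧
        if a.length < (W z).length then 2 ^ ((W z).length - a.length - 1) * (1 + 2 * bitsVal a) ≤ f y
        else bitsVal a ≤ f y ∧ ((S.I z).v, (S.I z).w) ∉ pathSem (subG t.1 ⟨y⟩).graph (S.I z).q := by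
      intro y
      rw [verify, Bool.and_eq_true]
      refine and_congr Iff.rfl ?_
      simp only [dropBy_eq]
      by_cases ha : a.length < (W z).length
      · rw [if_pos ha, if_neg (by simpa using ha), leBits_iff, bitsVal_append, List.length_map, List.length_tail,
          List.length_drop, bitsVal_cons]
        have : ∀ l : List Bool, bitsVal (l.map fun _ => false) = 0 := by
          intro l; induction l <;> simp_all
        rw [this, zero_add]
        rfl
      · rw [if_neg ha, if_pos (by simpa using ha), Bool.and_eq_true, leBits_iff, Bool.not_eq_true',
          Bool.eq_false_iff, Ne, hR.answerB]
    have hO' := hOiff ((t, e, W z), ⟨a⟩)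
    simp only [hv] at hO'
    rw [show encStr x ++ a = enc ((t, e, W z), (⟨a⟩ : Raw)) from rfl, hO']
    constructor
    · rintro ⟨y, -, h⟩; exact ⟨y, h⟩
    · rintro ⟨y, h⟩
      obtain ⟨y', hy', h'⟩ := S.exists_subG z (S.sub z ⟨y⟩) (hlen a)
      refine ⟨y', hy', ?_⟩
      -- `y` and `y'` select the same graph but may differ as strings. Their values agree because
      -- `le_iff` expresses the order of values through the graphs alone.
      have hf : f y' = f y := le_antisymm
        ((hS.le_iff z _ _ (subL_subG _ _) (subL_subG _ _)).1 (by
          rw [h', hS.le_iff z _ _ (subL_subG _ _) (subL_subG _ _)]))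
        ((hS.le_iff z _ _ (subL_subG _ _) (subL_subG _ _)).1 (by
          rw [h', hS.le_iff z _ _ (subL_subG _ _) (subL_subG _ _)]))
      have hC : C y' ↔ C y := by simp only [C, hR.consistent]; rw [h']
      rw [hC, hf, h']
      exact h
  -- A maximum of `f` is a minimum of `2 ^ (W z).length - f y`, where the subtraction does not
  -- truncate by `hfW`.
  obtain ⟨y₀, hy₀, hmax⟩ : ∃ y₀, C y₀ ∧ ∀ y, C y → f y ≤ f y₀ := by
    have hne : ∃ n, ∃ y, C y ∧ 2 ^ (W z).length - f y = n := by
      obtain ⟨H, hH, hc⟩ := empty_sub (S.I z).G (S.I z).R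
      obtain ⟨y, -, rfl⟩ := S.exists_subG z hH le_rfl
      exact ⟨_, y, (hR.consistent _).2 hc, rfl⟩
    classical
    obtain ⟨y₀, h1, h2⟩ := Nat.find_spec hne
    refine ⟨y₀, h1, fun y hy => ?_⟩
    have := Nat.find_min' hne ⟨y, hy, rfl⟩
    have := hfW y
    omega
  -- The latest answer comes first in `answers`, just as the lowest digit comes first in `bitsVal`,
  -- so the answers are literally the leading digits of the maximum.
  have hbin : ∀ n ≤ (W z).length, bitsVal (answers O x n) = f y₀ / 2 ^ ((W z).length - n) := by
    intro n
    induction n with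
    | zero => intro _; rw [Nat.sub_zero, Nat.div_eq_of_lt (hfW _)]; rfl
    | succ n ih =>
      intro hn
      have ih := ih (by omega)
      rw [answers, bitsVal_cons, ih]
      obtain ⟨k, hk⟩ := Nat.exists_eq_add_of_le' hn
      rw [show (W z).length - n = k + 1 by omega, show (W z).length - (n + 1) = k by omega]
      refine div_two_pow_succ _ _ _ ?_
      simp only [decide_eq_true_eq]
      rw [hq, length_answers]
      simp only [show n < (W z).length by omega, if_true, ih]
      rw [show (W z).length - n - 1 = k by omega, show (W z).length - n = k + 1 by omega]
      exact ⟨fun ⟨y, h1, h2⟩ => h2.trans (hmax y h1), fun h => ⟨y₀, hy₀, h⟩⟩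
  have hfin := hbin _ le_rfl
  rw [Nat.sub_self, pow_zero, Nat.div_one] at hfin
  rw [S.yes, answers, List.head?_cons, Option.some.injEq, decide_eq_false_iff_not, hq, length_answers]
  simp only [lt_irrefl, if_false, hfin]
  -- Repairs are the consistent subgraphs of maximal value. The condition `K ≼ G` excludes nothing,
  -- by `mono`.
  have hrep : ∀ y, IsRepair (S.pref z) (S.I z).G (S.I z).R (subG t.1 ⟨y⟩).graph ↔ C y ∧ f y₀ ≤ f y := by
    intro y
    have hC : C y ↔ Consistent (subG t.1 ⟨y⟩).graph (S.I z).R := hR.consistent _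
    rw [IsRepair, ← hC]
    constructor
    · rintro ⟨h1, -, h2⟩
      refine ⟨h1, ?_⟩
      by_contra hlt
      have hlt' : ¬ S.pref z (subG t.1 ⟨y₀⟩).graph (subG t.1 ⟨y⟩).graph := by
        rwa [hS.le_iff z _ _ (subL_subG _ _) (subL_subG _ _)]
      have hle : S.pref z (subG t.1 ⟨y⟩).graph (subG t.1 ⟨y₀⟩).graph := by
        rw [hS.le_iff z _ _ (subL_subG _ _) (subL_subG _ _)]
        exact hmax y h1
      refine h2 ⟨_, fun h => ?_, S.sub z ⟨y₀⟩, (hR.consistent _).1 hy₀, ⟨hle, hlt'⟩, ?_⟩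
      · rw [h] at hlt' hle; exact hlt' hle
      · rw [← hR.graph, hS.le_iff z _ _ (subL_subG _ _) (SubL.refl _)]
        exact hS.mono z _ (subL_subG _ _)
    · rintro ⟨h1, h2⟩
      refine ⟨h1, S.sub z ⟨y⟩, ?_⟩
      rintro ⟨K, -, h3, h4, ⟨-, h5⟩, -⟩
      obtain ⟨y', -, rfl⟩ := S.exists_subG z h3 le_rfl
      rw [hS.le_iff z _ _ (subL_subG _ _) (subL_subG _ _)] at h5
      exact h5 ((hmax y' ((hR.consistent _).2 h4)).trans h2)
  constructor
  · rintro hc ⟨y, h1, h2, h3⟩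
    exact h3 (hc _ ((hrep y).2 ⟨h1, h2⟩))
  · intro h H hH
    obtain ⟨y, -, rfl⟩ := S.exists_subG z hH.2.1 le_rfl
    by_contra hn
    exact h ⟨y, ((hrep y).1 hH).1, ((hrep y).1 hH).2, hn⟩

theorem Setup.Valued.inDelta2 {S : Setup Q 𝓛 𝓠 ε} {val : ε × GLists Lab Val → List Bool}
    (hS : S.Valued val) : InDelta2 Q := by
  obtain ⟨F, W, O, hF, hW, hO, -, h⟩ := hS.exists_answers
  exact .of_answers hF hW hO h

/-- With a value of at most `n`, there are at most `log n + 1` digits, and the final query makes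
`log n + 2`, which is at most twice `log n + 1`. -/
theorem Setup.Valued.inDelta2Log {S : Setup Q 𝓛 𝓠 ε} {val : ε × GLists Lab Val → List Bool}
    (hS : S.Valued val) (hlog : ∀ z, bitsVal (val (S.e z, (S.t z).1)) ≤ (enc z).length) : InDelta2Log Q := by
  obtain ⟨F, W, O, hF, hW, hO, hWeq, h⟩ := hS.exists_answers
  refine .of_answers hF hW hO h 2 fun z => ?_
  by_cases hz : W z = []
  · rw [hz, List.length_nil]; omega
  · have h1 := hz
    rw [hWeq] at h1
    have h2 := pow_le_bitsVal_trim _ h1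
    rw [bitsVal_trim, ← hWeq] at h2
    have h3 := Nat.le_log_of_pow_le (by norm_num : 1 < 2) (h2.trans (hlog z))
    omega

end
end GXPath

namespace GXPath
open Machine
open Machine.Enc (enc)

section
variable {Lab : Type u} {Val : Type v} [Coded Lab] [Coded Val] {𝓛 𝓠 : Set (Expr Lab Val)}

/-! ## The algorithms for the criteria -/

/-- The setup for a criterion that is not part of the input. -/
noncomputable def cqaSetup (𝓛 𝓠 : Set (Expr Lab Val)) (pref : Pref Lab Val) : Setup (cqa 𝓛 𝓠 pref) 𝓛 𝓠 Bool where
  I z := z.1.1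
  pref _ := pref
  yes _ := Iff.rfl
  t z := (exists_reads z.2).choose
  -- `t` is obtained by choice, but being in `PF` concerns codes only, and its code is the output of
  -- the parser.
  pf_t := PF.readInput.fst.cast (fun z => ⟨z.1.2⟩) (fun _ => rfl) fun z => by
    have := ((exists_reads z.2).choose_spec.2.2 []).1
    rwa [List.append_nil] at this
  reads z := (exists_reads z.2).choose_spec.1
  length_le z := (exists_reads z.2).choose_spec.2.1
  e _ := true
  pf_e := .const _

/-- The lists of facts describe the priority levels. -/
def Levels (ls : List (List FactR)) (P : List (Finset (Fact Lab))) : Prop :=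
  List.Forall₂ (fun l A => ∃ l' : List (Fact Lab), Enumerates l' A ∧ l = l'.map factR) ls P

theorem exists_levels {P : List (Finset (Fact Lab))} {z : List Bool} (h : CodesPrioritization P z) :
    Levels (readList (readList readFact) ⟨z⟩).1 P := by
  obtain ⟨ls, h, rfl⟩ := h
  have h1 := readList_encList (readList_encList (f := factR) (readFact_enc (Lab := Lab))) ls []
  rw [List.append_nil] at h1
  rw [h1, Levels, List.forall₂_map_left_iff]
  exact h.imp fun l A hl => ⟨l, hl, rfl⟩

/-- The setup for a criterion that depends on a prioritization. -/
noncomputable def cqaPrioSetup (𝓛 𝓠 : Set (Expr Lab Val)) (pref : List (Finset (Fact Lab)) → Pref Lab Val) :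
    Setup (cqaPrio 𝓛 𝓠 pref) 𝓛 𝓠 (List (List FactR)) where
  I z := z.1.1.toInput
  pref z := pref z.1.1.P
  yes _ := Iff.rfl
  t z := (exists_reads z.2.choose_spec.choose_spec.1).choose
  pf_t := PF.readInput.fst.cast (fun z => ⟨z.1.2⟩) (fun _ => rfl) fun z => by
    have h := z.2.choose_spec.choose_spec
    exact (congrArg (fun x => enc (readInput ⟨x⟩).1) h.2.2).trans ((exists_reads h.1).choose_spec.2.2 _).1
  reads z := (exists_reads z.2.choose_spec.choose_spec.1).choose_spec.1
  length_le z := by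
    have h := z.2.choose_spec.choose_spec
    have h1 := (exists_reads h.1).choose_spec.2.1
    have h2 := congrArg List.length h.2.2
    rw [List.length_append] at h2
    rw [enc_codeOf]
    omega
  e z := (readList (readList readFact) (readInput ⟨z.1.2⟩).2).1
  pf_e := by
    have h : PF fun r : Raw => (readList (readList readFact) (readInput r).2).1 :=
      PF.fst (PF.comp (PF.readList (PF.readList PF.readFact sz_readFact) (sz_readList sz_readFact)) PF.readInput.snd)
    exact h.cast (fun z => ⟨z.1.2⟩) (fun _ => rfl) fun _ => rfl

theorem cqaPrioSetup_levels {pref : List (Finset (Fact Lab)) → Pref Lab Val} (z : CodeOf (cqaPrio 𝓛 𝓠 pref)) :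
    Levels ((cqaPrioSetup 𝓛 𝓠 pref).e z) z.1.1.P := by
  have h := z.2.choose_spec.choose_spec
  have h1 := ((exists_reads h.1).choose_spec.2.2 z.2.choose_spec.choose).2
  rw [← h.2.2] at h1
  simp only [cqaPrioSetup, h1]
  exact exists_levels h.2.1

/-! ### Multisets -/

/-- The code of a pair of data-graphs. -/
noncomputable def pairCode (pref : Pref Lab Val) (p : GLists Lab Val × GLists Lab Val) : CodeOf (comparison pref) :=
  ⟨((p.1.graph, p.2.graph), codeLists p.1.1 ++ codeLists p.2.1), _, _, codes_graph p.1, codes_graph p.2, rfl⟩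

theorem PF.pairCode (pref : Pref Lab Val) : PF (pairCode pref) := by
  have h1 : PF fun p : GLists Lab Val × GLists Lab Val => GXPath.codeLists p.1.1 := PF.codeLists.comp (by fun_prop)
  have h2 : PF fun p : GLists Lab Val × GLists Lab Val => GXPath.codeLists p.2.1 := PF.codeLists.comp (by fun_prop)
  exact (PF.rawMk (h1.append h2)).cast (fun p => p) (fun _ => rfl) fun _ => rfl

/-- The two subgraphs are written out again in the input format of the comparison problem, to which
the assumed algorithm is then applied. -/
theorem inPi2_of_comparison {pref : Pref Lab Val} (h : InP (comparison pref)) : InPi2 (cqa 𝓛 𝓠 pref) := by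
  classical
  refine (cqaSetup 𝓛 𝓠 pref).inPi2 (h.pf.comp ((PF.pairCode pref).comp PF.id.snd)) fun z H K _ _ => ?_
  rw [decide_eq_true_eq]
  rfl

/-! ### Cardinality and weights -/

theorem sum_toFinset_data (g : GLists Lab Val) (w : Val → ℕ) :
    ∑ v : g.graph.V, w (g.graph.D v v.2) = (g.1.1.map fun p => w p.2).sum := by
  classical
  let F : ℕ → ℕ := fun v => if h : v ∈ g.graph.V then w (g.graph.D v h) else 0
  have hV : g.graph.V = (g.1.1.map Prod.fst).toFinset := by
    ext v; rw [GLists.mem_V]; simp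
  have h1 : ∑ v : g.graph.V, w (g.graph.D v v.2) = ∑ v ∈ g.graph.V, F v := by
    rw [← Finset.sum_coe_sort g.graph.V F]
    exact Finset.sum_congr rfl fun v _ => by rw [show F v = w (g.graph.D v v.2) from dif_pos v.2]
  rw [h1, hV, List.sum_toFinset _ g.2.1, List.map_map]
  congr 1
  refine List.map_congr_left fun p hp => ?_
  have h : p.1 ∈ g.graph.V := GLists.mem_V.2 ⟨p.2, hp⟩
  simp only [Function.comp_apply, F, dif_pos h]
  rw [g.D_eq hp h]

theorem sum_edges (g : GLists Lab Val) (w : Lab → ℕ) :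
    ∑ e ∈ g.graph.E, w e.2.1 = (g.1.2.map fun e => w e.2.1).sum := by
  classical
  have hE : g.graph.E = g.1.2.toFinset := by
    ext e; rw [GLists.mem_E]; simp
  rw [hE, List.sum_toFinset _ g.2.2.1]

/-- The weight in binary. -/
def weightBits (w : Lab ⊕ Val → ℕ) (g : Lists Lab Val) : List Bool :=
  sumBits ((g.1.map fun p => (w (.inr p.2)).bits) ++ g.2.map fun e => (w (.inl e.2.1)).bits)

theorem PF.weightBits {w : Lab ⊕ Val → ℕ} (hw : PF w) : PF (weightBits w) := by
  have h1 : PF fun c : Val => (Sum.inr c : Lab ⊕ Val) :=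
    (PF.rawCons.comp ((PF.const true).mk .id)).cast (fun c => toRaw c) (fun _ => rfl) fun _ => rfl
  have h2 : PF fun a : Lab => (Sum.inl a : Lab ⊕ Val) :=
    (PF.rawCons.comp ((PF.const false).mk .id)).cast (fun c => toRaw c) (fun _ => rfl) fun _ => rfl
  have h3 : PF fun p : ℕ × Val => (w (.inr p.2)).bits := PF.code (hw.comp (h1.comp (by fun_prop)))
  have h4 : PF fun e : ℕ × Lab × ℕ => (w (.inl e.2.1)).bits := PF.code (hw.comp (h2.comp (by fun_prop)))
  exact PF.sumBits (PF.append (PF.map (by fun_prop) (h3.comp (by fun_prop)))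
    (PF.map (by fun_prop) (h4.comp (by fun_prop))))

theorem bitsVal_weightBits (w : Lab ⊕ Val → ℕ) (g : Lists Lab Val) : bitsVal (weightBits w g) =
    (g.1.map fun p => w (.inr p.2)).sum + (g.2.map fun e => w (.inl e.2.1)).sum := by
  rw [weightBits, bitsVal_sumBits, List.map_append, List.sum_append, List.map_map, List.map_map]
  simp only [Function.comp_def, bitsVal_bits]

theorem weight_graph (w : Lab ⊕ Val → ℕ) (g : GLists Lab Val) : g.graph.weight w = bitsVal (weightBits w g.1) := by
  rw [bitsVal_weightBits, DataGraph.weight, sum_toFinset_data g fun c => w (.inr c), sum_edges g fun a => w (.inl a)]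

theorem SubL.weight_le {H G : GLists Lab Val} (h : SubL H G) (w : Lab ⊕ Val → ℕ) :
    bitsVal (weightBits w H.1) ≤ bitsVal (weightBits w G.1) := by
  rw [bitsVal_weightBits, bitsVal_weightBits]
  exact add_le_add ((h.1.map _).sum_le_sum fun _ _ => Nat.zero_le _) ((h.2.map _).sum_le_sum fun _ _ => Nat.zero_le _)

theorem weights_valued {w : Lab ⊕ Val → ℕ} (hw : PF w) :
    (cqaSetup 𝓛 𝓠 (weights w)).Valued fun x => weightBits w x.2.1 where
  pf := (PF.weightBits hw).comp (by fun_prop)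
  le_iff _ H K _ _ := by
    change H.graph.weight w ≤ K.graph.weight w ↔ _
    rw [weight_graph, weight_graph]
  mono _ _ h := h.weight_le w

/-- Cardinality needs no algorithm of its own, only a better bound on the number of queries. -/
theorem cardinality_eq : (cardinality : Pref Lab Val) = weights fun _ => 1 := by
  funext G G'
  simp [cardinality, weights, DataGraph.size, DataGraph.weight]

/-! ### Priority levels -/

/-- The lexicographic preference given by a strict and a weak preference on levels. -/
def LexPref {A : Type*} (lt eq : A → Prop) (P : List A) : Prop :=
  (∀ i : Fin P.length, eq (P.get i)) ∨ ∃ i : Fin P.length, lt (P.get i) ∧ ∀ j < i, eq (P.get j)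

theorem lexPref_nil {A : Type*} (lt eq : A → Prop) : LexPref lt eq [] := .inl fun i => i.elim0

theorem lexPref_cons {A : Type*} {lt eq : A → Prop} {a : A} {P : List A} :
    LexPref lt eq (a :: P) ↔ lt a ∨ (eq a ∧ LexPref lt eq P) := by
  have h1 : (∀ i : Fin (a :: P).length, eq ((a :: P).get i)) ↔ eq a ∧ ∀ i : Fin P.length, eq (P.get i) :=
    Fin.forall_fin_succ
  have h2 : ∀ i : Fin (a :: P).length, (∀ j < i, eq ((a :: P).get j)) ↔
      ((0 : Fin (P.length + 1)) < i → eq a) ∧ ∀ j : Fin P.length, j.succ < i → eq (P.get j) :=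
    fun i => Fin.forall_fin_succ
  have h3 : (∃ i : Fin (a :: P).length, lt ((a :: P).get i) ∧ ∀ j < i, eq ((a :: P).get j)) ↔
      lt a ∨ (eq a ∧ ∃ i : Fin P.length, lt (P.get i) ∧ ∀ j < i, eq (P.get j)) := by
    simp only [h2]
    refine Fin.exists_fin_succ.trans (or_congr ?_ ?_)
    · simp
    · simp only [Fin.succ_pos, true_imp_iff, Fin.succ_lt_succ_iff]
      constructor
      · rintro ⟨i, h, h', h''⟩; exact ⟨h', i, h, h''⟩
      · rintro ⟨h', i, h, h''⟩; exact ⟨i, h, h', h''⟩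
  rw [LexPref, LexPref, h1, h3]
  tauto

@[fun_prop] theorem PF.edgeR {α : Type*} [Enc α] {e : α → ℕ × Lab × ℕ} (he : PF e) : PF fun a => edgeR (e a) := by
  unfold GXPath.edgeR; fun_prop

theorem edgeR_injective : Function.Injective (edgeR (Lab := Lab)) := fun e e' h =>
  LawfulEnc.inj ((enc_edgeR e).symm.trans ((congrArg enc h).trans (enc_edgeR e')))

/-- The data-graph contains the fact. -/
def hasFact (g : Lists Lab Val) (f : FactR) : Bool :=
  if f.1 then g.2.any fun e => eqb (edgeR e) f.2 else g.1.any fun p => eqb (toRaw p.1) f.2.1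

@[fun_prop] theorem PF.hasFact {α : Type*} [Enc α] {g : α → Lists Lab Val} {f : α → FactR} (hg : PF g) (hf : PF f) :
    PF fun a => hasFact (g a) (f a) := by unfold GXPath.hasFact; fun_prop

theorem hasFact_iff (g : GLists Lab Val) (f : Fact Lab) : hasFact g.1 (factR f) = true ↔ f ∈ g.graph.facts := by
  rcases f with v | e
  · simp only [hasFact, factR, DataGraph.facts, Finset.inl_mem_disjSum, GLists.mem_V]
    simp only [Bool.false_eq_true, if_false, List.any_eq_true, eqb_iff]
    constructor
    · rintro ⟨p, hp, h⟩
      have : p.1 = v := LawfulEnc.inj (congrArg Raw.bits h)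
      exact ⟨p.2, this ▸ hp⟩
    · rintro ⟨c, hc⟩; exact ⟨_, hc, rfl⟩
  · simp only [hasFact, factR, DataGraph.facts, Finset.inr_mem_disjSum, GLists.mem_E, if_true, List.any_eq_true,
      eqb_iff]
    constructor
    · rintro ⟨e', he, h⟩; exact edgeR_injective h ▸ he
    · intro h; exact ⟨e, h, rfl⟩

theorem SubL.hasFact {H G : GLists Lab Val} (h : SubL H G) {f : FactR} (hf : hasFact H.1 f = true) :
    hasFact G.1 f = true := by
  simp only [GXPath.hasFact] at hf ⊢
  split_ifs at hf ⊢
  · simp only [List.any_eq_true] at hf ⊢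
    obtain ⟨e, he, h'⟩ := hf
    exact ⟨e, h.2.subset he, h'⟩
  · simp only [List.any_eq_true] at hf ⊢
    obtain ⟨e, he, h'⟩ := hf
    exact ⟨e, h.1.subset he, h'⟩

/-- Inclusion on a priority level. -/
def levelLe (H K : Lists Lab Val) (l : List FactR) : Bool := l.all fun f => !hasFact H f || hasFact K f

theorem levelLe_iff (H K : GLists Lab Val) {A : Finset (Fact Lab)} {l : List (Fact Lab)} (h : Enumerates l A) :
    levelLe H.1 K.1 (l.map factR) = true ↔ H.graph.factsIn A ⊆ K.graph.factsIn A := by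
  simp only [levelLe, List.all_map, List.all_eq_true, Function.comp_apply, Bool.or_eq_true, Bool.not_eq_true',
    Bool.eq_false_iff, Ne, hasFact_iff, h.mem]
  constructor
  · rintro h f ⟨h1, h2⟩
    exact ⟨(h f h2).resolve_left (not_not.2 h1), h2⟩
  · intro h f hf
    by_cases h1 : f ∈ H.graph.facts
    · exact .inr (h ⟨h1, hf⟩).1
    · exact .inl h1

/-- Prioritized inclusion. -/
def prioInclusionB (x : List (List FactR) × GLists Lab Val × GLists Lab Val) : Bool :=
  x.1.reverse.foldl (fun b l => (levelLe x.2.1.1 x.2.2.1 l && !levelLe x.2.2.1 x.2.1.1 l) ||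
    (levelLe x.2.1.1 x.2.2.1 l && levelLe x.2.2.1 x.2.1.1 l) && b) true

theorem PF.prioInclusionB : PF (prioInclusionB (Lab := Lab) (Val := Val)) := by
  unfold GXPath.prioInclusionB levelLe
  exact PF.foldl_fin (by fun_prop) (by fun_prop) (by fun_prop)

/-- By `lexPref_cons` the verdict on the remaining levels matters only when the current one ties.
Hence the fold goes from the last level to the first, starting with `true` for no levels. -/
theorem prioInclusionB_iff {ls : List (List FactR)} {P : List (Finset (Fact Lab))} (h : Levels ls P)
    (H K : GLists Lab Val) : prioInclusionB (ls, H, K) = true ↔ prioInclusion P H.graph K.graph := by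
  change _ ↔ LexPref (fun A => H.graph.factsIn A ⊂ K.graph.factsIn A)
    (fun A => H.graph.factsIn A = K.graph.factsIn A) P
  simp only [prioInclusionB, List.foldl_reverse]
  induction h with
  | nil => simp [lexPref_nil]
  | cons h _ ih =>
    obtain ⟨l', h, rfl⟩ := h
    rw [lexPref_cons, ← ih, List.foldr_cons, Bool.or_eq_true, Bool.and_eq_true, Bool.and_eq_true, Bool.and_eq_true,
      Bool.not_eq_true', Bool.eq_false_iff, Ne, levelLe_iff _ _ h, levelLe_iff _ _ h, ssubset_iff_subset_not_subset,
      Set.Subset.antisymm_iff]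

/-- The number of facts on a priority level, in unary, with a fixed number of digits. -/
def levelDigits (g : Lists Lab Val) (l : List FactR) : List Bool :=
  ((l.filter fun f => hasFact g f).map fun _ => true) ++ (l.filter fun f => !hasFact g f).map fun _ => false

theorem length_levelDigits (g : Lists Lab Val) (l : List FactR) : (levelDigits g l).length = l.length := by
  rw [levelDigits, List.length_append, List.length_map, List.length_map]
  induction l with
  | nil => rfl
  | cons f l ih => by_cases h : hasFact g f <;> simp [h] at ih ⊢ <;> omega

/-- With the lowest digit first, `k` ones followed by zeros have the value `2^k - 1`. It is strictly
increasing in `k`, so blocks compare like cardinalities and no counting is required. -/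
theorem bitsVal_levelDigits (g : Lists Lab Val) (l : List FactR) :
    bitsVal (levelDigits g l) + 1 = 2 ^ (l.filter fun f => hasFact g f).length := by
  have h0 : ∀ l : List FactR, bitsVal (l.map fun _ => false) = 0 := by
    intro l; induction l <;> simp_all
  have h1 : ∀ l : List FactR, bitsVal (l.map fun _ => true) + 1 = 2 ^ l.length := by
    intro l
    induction l with
    | nil => rfl
    | cons f l ih =>
      simp only [List.map_cons, bitsVal_cons, List.length_cons, pow_succ, Bool.toNat_true]; omega
  rw [levelDigits, bitsVal_append, h0, mul_zero, add_zero, h1]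

theorem ncard_factsIn (g : GLists Lab Val) {A : Finset (Fact Lab)} {l : List (Fact Lab)} (h : Enumerates l A) :
    (g.graph.factsIn A).ncard = ((l.map factR).filter fun f => hasFact g.1 f).length := by
  classical
  have : g.graph.factsIn A = ↑(l.filter fun f => hasFact g.1 (factR f)).toFinset := by
    ext f
    simp only [DataGraph.factsIn, Set.mem_ofPred_eq, List.coe_toFinset, List.mem_filter, hasFact_iff, h.mem]
    exact and_comm
  rw [this, Set.ncard_coe_finset, List.toFinset_card_of_nodup (h.nodup.filter _), List.filter_map, List.length_map]
  rfl

/-- The numbers of facts on the priority levels, the last level first. -/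
def prioDigits (x : List (List FactR) × GLists Lab Val) : List Bool := x.1.reverse.flatMap fun l => levelDigits x.2.1 l

theorem PF.prioDigits : PF (prioDigits (Lab := Lab) (Val := Val)) := by
  unfold GXPath.prioDigits levelDigits
  fun_prop

theorem prioDigits_cons (l : List FactR) (ls : List (List FactR)) (g : GLists Lab Val) :
    prioDigits (l :: ls, g) = prioDigits (ls, g) ++ levelDigits g.1 l := by
  simp [prioDigits]

/-- The width of a block depends on the level and not on the subgraph; this is what makes comparison
of the concatenated blocks lexicographic. -/
theorem length_prioDigits (ls : List (List FactR)) (H K : GLists Lab Val) :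
    (prioDigits (ls, H)).length = (prioDigits (ls, K)).length := by
  induction ls with
  | nil => rfl
  | cons l ls ih => rw [prioDigits_cons, prioDigits_cons, List.length_append, List.length_append, ih,
      length_levelDigits, length_levelDigits]

/-- Comparison in base `N`: the high digits decide unless they are equal. Here the high part is the
first priority level and the low part all later ones. -/
theorem add_mul_le_iff {N x y c d : ℕ} (hx : x < N) (hy : y < N) :
    x + N * c ≤ y + N * d ↔ c < d ∨ (c = d ∧ x ≤ y) := by
  rcases lt_trichotomy c d with h | rfl | h
  · have := Nat.mul_le_mul_left N h
    rw [Nat.mul_succ] at this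
    simp only [h, true_or, iff_true]; omega
  · simp
  · have := Nat.mul_le_mul_left N h
    rw [Nat.mul_succ] at this
    simp only [h.not_gt, h.ne', false_and, or_false, iff_false]; omega

theorem prioDigits_le_iff {ls : List (List FactR)} {P : List (Finset (Fact Lab))} (h : Levels ls P)
    (H K : GLists Lab Val) :
    prioCardinality P H.graph K.graph ↔ bitsVal (prioDigits (ls, H)) ≤ bitsVal (prioDigits (ls, K)) := by
  change LexPref (fun A => (H.graph.factsIn A).ncard < (K.graph.factsIn A).ncard)
    (fun A => (H.graph.factsIn A).ncard = (K.graph.factsIn A).ncard) P ↔ _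
  induction h with
  | nil => simp [lexPref_nil, prioDigits]
  | @cons l A ls P h _ ih =>
    obtain ⟨l', h, rfl⟩ := h
    have h1 := bitsVal_levelDigits H.1 (l'.map factR)
    have h2 := bitsVal_levelDigits K.1 (l'.map factR)
    have hlt := bitsVal_lt (prioDigits (ls, H))
    have hlt' := bitsVal_lt (prioDigits (ls, K))
    rw [length_prioDigits ls H K] at hlt
    rw [lexPref_cons, ih, prioDigits_cons, prioDigits_cons, bitsVal_append, bitsVal_append, length_prioDigits ls H K,
      add_mul_le_iff hlt hlt', ncard_factsIn H h, ncard_factsIn K h]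
    have h3 := Nat.pow_lt_pow_iff_right (a := 2) (by norm_num)
      (n := ((l'.map factR).filter fun f => hasFact H.1 f).length)
      (m := ((l'.map factR).filter fun f => hasFact K.1 f).length)
    have h4 := (Nat.pow_right_injective (le_refl 2)).eq_iff
      (a := ((l'.map factR).filter fun f => hasFact H.1 f).length)
      (b := ((l'.map factR).filter fun f => hasFact K.1 f).length)
    -- Comparisons of the cardinalities become comparisons of powers of two, and thus of the block
    -- values increased by one.
    rw [← h1, ← h2] at h3 h4
    rw [← h3, ← h4]
    simp

theorem SubL.prioDigits_le {H G : GLists Lab Val} (h : SubL H G) (ls : List (List FactR)) :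
    bitsVal (prioDigits (ls, H)) ≤ bitsVal (prioDigits (ls, G)) := by
  induction ls with
  | nil => rfl
  | cons l ls ih =>
    rw [prioDigits_cons, prioDigits_cons, bitsVal_append, bitsVal_append, length_prioDigits ls H G]
    refine add_le_add ih (Nat.mul_le_mul_left _ ?_)
    have h1 := bitsVal_levelDigits H.1 l
    have h2 := bitsVal_levelDigits G.1 l
    have h3 := Nat.pow_le_pow_right (n := 2) (by norm_num)
      (List.monotone_filter_right l (p := fun f => GXPath.hasFact H.1 f) (q := fun f => GXPath.hasFact G.1 f)
        fun f hf => h.hasFact hf).length_le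
    omega

theorem prioCardinality_valued :
    (cqaPrioSetup 𝓛 𝓠 (prioCardinality (Val := Val))).Valued prioDigits where
  pf := PF.prioDigits
  le_iff z H K _ _ := prioDigits_le_iff (cqaPrioSetup_levels z) H K
  mono _ _ h := h.prioDigits_le _

end
end GXPath

-- The five complexity bounds

open Machine GXPath
theorem mainTheorem5 {Lab : Type u} {Val : Type v} [Coded Lab] [Coded Val] (𝓛 𝓠 : Set (Expr Lab Val)) :
    InPi2 (cqaPrio 𝓛 𝓠 prioInclusion) ∧
    (∀ le : Lab ⊕ Val → Lab ⊕ Val → Prop, IsPartialOrder (Lab ⊕ Val) le →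
      InP (comparison (multisets le)) →
      InPi2 (cqa 𝓛 𝓠 (multisets le))) ∧
    InDelta2Log (cqa 𝓛 𝓠 cardinality) ∧
    (∀ w : Lab ⊕ Val → ℕ, PolyTimeComputable w →
      (∃ C : ℕ, ∀ x, w x ≤ C * 2 ^ (Coded.code x).length) →
      InDelta2 (cqa 𝓛 𝓠 (weights w))) ∧
    InDelta2 (cqaPrio 𝓛 𝓠 prioCardinality) := by
  refine ⟨?_, fun le _ h => inPi2_of_comparison h, ?_, fun w hw _ => (weights_valued hw.pf).inDelta2,
    prioCardinality_valued.inDelta2⟩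
  · exact (cqaPrioSetup 𝓛 𝓠 prioInclusion).inPi2 PF.prioInclusionB fun z H K _ _ =>
      prioInclusionB_iff (cqaPrioSetup_levels z) H K
  · rw [cardinality_eq]
    refine (weights_valued (.const 1)).inDelta2Log fun z => ?_
    -- With all weights `1`, the value of `G` is its number of facts, and each fact takes at least
    -- one bit of the input.
    refine le_trans (le_of_eq ?_) ((cqaSetup 𝓛 𝓠 _).length_le z)
    rw [bitsVal_weightBits]
    simp
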